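/- Consider the following two computational problems. LP: given a rational matrix $A\in\mathbb{Q}^{m\times n}$, a rational vector $b\in\mathbb{Q}^m$ and a rational vector $c\in\mathbb{Q}^n$, output a rational $x\in\operatorname{argmax}\{c^Tx : Ax\le b\}$ if $\max\{c^Tx : Ax\le b\}$ is finite; otherwise output INFEASIBLE if $\{x\in\mathbb{R}^n : Ax\le b\}$ is empty, and else output INFINITE. DVS (distance to a V-simplex): given $n\ge 1$ affinely independent rational points $p_1,\dots,p_n\in\mathbb{R}^d$ (so $n\le d+1$), which define the simplex $P=\operatorname{conv}\{p_1,\dots,p_n\}$, output the squared Euclidean distance $d(0,P)^2$. Theorem. LP reduces to DVS in strongly-polynomial time. That is, there are a single program that uses rational arithmetic ($+,-,\times,/$ and comparisons), index arithmetic and calls to an oracle, and two polynomials, such that the following holds for every oracle that answers all DVS instances correctly (its answers to other queries are arbitrary). On every LP instance, in which each entry is given by its numerator and denominator, the program outputs a correct LP solution; the number of its steps (arithmetic operations, comparisons, data transfers and oracle calls, a call being charged also for the entries of its query and of its answer) is bounded by the first polynomial in the dimension of the instance (how many rational numbers it has); and the binary encoding length of every rational number stored in the computation, including the answers of the oracle,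 is bounded by the second polynomial in the total binary encoding length of the instance, while all indices are bounded by the first polynomial in the dimension. -/

import Mathlib

/-!
# Strongly polynomial reductions between problems with rational data

Computational problems whose inputs consist of a few shape parameters and a list of rational
numbers, a uniform machine model for elementary rational arithmetic with an oracle, the notion of a
strongly polynomial time (oracle) reduction, and the two problems `LP` and `DVS`.
-/

namespace StrongPoly

/-! ## Inputs, sizes and problems -/

/-- A machine-readable input: the shape parameters (such as the numbers of rows and columns) and
the list of rational entries. -/
structure Datum where
  shape : List ℕ
  nums : List ℚ

/-- The binary encoding length `1 + ⌈log₂(|p| + 1)⌉ + ⌈log₂(q + 1)⌉` of a rational number `p / q`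
in lowest terms. -/
def ratSize (x : ℚ) : ℕ := 1 + Nat.size x.num.natAbs + Nat.size x.den

/-- The dimension of an input: how many rational numbers it has. -/
def Datum.dimension (w : Datum) : ℕ := w.nums.length

/-- The total encoding length of the numbers in an input. -/
def Datum.bitSize (w : Datum) : ℕ := (w.nums.map ratSize).sum

/-- A computational (search) problem: instances, possible outputs of an instance, the relation
saying which outputs are correct, and the encodings of instances and outputs. -/
structure Problem where
  Inst : Type
  Out : Inst → Type
  IsCorrect : (x : Inst) → Out x → Prop
  encInst : Inst → Datum
  encOut : (x : Inst) → Out x → List ℚ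

/-- An oracle answers every query by a list of rational numbers. -/
abbrev Oracle := Datum → List ℚ

/-- The oracle `O` solves `Q`: it answers every instance of `Q` by (the encoding of) a correct
output. Nothing is required about queries that do not encode instances of `Q`. -/
def Oracle.Solves (O : Oracle) (Q : Problem) : Prop :=
  ∀ x : Q.Inst, ∃ y : Q.Out x, Q.IsCorrect x y ∧ O (Q.encInst x) = Q.encOut x y

/-! ## The machine

Programs of a structured random access machine. The store has integer index variables
`i₀, i₁, …`, and arrays `M₀, M₁, …` of rational numbers. A program mentions finitely many
variables and arrays by name and reaches the entries of an array through computed indices. Rational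
numbers are manipulated only by `+`, `-`, `*`, `/` and comparisons; in particular no rounding, no
access to bits and no conversion of a rational number to an index is available. -/

/-- The contents of the store. -/
structure State where
  idx : ℕ → ℕ
  mem : ℕ → ℕ → ℚ

/-- Index expressions. Subtraction is truncated. -/
inductive IExpr where
  | const (k : ℕ)
  | var (v : ℕ)
  | add (e f : IExpr)
  | sub (e f : IExpr)
  | mul (e f : IExpr)

/-- Rational expressions; `cell a i` is the entry with index `i` of the array `a`. -/
inductive QExpr where
  | const (q : ℚ)
  | ofIdx (i : IExpr)
  | cell (a : ℕ) (i : IExpr)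
  | add (e f : QExpr)
  | sub (e f : QExpr)
  | mul (e f : QExpr)
  | div (e f : QExpr)

/-- Tests. -/
inductive Test where
  | ilt (e f : IExpr)
  | qlt (e f : QExpr)
  | neg (b : Test)
  | conj (b b' : Test)

/-- Programs. `call sh a len r` sends to the oracle the query with shape parameters `sh` and with
the first `len` entries of the array `a` as its rational numbers, and writes the answer to the
beginning of the array `r`. -/
inductive Program where
  | skip
  | setIdx (v : ℕ) (e : IExpr)
  | setCell (a : ℕ) (i : IExpr) (e : QExpr)
  | call (sh : List IExpr) (a : ℕ) (len : IExpr) (r : ℕ)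
  | seq (c c' : Program)
  | branch (b : Test) (c c' : Program)
  | loop (b : Test) (c : Program)

/-- The value of an index expression. -/
def IExpr.eval (s : State) : IExpr → ℕ
  | .const k => k
  | .var v => s.idx v
  | .add e f => e.eval s + f.eval s
  | .sub e f => e.eval s - f.eval s
  | .mul e f => e.eval s * f.eval s

/-- The value of a rational expression. A quotient with denominator `0` has the value `0`. -/
def QExpr.eval (s : State) : QExpr → ℚ
  | .const q => q
  | .ofIdx i => (i.eval s : ℚ)
  | .cell a i => s.mem a (i.eval s)
  | .add e f => e.eval s + f.eval s
  | .sub e f => e.eval s - f.eval s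
  | .mul e f => e.eval s * f.eval s
  | .div e f => e.eval s / f.eval s

/-- The truth of a test. -/
def Test.Holds (s : State) : Test → Prop
  | .ilt e f => e.eval s < f.eval s
  | .qlt e f => e.eval s < f.eval s
  | .neg b => ¬ b.Holds s
  | .conj b b' => b.Holds s ∧ b'.Holds s

/-- The number of elementary steps for evaluating an index expression. -/
def IExpr.cost : IExpr → ℕ
  | .const _ => 1
  | .var _ => 1
  | .add e f => e.cost + f.cost + 1
  | .sub e f => e.cost + f.cost + 1
  | .mul e f => e.cost + f.cost + 1

/-- The number of elementary steps for evaluating a rational expression. -/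
def QExpr.cost : QExpr → ℕ
  | .const _ => 1
  | .ofIdx i => i.cost + 1
  | .cell _ i => i.cost + 1
  | .add e f => e.cost + f.cost + 1
  | .sub e f => e.cost + f.cost + 1
  | .mul e f => e.cost + f.cost + 1
  | .div e f => e.cost + f.cost + 1

/-- The number of elementary steps for evaluating a test. -/
def Test.cost : Test → ℕ
  | .ilt e f => e.cost + f.cost + 1
  | .qlt e f => e.cost + f.cost + 1
  | .neg b => b.cost + 1
  | .conj b b' => b.cost + b'.cost + 1

/-- The store after assigning `k` to the index variable `v`. -/
def State.setIdx (s : State) (v k : ℕ) : State :=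
  { s with idx := fun u => if u = v then k else s.idx u }

/-- The store after assigning `x` to the entry `i` of the array `a`. -/
def State.setCell (s : State) (a i : ℕ) (x : ℚ) : State :=
  { s with mem := fun b j => if b = a ∧ j = i then x else s.mem b j }

/-- The store after writing the list `l` to the beginning of the array `a`. -/
def State.setList (s : State) (a : ℕ) (l : List ℚ) : State :=
  { s with mem := fun b j => if b = a then l.getD j (s.mem b j) else s.mem b j }

/-- The query that is sent by `Program.call sh a len r`. -/
def State.query (s : State) (sh : List IExpr) (a : ℕ) (len : IExpr) : Datum where
  shape := sh.map (IExpr.eval s)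
  nums := (List.range (len.eval s)).map (s.mem a)

/-- `Exec O K S c s s' t`: with the oracle `O`, the program `c`, started in the store `s`, halts in
the store `s'` after `t` steps, and on the way every number assigned to an index variable is at most
`K`, and every rational number written to an array (by an assignment or as an answer of the oracle)
has encoding length at most `S`. (The expressions are fixed with the program, so intermediate values
inside an expression are longer by at most a constant factor.)

An oracle call is charged with the number of its query and answer entries. -/
inductive Exec (O : Oracle) (K S : ℕ) : Program → State → State → ℕ → Prop where
  | skip (s : State) : Exec O K S .skip s s 1
  | setIdx (v : ℕ) (e : IExpr) (s : State) (h : e.eval s ≤ K) :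
      Exec O K S (.setIdx v e) s (s.setIdx v (e.eval s)) (e.cost + 1)
  | setCell (a : ℕ) (i : IExpr) (e : QExpr) (s : State) (h : ratSize (e.eval s) ≤ S) :
      Exec O K S (.setCell a i e) s (s.setCell a (i.eval s) (e.eval s)) (i.cost + e.cost + 1)
  | call (sh : List IExpr) (a : ℕ) (len : IExpr) (r : ℕ) (s : State)
      (h : ∀ x ∈ O (s.query sh a len), ratSize x ≤ S) :
      Exec O K S (.call sh a len r) s (s.setList r (O (s.query sh a len)))
        ((sh.map IExpr.cost).sum + len.cost + len.eval s + (O (s.query sh a len)).length + 1)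
  | seq {c c' : Program} {s s' s'' : State} {t t' : ℕ}
      (h : Exec O K S c s s' t) (h' : Exec O K S c' s' s'' t') :
      Exec O K S (.seq c c') s s'' (t + t')
  | branchTrue {b : Test} {c c' : Program} {s s' : State} {t : ℕ}
      (hb : b.Holds s) (h : Exec O K S c s s' t) :
      Exec O K S (.branch b c c') s s' (b.cost + t)
  | branchFalse {b : Test} {c c' : Program} {s s' : State} {t : ℕ}
      (hb : ¬ b.Holds s) (h : Exec O K S c' s s' t) :
      Exec O K S (.branch b c c') s s' (b.cost + t)
  | loopTrue {b : Test} {c : Program} {s s' s'' : State} {t t' : ℕ}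
      (hb : b.Holds s) (h : Exec O K S c s s' t) (h' : Exec O K S (.loop b c) s' s'' t') :
      Exec O K S (.loop b c) s s'' (b.cost + t + t')
  | loopFalse {b : Test} {c : Program} {s : State} (hb : ¬ b.Holds s) :
      Exec O K S (.loop b c) s s b.cost

/-- The initial store on the input `w`: the shape parameters are in the first index variables, the
numerators of the entries are in the array `0` and the (positive) denominators are in the array `1`
(each rational number is presented by numerator and denominator in lowest terms). -/
def State.init (w : Datum) : State where
  idx := fun v => w.shape.getD v 0
  mem := fun a j =>
    if a = 0 then ((w.nums.getD j 0).num : ℚ)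
    else if a = 1 ∧ j < w.nums.length then ((w.nums.getD j 0).den : ℚ)
    else 0

/-- The output `l` is found at the beginning of the array `0`. -/
def State.Outputs (s : State) (l : List ℚ) : Prop :=
  ∀ (j : ℕ) (h : j < l.length), s.mem 0 j = l[j]

/-- `P` reduces to `Q` in strongly polynomial time: there is one oracle program which, with any
oracle solving `Q`, solves every instance of `P`, such that
* the number of steps (arithmetic operations, comparisons, data transfers, oracle calls) is bounded
  by a polynomial in the dimension of the input, that is, in how many rational numbers it has;
* the indices are bounded by a polynomial in the dimension of the input, and the encoding length of
  every rational number in the computation is bounded by a polynomial in the encoding length of the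
  input. -/
def Reduces (P Q : Problem) : Prop :=
  ∃ (c : Program) (p q : Polynomial ℕ), ∀ O : Oracle, O.Solves Q → ∀ x : P.Inst,
    ∃ (y : P.Out x) (s : State) (t : ℕ),
      Exec O (p.eval (P.encInst x).dimension) (q.eval (P.encInst x).bitSize) c
        (State.init (P.encInst x)) s t ∧
      t ≤ p.eval (P.encInst x).dimension ∧
      s.Outputs (P.encOut x y) ∧
      P.IsCorrect x y

/-! ## Linear programming -/

/-- The data of a linear program `max {cᵀ x : A x ≤ b}`. -/
structure LPInst where
  m : ℕ
  n : ℕ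
  A : Matrix (Fin m) (Fin n) ℚ
  b : Fin m → ℚ
  c : Fin n → ℚ

/-- The polyhedron `{x ∈ ℝⁿ : A x ≤ b}`. -/
def LPInst.feasible (I : LPInst) : Set (Fin I.n → ℝ) :=
  {x | ∀ i, ∑ j, (I.A i j : ℝ) * x j ≤ (I.b i : ℝ)}

/-- The objective function `cᵀ x`. -/
def LPInst.objective (I : LPInst) (x : Fin I.n → ℝ) : ℝ := ∑ j, (I.c j : ℝ) * x j

/-- The outputs for a linear program with `n` unknowns. -/
inductive LPOut (n : ℕ) where
  | optimal (x : Fin n → ℚ)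
  | infeasible
  | infinite

/-- The correct outputs: a rational maximizer; or INFEASIBLE if there is no feasible point; or
INFINITE if there are feasible points, and the objective is unbounded above on them. -/
def LPInst.IsCorrect (I : LPInst) : LPOut I.n → Prop
  | .optimal x =>
      (fun j => (x j : ℝ)) ∈ I.feasible ∧
        ∀ z ∈ I.feasible, I.objective z ≤ I.objective (fun j => (x j : ℝ))
  | .infeasible => I.feasible = ∅
  | .infinite => I.feasible.Nonempty ∧ ¬ BddAbove (I.objective '' I.feasible)

/-- The entries of a matrix, row by row. -/
def rowMajor {m n : ℕ} (A : Fin m → Fin n → ℚ) : List ℚ :=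
  (List.ofFn fun i => List.ofFn (A i)).flatten

/-- Linear programming: given rational `A`, `b`, `c`, find a rational maximizer of `cᵀ x` subject
to `A x ≤ b`, or report that the problem is infeasible or has infinite value. -/
def LP : Problem where
  Inst := LPInst
  Out := fun I => LPOut I.n
  IsCorrect := LPInst.IsCorrect
  encInst := fun I => ⟨[I.m, I.n], rowMajor I.A ++ List.ofFn I.b ++ List.ofFn I.c⟩
  encOut := fun _ o =>
    match o with
    | .optimal x => 0 :: List.ofFn x
    | .infeasible => [1]
    | .infinite => [2]

/-! ## Distance to a simplex given by its vertices -/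

/-- The point of Euclidean space `ℝᵈ` with the given rational coordinates. -/
noncomputable def ratPoint {d : ℕ} (v : Fin d → ℚ) : EuclideanSpace ℝ (Fin d) :=
  WithLp.toLp 2 fun j => (v j : ℝ)

/-- The vertices of a simplex: `n ≥ 1` affinely independent rational points of `ℝᵈ` (hence
`n ≤ d + 1`). -/
structure DVSInst where
  d : ℕ
  n : ℕ
  pts : Fin n → Fin d → ℚ
  pos : 0 < n
  indep : AffineIndependent ℝ fun i => ratPoint (pts i)

/-- The simplex spanned by the points. -/
def DVSInst.simplex (I : DVSInst) : Set (EuclideanSpace ℝ (Fin I.d)) :=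
  convexHull ℝ (Set.range fun i => ratPoint (I.pts i))

/-- Distance to a simplex given by its vertices: given affinely independent rational points with
convex hull `P`, output the squared Euclidean distance `d(0, P)²`. -/
noncomputable def DVS : Problem where
  Inst := DVSInst
  Out := fun _ => ℚ
  IsCorrect := fun I r => (r : ℝ) = Metric.infDist 0 I.simplex ^ 2
  encInst := fun I => ⟨[I.d, I.n], rowMajor I.pts⟩
  encOut := fun _ r => [r]

end StrongPoly

open Matrix

set_option linter.unusedSectionVars false

namespace StrongPoly

/-! ## Nonnegative least squares over the rational numbers -/

section NNLS

variable {ι κ : Type*} [Fintype ι] [Fintype κ]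

/-! By duality, an optimal point of the LP can be read off from a nonnegative solution of A x⁺ - A
x⁻ + s = b, Aᵀy = σc, σcᵀ(x⁺ - x⁻) = bᵀy with σ = 1. With σ = 0 the choice y = 0 is allowed, so
solvability means feasibility of the LP. It therefore suffices to decide whether a vector β lies in
the cone spanned by given columns a_i, and to find coefficients if it does. If it does not, the
residual of the nearest point of the cone is a Farkas certificate (`alternative`), from which
`infeasible_of_not_coneMem` and `infinite_of_not_coneMem` follow; `optimal_of_resid` is weak
duality.

A `DVS` oracle measures the distance from β to a cone. If the v_i are independent, the simplex with
vertices -β and L v_i - β is a truncation of the cone translated by -β, and it has the same distance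
to the origin once L is at least the coefficient sum of the nearest point (`conePts_infDist`).
Dependent columns are made independent by giving each an extra coordinate: v_i = (E a_i, e_i), with
target (Eβ, 0). The answer is then the minimum over l ≥ 0 of E²|β - ∑ l_i a_i|² + ∑ l_i². For
integer data Cramer's rule (`exists_small_coeffs`) gives a number B such that nearest-point
coefficients are at most B and nonzero squared distances are at least 1/B. With E = (N+1)B² the
answer is below E exactly when β is in the cone (`coneMem_iff_lt`).

To find a solution, columns are dropped greedily while the system stays solvable. The surviving
columns are independent and their unique solution l is positive (`exists_minimal_solution`). For a
surviving column j, the extra coordinates of the other surviving columns are switched off, and the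
target gets the value y in coordinate j. Since E is large, the sign constraints are inactive and the
answer is c(l_j - y)² with an unknown c ≠ 0 (`value_eq_mul_sq`); the answers for y = 0, 1, 2
determine l_j by arithmetic (`coeff_eq`).

The step count depends on the dimension only, because all loops, including those that form the
powers B and L, run over rows, columns or input entries. The numbers stay short because each
constant has polynomially many bits and, by `GramBound.value`, the answers have small numerators and
denominators. -/

theorem dotProduct_self_nonneg_rat (x : κ → ℚ) : 0 ≤ x ⬝ᵥ x :=
  Finset.sum_nonneg fun i _ => mul_self_nonneg (x i)

/-- The residual `β - ∑ i, l i • v i`. -/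
def resid (v : ι → κ → ℚ) (β : κ → ℚ) (l : ι → ℚ) : κ → ℚ := β - ∑ i, l i • v i

theorem resid_dotProduct (v : ι → κ → ℚ) (β : κ → ℚ) (l : ι → ℚ) (x : κ → ℚ) :
    resid v β l ⬝ᵥ x = β ⬝ᵥ x - ∑ i, l i * (v i ⬝ᵥ x) := by
  simp [resid, sub_dotProduct, sum_dotProduct, smul_dotProduct]

theorem resid_eq_add (v : ι → κ → ℚ) (β : κ → ℚ) (l μ : ι → ℚ) :
    resid v β μ = resid v β l + ∑ i, (l i - μ i) • v i := by
  simp [resid, sub_smul, Finset.sum_sub_distrib]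

theorem dotProduct_add_self (x y : κ → ℚ) :
    (x + y) ⬝ᵥ (x + y) = x ⬝ᵥ x + 2 * (x ⬝ᵥ y) + y ⬝ᵥ y := by
  rw [add_dotProduct, dotProduct_add, dotProduct_add, dotProduct_comm y x]; ring

theorem dotProduct_comb (v : ι → κ → ℚ) (g : ι → ℚ) (x : κ → ℚ) :
    x ⬝ᵥ ∑ i, g i • v i = ∑ i, g i * (x ⬝ᵥ v i) := by
  simp [dotProduct_sum, dotProduct_smul]

/-- Expanding the second square around the residual of l leaves a linear term, nonnegative by `h`,
and a square. All later optimality comparisons, with or without sign constraints, are instances of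
this first-order condition. -/
theorem resid_sq_le {v : ι → κ → ℚ} {β : κ → ℚ} {l μ : ι → ℚ}
    (h : ∀ i, 0 ≤ (l i - μ i) * (resid v β l ⬝ᵥ v i)) :
    resid v β l ⬝ᵥ resid v β l ≤ resid v β μ ⬝ᵥ resid v β μ := by
  rw [resid_eq_add v β l μ, dotProduct_add_self, dotProduct_comb]
  have h1 := Finset.sum_nonneg fun i (_ : i ∈ Finset.univ) => h i
  have h2 := dotProduct_self_nonneg_rat (∑ i, (l i - μ i) • v i)
  linarith

/-- The family `v` is linearly independent on `S`. -/
def FamIndep (v : ι → κ → ℚ) (S : Finset ι) : Prop :=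
  ∀ g : ι → ℚ, (∀ i, i ∉ S → g i = 0) → ∑ i, g i • v i = 0 → ∀ i, g i = 0

theorem FamIndep.mono {v : ι → κ → ℚ} {S T : Finset ι} (h : FamIndep v T) (hST : S ⊆ T) :
    FamIndep v S :=
  fun g hg => h g fun i hi => hg i fun hS => hi (hST hS)

variable [DecidableEq ι]

/-- The Gram matrix of the vectors `v i` with `i ∈ S`, extended by an identity matrix. -/
def gramOn {R : Type*} [CommRing R] (v : ι → κ → R) (S : Finset ι) : Matrix ι ι R :=
  Matrix.of fun i j => if i ∈ S ∧ j ∈ S then v i ⬝ᵥ v j else if i = j then 1 else 0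

theorem gramOn_mulVec_mem {v : ι → κ → ℚ} {S : Finset ι} {g : ι → ℚ} (hg : ∀ i, i ∉ S → g i = 0)
    {i : ι} (hi : i ∈ S) : (gramOn v S *ᵥ g) i = (∑ j, g j • v j) ⬝ᵥ v i := by
  rw [dotProduct_comm, dotProduct_comb]
  refine Finset.sum_congr rfl fun j _ => ?_
  by_cases hj : j ∈ S
  · simp [gramOn, hi, hj, mul_comm]
  · simp [hg j hj]

theorem gramOn_mulVec_notMem {v : ι → κ → ℚ} {S : Finset ι} (g : ι → ℚ) {i : ι} (hi : i ∉ S) :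
    (gramOn v S *ᵥ g) i = g i := by
  simp [gramOn, hi, Matrix.mulVec, dotProduct]

/-- The identity block forces a kernel vector g to vanish off S; then |∑ g_i v_i|² = gᵀGg = 0, and
independence gives g = 0. -/
theorem gramOn_det_ne_zero {v : ι → κ → ℚ} {S : Finset ι} (h : FamIndep v S) :
    (gramOn v S).det ≠ 0 := by
  intro h0
  obtain ⟨g, hg0, hg⟩ := Matrix.exists_mulVec_eq_zero_iff.mpr h0
  have hoff : ∀ i, i ∉ S → g i = 0 := fun i hi => by
    rw [← gramOn_mulVec_notMem (v := v) g hi, hg]; rfl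
  apply hg0
  funext i
  refine h g hoff ?_ i
  rw [← dotProduct_self_eq_zero, dotProduct_comb]
  refine Finset.sum_eq_zero fun i _ => ?_
  by_cases hi : i ∈ S
  · rw [← gramOn_mulVec_mem hoff hi, hg]; simp
  · simp [hoff i hi]

/-- The orthogonal projection of `β` to the span of the vectors `v i` with `i ∈ S`. -/
theorem exists_projection {v : ι → κ → ℚ} {S : Finset ι} (h : FamIndep v S) (β : κ → ℚ) :
    ∃ μ : ι → ℚ, (∀ i, i ∉ S → μ i = 0) ∧ ∀ i ∈ S, resid v β μ ⬝ᵥ v i = 0 := by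
  have hu : IsUnit (gramOn v S).det := (gramOn_det_ne_zero h).isUnit
  -- Normal equations. The zeros off S make the solution vanish there, through the identity block.
  set b : ι → ℚ := fun i => if i ∈ S then β ⬝ᵥ v i else 0 with hb
  have hμ : gramOn v S *ᵥ ((gramOn v S)⁻¹ *ᵥ b) = b := by
    rw [Matrix.mulVec_mulVec, Matrix.mul_nonsing_inv _ hu, Matrix.one_mulVec]
  have hoff : ∀ i, i ∉ S → ((gramOn v S)⁻¹ *ᵥ b) i = 0 := fun i hi => by
    rw [← gramOn_mulVec_notMem (v := v) ((gramOn v S)⁻¹ *ᵥ b) hi, hμ]; simp [hb, hi]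
  refine ⟨_, hoff, fun i hi => ?_⟩
  have := congrFun hμ i
  rw [gramOn_mulVec_mem hoff hi] at this
  rw [resid, sub_dotProduct, this]
  simp [hb, hi]

/-- The support of a vector of coefficients. -/
def supp (l : ι → ℚ) : Finset ι := Finset.univ.filter fun i => l i ≠ 0

theorem mem_supp {l : ι → ℚ} {i : ι} : i ∈ supp l ↔ l i ≠ 0 := by simp [supp]

theorem notMem_supp {l : ι → ℚ} {i : ι} : i ∉ supp l ↔ l i = 0 := by simp [supp]

/-- Moving from a nonnegative point in a direction with a negative entry until an entry vanishes. -/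
theorem exists_move {l g : ι → ℚ} (hl : ∀ i, 0 ≤ l i) (hg : ∀ i, l i = 0 → g i = 0)
    {i₀ : ι} (hi₀ : g i₀ < 0) :
    ∃ t : ℚ, 0 ≤ t ∧ (∀ i, 0 ≤ l i + t * g i) ∧ supp (fun i => l i + t * g i) ⊂ supp l := by
  -- Ratio test: the entry k with the smallest ratio is the first one to reach zero.
  obtain ⟨k, hk, hmin⟩ := Finset.exists_min_image (Finset.univ.filter fun i => g i < 0)
    (fun i => l i / (-g i)) ⟨i₀, by simp [hi₀]⟩
  have hk' : g k < 0 := by simpa using hk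
  refine ⟨l k / (-g k), div_nonneg (hl k) (by linarith), fun i => ?_, ?_⟩
  · rcases lt_or_ge (g i) 0 with hi | hi
    · have := hmin i (by simp [hi])
      rw [le_div_iff₀ (by linarith)] at this
      linarith
    · have : 0 ≤ l k / (-g k) * g i := mul_nonneg (div_nonneg (hl k) (by linarith)) hi
      linarith [hl i]
  · refine Finset.ssubset_iff_subset_ne.mpr ⟨fun i hi => ?_, fun h => ?_⟩
    · rw [mem_supp] at hi ⊢
      intro h0
      exact hi (by simp [h0, hg i h0])
    · have h1 : k ∈ supp l := by
        rw [mem_supp]; intro h0; rw [hg k h0] at hk'; exact lt_irrefl _ hk'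
      rw [← h, mem_supp] at h1
      apply h1
      have : g k ≠ 0 := hk'.ne
      field_simp
      ring

/-- `l` is nonnegative, its support is independent, and it describes the orthogonal projection of
`β` to the span of its support. -/
structure Stationary (v : ι → κ → ℚ) (β : κ → ℚ) (l : ι → ℚ) : Prop where
  nonneg : ∀ i, 0 ≤ l i
  indep : FamIndep v (supp l)
  ortho : ∀ i, l i ≠ 0 → resid v β l ⬝ᵥ v i = 0

/-- Induction on the size of the support. If the support is dependent, a move along a linear
relation kills an entry and keeps the residual, as in Carathéodory's theorem. If it is independent,
either the projection has nonnegative coefficients, or moving towards it kills an entry without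
increasing the residual. -/
theorem exists_stationary_le (v : ι → κ → ℚ) (β : κ → ℚ) (l : ι → ℚ) (hl : ∀ i, 0 ≤ l i) :
    ∃ μ, Stationary v β μ ∧ resid v β μ ⬝ᵥ resid v β μ ≤ resid v β l ⬝ᵥ resid v β l := by
  induction hn : (supp l).card using Nat.strong_induction_on generalizing l with
  | _ n ih =>
  have key : ∀ g : ι → ℚ, (∀ i, l i = 0 → g i = 0) → (∃ i, g i < 0) →
      (∀ t : ℚ, 0 ≤ t → (∀ i, 0 ≤ l i + t * g i) →
        resid v β (fun i => l i + t * g i) ⬝ᵥ resid v β (fun i => l i + t * g i) ≤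
          resid v β l ⬝ᵥ resid v β l) →
      ∃ μ, Stationary v β μ ∧ resid v β μ ⬝ᵥ resid v β μ ≤ resid v β l ⬝ᵥ resid v β l := by
    rintro g hg ⟨i₀, hi₀⟩ hle
    obtain ⟨t, ht, hnn, hss⟩ := exists_move hl hg hi₀
    obtain ⟨μ, hμ, hle'⟩ := ih _ (hn ▸ Finset.card_lt_card hss) _ hnn rfl
    exact ⟨μ, hμ, hle'.trans (hle t ht hnn)⟩
  by_cases hind : FamIndep v (supp l)
  · obtain ⟨μ, hoff, hort⟩ := exists_projection hind β
    have hle : resid v β μ ⬝ᵥ resid v β μ ≤ resid v β l ⬝ᵥ resid v β l := by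
      apply resid_sq_le
      intro i
      by_cases hi : i ∈ supp l
      · rw [hort i hi]; simp
      · rw [hoff i hi, notMem_supp.mp hi]; simp
    by_cases hμ : ∀ i, 0 ≤ μ i
    · have hsub : supp μ ⊆ supp l := fun i hi => by
        by_contra h; exact mem_supp.mp hi (hoff i h)
      exact ⟨μ, ⟨hμ, hind.mono hsub, fun i hi => hort i (hsub (mem_supp.mpr hi))⟩, hle⟩
    · push Not at hμ
      obtain ⟨i₀, hi₀⟩ := hμ
      refine key (fun i => μ i - l i) (fun i hi => ?_) ⟨i₀, by linarith [hl i₀]⟩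
        fun t ht hnn => ?_
      · rw [hi, hoff i (notMem_supp.mpr hi)]; simp
      -- Entry i₀ at time t is (1 - t) l + t μ with μ < 0 ≤ l, which is negative for t > 1.
      have ht1 : t ≤ 1 := by
        by_contra hlt
        push Not at hlt
        have h1 := hnn i₀
        nlinarith [hl i₀, mul_nonneg (hl i₀) (sub_nonneg.mpr hlt.le)]
      have h1 : resid v β (fun i => l i + t * (μ i - l i)) =
          resid v β μ + (1 - t) • ∑ i, (μ i - l i) • v i := by
        rw [resid_eq_add v β μ, Finset.smul_sum]
        congr 1
        refine Finset.sum_congr rfl fun i _ => ?_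
        rw [smul_smul]; congr 1; ring
      have h2 : resid v β l = resid v β μ + ∑ i, (μ i - l i) • v i := resid_eq_add ..
      have h3 : resid v β μ ⬝ᵥ ∑ i, (μ i - l i) • v i = 0 := by
        rw [dotProduct_comb]
        refine Finset.sum_eq_zero fun i _ => ?_
        by_cases hi : i ∈ supp l
        · rw [hort i hi]; simp
        · rw [hoff i hi, notMem_supp.mp hi]; simp
      rw [h1, h2, dotProduct_add_self, dotProduct_add_self, dotProduct_smul, h3, smul_dotProduct,
        dotProduct_smul]
      have h4 := dotProduct_self_nonneg_rat (∑ i, (μ i - l i) • v i)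
      simp only [smul_eq_mul]
      -- By Pythagoras the squares differ by 1 - (1 - t)² = t(2 - t) times the squared length of the
      -- displacement.
      nlinarith [mul_nonneg (mul_nonneg ht (by linarith : (0:ℚ) ≤ 2 - t)) h4]
  · unfold FamIndep at hind
    push Not at hind
    obtain ⟨g, hoff, hg0, i₁, hi₁⟩ := hind
    have hconst : ∀ s t : ℚ, resid v β (fun i => l i + t * (s * g i)) = resid v β l := by
      intro s t
      rw [resid_eq_add v β l]
      have : ∑ i, (l i - (l i + t * (s * g i))) • v i = (-(t * s)) • ∑ i, g i • v i := by
        rw [Finset.smul_sum]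
        refine Finset.sum_congr rfl fun i _ => ?_
        rw [smul_smul]; congr 1; ring
      rw [this, hg0]; simp
    -- The sign of the relation is chosen so that it has a negative entry, as `key` requires.
    rcases lt_or_gt_of_ne hi₁ with hi | hi
    · refine key (fun i => 1 * g i) (fun i h => ?_) ⟨i₁, by simpa using hi⟩ fun t _ _ => ?_
      · simp [hoff i (notMem_supp.mpr h)]
      · simp only [hconst]; exact le_rfl
    · refine key (fun i => (-1) * g i) (fun i h => ?_) ⟨i₁, by simpa using hi⟩ fun t _ _ => ?_
      · simp [hoff i (notMem_supp.mpr h)]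
      · simp only [hconst]; exact le_rfl

/-- The optimality conditions for the nearest point of `β` in the cone generated by `v`, with
coefficients whose support is independent. -/
structure IsNNLS (v : ι → κ → ℚ) (β : κ → ℚ) (l : ι → ℚ) : Prop extends Stationary v β l where
  dot_le : ∀ i, resid v β l ⬝ᵥ v i ≤ 0

/-- Compactness is not available over ℚ. Instead, the residual length of a stationary point depends
only on its support, so a best one exists among finitely many supports, and `exists_stationary_le`
makes it a global minimum. A violated inequality at j would allow an improvement along v_j. -/
theorem exists_isNNLS (v : ι → κ → ℚ) (β : κ → ℚ) : ∃ l, IsNNLS v β l := by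
  classical
  set F : Finset (Finset ι) := Finset.univ.filter fun S => ∃ l, Stationary v β l ∧ supp l = S
  have hF : ∀ S : F, ∃ l, Stationary v β l ∧ supp l = S := fun S => (Finset.mem_filter.mp S.2).2
  choose f hf hfS using hF
  obtain ⟨l₀, hl₀, -⟩ := exists_stationary_le v β (fun _ => 0) fun _ => le_rfl
  have hmem : ∀ l, Stationary v β l → supp l ∈ F := fun l hl => by
    simp only [F, Finset.mem_filter, Finset.mem_univ, true_and]; exact ⟨l, hl, rfl⟩
  obtain ⟨S, -, hS⟩ := Finset.exists_min_image F.attach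
    (fun S => resid v β (f S) ⬝ᵥ resid v β (f S)) ⟨⟨_, hmem l₀ hl₀⟩, Finset.mem_attach _ _⟩
  have hbest : ∀ l, (∀ i, 0 ≤ l i) →
      resid v β (f S) ⬝ᵥ resid v β (f S) ≤ resid v β l ⬝ᵥ resid v β l := by
    intro l hl
    obtain ⟨μ, hμ, hle⟩ := exists_stationary_le v β l hl
    refine le_trans ((hS ⟨_, hmem μ hμ⟩ (Finset.mem_attach _ _)).trans ?_) hle
    set ν := f ⟨_, hmem μ hμ⟩ with hν
    -- Here μ and ν have the same support, and ν is a projection to its span, so every term of the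
    -- criterion vanishes.
    apply resid_sq_le
    intro i
    by_cases hi : ν i = 0
    · have : μ i = 0 := by
        have h := hfS ⟨_, hmem μ hμ⟩
        simp only at h
        rw [← notMem_supp, ← h, notMem_supp]; exact hi
      simp [hi, this]
    · rw [(hf ⟨_, hmem μ hμ⟩).ortho i hi]; simp
  refine ⟨f S, { hf S with dot_le := fun j => ?_ }⟩
  by_contra! hpos
  set w := resid v β (f S) with hw
  have hvj : 0 < v j ⬝ᵥ v j := by
    refine lt_of_le_of_ne (dotProduct_self_nonneg_rat _) fun h => ?_
    rw [dotProduct_self_eq_zero.mp h.symm, dotProduct_zero] at hpos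
    exact lt_irrefl _ hpos
  -- Exact line search along v_j; the squared residual drops by t times w ⬝ᵥ v j.
  set t := (w ⬝ᵥ v j) / (v j ⬝ᵥ v j) with ht
  have h1 : resid v β (fun i => f S i + if i = j then t else 0) = w + (-t) • v j := by
    rw [resid_eq_add v β (f S), ← hw]
    congr 1
    rw [Finset.sum_eq_single j]
    · simp
    · intro i _ hi; simp [hi]
    · simp
  have h2 := hbest (fun i => f S i + if i = j then t else 0) fun i =>
    add_nonneg ((hf S).nonneg i) (by split_ifs <;> positivity)
  rw [h1, dotProduct_add_self, dotProduct_smul, dotProduct_smul, smul_dotProduct] at h2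
  simp only [smul_eq_mul] at h2
  have h3 : t * (v j ⬝ᵥ v j) = w ⬝ᵥ v j := by rw [ht]; field_simp
  have h5 : -t * (-t * (v j ⬝ᵥ v j)) = t * (w ⬝ᵥ v j) := by rw [← h3]; ring
  rw [h5] at h2
  have h4 : 0 < t := div_pos hpos hvj
  nlinarith [mul_pos h4 hpos]

theorem IsNNLS.mul_dot {v : ι → κ → ℚ} {β : κ → ℚ} {l : ι → ℚ} (h : IsNNLS v β l) (i : ι) :
    l i * (resid v β l ⬝ᵥ v i) = 0 := by
  by_cases hi : l i = 0
  · simp [hi]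
  · simp [h.ortho i hi]

theorem IsNNLS.resid_sq_le {v : ι → κ → ℚ} {β : κ → ℚ} {l μ : ι → ℚ} (h : IsNNLS v β l)
    (hμ : ∀ i, 0 ≤ μ i) : resid v β l ⬝ᵥ resid v β l ≤ resid v β μ ⬝ᵥ resid v β μ := by
  apply StrongPoly.resid_sq_le
  intro i
  rw [sub_mul, h.mul_dot]
  nlinarith [mul_nonneg (hμ i) (sub_nonneg.mpr (h.dot_le i))]

/-- The residual is orthogonal to the nearest point β - r itself. This puts the vertex -β on the
supporting hyperplane of the simplex, gives strictness in Farkas' lemma, and lets one common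
denominator clear a squared length. -/
theorem resid_self_eq {v : ι → κ → ℚ} {β : κ → ℚ} {l : ι → ℚ}
    (h : ∀ i, l i * (resid v β l ⬝ᵥ v i) = 0) :
    resid v β l ⬝ᵥ resid v β l = β ⬝ᵥ resid v β l := by
  conv_lhs => rw [resid_dotProduct]
  rw [Finset.sum_eq_zero fun i _ => by rw [dotProduct_comm, h i], sub_zero]

theorem intCast_dotProduct (x y : κ → ℤ) :
    (fun k => (x k : ℚ)) ⬝ᵥ (fun k => (y k : ℚ)) = ((x ⬝ᵥ y : ℤ) : ℚ) := by
  simp [dotProduct]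

/-- Cramer's rule: the coefficients of a projection of integer data have small numerators and a
small common denominator. -/
theorem exists_small_coeffs {v : ι → κ → ℤ} {β : κ → ℤ} {S : Finset ι}
    (hS : FamIndep (fun i k => (v i k : ℚ)) S) {l : ι → ℚ} (hl : ∀ i, i ∉ S → l i = 0)
    (hort : ∀ i ∈ S, resid (fun i k => (v i k : ℚ)) (fun k => (β k : ℚ)) l ⬝ᵥ
      (fun k => (v i k : ℚ)) = 0)
    {X : ℤ} (hX : 1 ≤ X) (hv : ∀ i j, |v i ⬝ᵥ v j| ≤ X) (hβ : ∀ i, |v i ⬝ᵥ β| ≤ X) :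
    ∃ (Q : ℤ) (z : ι → ℤ), 1 ≤ Q ∧
      Q ≤ (Fintype.card ι).factorial * X ^ Fintype.card ι ∧
      ∀ i, (Q : ℚ) * l i = z i ∧ |z i| ≤ (Fintype.card ι).factorial * X ^ Fintype.card ι := by
  set G := gramOn v S with hG
  set b : ι → ℤ := fun i => if i ∈ S then v i ⬝ᵥ β else 0 with hb
  have hmap : gramOn (fun i k => (v i k : ℚ)) S = G.map (Int.castRingHom ℚ) := by
    ext i j
    simp only [gramOn, of_apply, hG, map_apply, intCast_dotProduct]
    split_ifs <;> simp
  have hdet : (gramOn (fun i k => (v i k : ℚ)) S).det = ((G.det : ℤ) : ℚ) := by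
    rw [hmap]; exact (RingHom.map_det (Int.castRingHom ℚ) G).symm
  have hd0 : G.det ≠ 0 := by
    intro h0
    apply gramOn_det_ne_zero hS
    rw [hdet, h0]; simp
  have hb' : gramOn (fun i k => (v i k : ℚ)) S *ᵥ l = fun i => (b i : ℚ) := by
    funext i
    by_cases hi : i ∈ S
    · have h1 := hort i hi
      rw [resid, sub_dotProduct, sub_eq_zero] at h1
      rw [gramOn_mulVec_mem hl hi, ← h1, dotProduct_comm, intCast_dotProduct]
      simp [hb, hi]
    · rw [gramOn_mulVec_notMem _ hi, hl i hi]; simp [hb, hi]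
  -- Multiplying the normal equations by the adjugate gives Cramer's rule; both determinants are
  -- integers because the Gram data are.
  have hcr : ∀ i, ((G.det : ℤ) : ℚ) * l i = ((G.cramer b i : ℤ) : ℚ) := by
    intro i
    have h1 := congrArg (fun x => ((gramOn (fun i k => (v i k : ℚ)) S).adjugate *ᵥ x) i) hb'
    simp only [Matrix.mulVec_mulVec, Matrix.adjugate_mul, Matrix.smul_mulVec, Matrix.one_mulVec,
      ← Matrix.cramer_eq_adjugate_mulVec, Pi.smul_apply, smul_eq_mul] at h1
    rw [hdet] at h1
    rw [h1, Matrix.cramer_apply, Matrix.cramer_apply]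
    have : (gramOn (fun i k => (v i k : ℚ)) S).updateCol i (fun i => (b i : ℚ)) =
        (G.updateCol i b).map (Int.castRingHom ℚ) := by
      rw [hmap]; ext j k; simp only [Matrix.updateCol_apply, Matrix.map_apply]; split_ifs <;> simp
    rw [this]; exact (RingHom.map_det (Int.castRingHom ℚ) _).symm
  have hent : ∀ i j, |G i j| ≤ X := by
    intro i j
    simp only [hG, gramOn, of_apply]
    split_ifs
    · exact hv i j
    · simpa using hX
    · simp; linarith
  have hbb : ∀ i, |b i| ≤ X := by
    intro i
    simp only [hb]
    split_ifs
    · exact hβ i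
    · simp; linarith
  have hdle : |G.det| ≤ (Fintype.card ι).factorial * X ^ Fintype.card ι := by
    have := Matrix.det_le (A := G) (abv := AbsoluteValue.abs) (x := X) hent
    simpa using this
  have hcle : ∀ i, |G.cramer b i| ≤ (Fintype.card ι).factorial * X ^ Fintype.card ι := by
    intro i
    rw [Matrix.cramer_apply]
    have := Matrix.det_le (A := G.updateCol i b) (abv := AbsoluteValue.abs) (x := X) fun j k => by
      rw [Matrix.updateCol_apply]; split_ifs
      · exact hbb j
      · exact hent j k
    simpa using this
  -- The sign of the determinant moves to the numerators, so that the common denominator is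
  -- positive.
  refine ⟨|G.det|, fun i => G.det.sign * G.cramer b i, Int.one_le_abs hd0, hdle,
    fun i => ⟨?_, ?_⟩⟩
  · rw [← Int.sign_mul_self_eq_abs, Int.cast_mul, Int.cast_mul, mul_assoc, hcr]
  · rw [abs_mul]
    refine le_trans ?_ (hcle i)
    refine mul_le_of_le_one_left (abs_nonneg _) ?_
    rcases lt_trichotomy G.det 0 with h | h | h <;>
      simp [h, Int.sign_eq_one_of_pos, Int.sign_eq_neg_one_of_neg]

end NNLS

/-! ## The distance to a simplex with one vertex `-β` and the other vertices in a cone -/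

/-- Independence passes from ℚ to ℝ because a nonzero rational Gram determinant stays nonzero;
`DVSInst` asks for independence over ℝ. -/
theorem FamIndep.real {ι κ : Type*} [Fintype ι] [Fintype κ] [DecidableEq ι] {v : ι → κ → ℚ}
    (h : FamIndep v Finset.univ) {x : ι → ℝ} (hx : ∀ k, ∑ i, x i * (v i k : ℝ) = 0) : x = 0 := by
  have hdet : ((gramOn v Finset.univ).map (Rat.castHom ℝ)).det ≠ 0 := by
    have := gramOn_det_ne_zero h
    have h2 := (RingHom.map_det (Rat.castHom ℝ) (gramOn v Finset.univ)).symm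
    rw [RingHom.mapMatrix_apply] at h2
    rw [h2]
    simpa using this
  refine Matrix.eq_zero_of_mulVec_eq_zero hdet ?_
  funext i
  have : ∑ k, (v i k : ℝ) * ∑ j, x j * (v j k : ℝ) = 0 := by simp [hx]
  rw [Pi.zero_apply, ← this]
  simp only [Matrix.mulVec, dotProduct, Matrix.map_apply, gramOn, of_apply, Finset.mem_univ,
    and_self, if_true, eq_ratCast]
  push_cast
  simp only [Finset.sum_mul, Finset.mul_sum]
  rw [Finset.sum_comm]
  refine Finset.sum_congr rfl fun k _ => Finset.sum_congr rfl fun j _ => by ring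

theorem inner_ratPoint {d : ℕ} (x y : Fin d → ℚ) :
    inner ℝ (ratPoint x) (ratPoint y) = ((x ⬝ᵥ y : ℚ) : ℝ) := by
  simp [ratPoint, EuclideanSpace.inner_eq_star_dotProduct, dotProduct, mul_comm]

/-- The half-space ⟨w, ·⟩ ≥ |w|² contains the vertices, hence the simplex, and Cauchy–Schwarz bounds
the norm on it from below by |w|, which is attained at w. -/
theorem infDist_sq_eq {n d : ℕ} (P : Fin n → Fin d → ℚ) (w : Fin d → ℚ) (a : Fin n → ℚ)
    (ha : ∀ i, 0 ≤ a i) (hs : ∑ i, a i = 1) (hw : ∑ i, a i • P i = w)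
    (hP : ∀ i, w ⬝ᵥ w ≤ w ⬝ᵥ P i) :
    Metric.infDist 0 (convexHull ℝ (Set.range fun i => ratPoint (P i))) ^ 2 =
      ((w ⬝ᵥ w : ℚ) : ℝ) := by
  set C := convexHull ℝ (Set.range fun i => ratPoint (P i)) with hC
  have hmem : ratPoint w ∈ C := by
    refine mem_convexHull_of_exists_fintype (fun i => (a i : ℝ)) (fun i => ratPoint (P i))
      (fun i => by exact_mod_cast ha i) (by exact_mod_cast hs) (fun i => ⟨i, rfl⟩) ?_
    rw [← hw]
    ext k
    simp [ratPoint, Finset.sum_apply]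
  have hle : ∀ y ∈ C, ((w ⬝ᵥ w : ℚ) : ℝ) ≤ inner ℝ (ratPoint w) y := by
    have : C ⊆ {y | ((w ⬝ᵥ w : ℚ) : ℝ) ≤ inner ℝ (ratPoint w) y} := by
      refine convexHull_min ?_ ?_
      · rintro _ ⟨i, rfl⟩
        simp only [Set.mem_ofPred_eq, inner_ratPoint]
        exact_mod_cast hP i
      · exact convex_halfSpace_ge (innerₛₗ ℝ (ratPoint w)).isLinear _
    exact this
  have hnorm : ‖ratPoint w‖ ^ 2 = ((w ⬝ᵥ w : ℚ) : ℝ) := by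
    rw [← inner_ratPoint, real_inner_self_eq_norm_sq]
  have hdist : Metric.infDist 0 C = ‖ratPoint w‖ := by
    apply le_antisymm
    · have := Metric.infDist_le_dist_of_mem (x := 0) hmem
      simpa using this
    · rw [Metric.le_infDist ⟨_, hmem⟩]
      intro y hy
      rw [dist_zero_left]
      have h1 := hle y hy
      rw [← hnorm] at h1
      have h2 := real_inner_le_norm (ratPoint w) y
      by_contra! hlt
      have h3 : 0 < ‖ratPoint w‖ := lt_of_le_of_lt (norm_nonneg _) hlt
      nlinarith [mul_lt_mul_of_pos_left hlt h3]
  rw [hdist, hnorm]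

/-- The points `L • v i - β` and `-β`. -/
def conePts {N d : ℕ} (v : Fin N → Fin d → ℚ) (β : Fin d → ℚ) (L : ℚ) :
    Fin (N + 1) → Fin d → ℚ :=
  Fin.lastCases (-β) fun i => L • v i - β

theorem conePts_castSucc {N d : ℕ} (v : Fin N → Fin d → ℚ) (β : Fin d → ℚ) (L : ℚ) (i : Fin N) :
    conePts v β L i.castSucc = L • v i - β := by simp [conePts]

theorem conePts_last {N d : ℕ} (v : Fin N → Fin d → ℚ) (β : Fin d → ℚ) (L : ℚ) :
    conePts v β L (Fin.last N) = -β := by simp [conePts]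

/-- In an affine relation the weights sum to zero, so the translation by -β cancels and a linear
relation among the v_i is left. Hence β may be arbitrary. -/
theorem conePts_affineIndependent {N d : ℕ} {v : Fin N → Fin d → ℚ} (β : Fin d → ℚ) {L : ℚ}
    (hL : 0 < L) (h : FamIndep v Finset.univ) :
    AffineIndependent ℝ fun i => ratPoint (conePts v β L i) := by
  rw [affineIndependent_iff_of_fintype]
  intro x hx hx0
  rw [Finset.weightedVSub_eq_linear_combination _ hx] at hx0
  have h0 : (fun i : Fin N => x i.castSucc * (L : ℝ)) = 0 := by
    refine h.real fun k => ?_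
    have h1 := congrArg (fun z : EuclideanSpace ℝ (Fin d) => z k) hx0
    simp only [Fin.sum_univ_castSucc, conePts_castSucc, conePts_last] at h1 hx
    simp [ratPoint, mul_sub, Finset.sum_sub_distrib, ← Finset.sum_mul] at h1
    have h2 : x (Fin.last N) = - ∑ i : Fin N, x i.castSucc := by linarith
    rw [h2] at h1
    rw [← sub_eq_zero.mp (by linarith : (∑ i : Fin N, x i.castSucc * ((L:ℝ) * (v i k : ℝ))) - 0 = 0)]
    exact Finset.sum_congr rfl fun i _ => by ring
  have hL' : (L : ℝ) ≠ 0 := by exact_mod_cast hL.ne'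
  have h1 : ∀ i : Fin N, x i.castSucc = 0 := fun i => by
    have := congrFun h0 i
    simpa [hL'] using this
  intro i
  refine Fin.lastCases ?_ (fun i => h1 i) i
  rw [Fin.sum_univ_castSucc] at hx
  simpa [h1] using hx

/-- The weights l_i / L, with the remainder 1 - ∑ l_i / L at -β, represent the point -r. The
remainder is nonnegative by `hlL`, and the supporting inequalities at the vertices are the
optimality conditions of l. -/
theorem conePts_infDist {N d : ℕ} {v : Fin N → Fin d → ℚ} {β : Fin d → ℚ} {L : ℚ} (hL : 0 < L)
    {l : Fin N → ℚ} (hl : IsNNLS v β l) (hlL : ∑ i, l i ≤ L) :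
    Metric.infDist 0 (convexHull ℝ (Set.range fun i => ratPoint (conePts v β L i))) ^ 2 =
      ((resid v β l ⬝ᵥ resid v β l : ℚ) : ℝ) := by
  have hself := resid_self_eq hl.mul_dot
  have h := infDist_sq_eq (conePts v β L) (-resid v β l)
    (Fin.lastCases (1 - ∑ i, l i / L) fun i => l i / L) ?_ ?_ ?_ ?_
  · rw [h]; simp
  · intro i
    refine Fin.lastCases ?_ (fun i => ?_) i
    · rw [Fin.lastCases_last, ← Finset.sum_div, sub_nonneg, div_le_one hL]; exact hlL
    · rw [Fin.lastCases_castSucc]; exact div_nonneg (hl.nonneg i) hL.le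
  · simp [Fin.sum_univ_castSucc]
  · simp only [Fin.sum_univ_castSucc, conePts_castSucc, conePts_last, Fin.lastCases_last,
      Fin.lastCases_castSucc, resid]
    ext k
    simp [Finset.sum_apply, mul_sub, Finset.sum_sub_distrib, ← Finset.sum_mul]
    have : ∀ i, l i / L * (L * v i k) = l i * v i k := fun i => by field_simp
    simp only [this]
    ring
  · intro i
    have h1 : (-resid v β l) ⬝ᵥ (-resid v β l) = β ⬝ᵥ resid v β l := by
      rw [neg_dotProduct_neg, hself]
    rw [h1]
    refine Fin.lastCases ?_ (fun i => ?_) i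
    · rw [conePts_last, neg_dotProduct_neg, dotProduct_comm]
    · rw [conePts_castSucc, dotProduct_sub, neg_dotProduct, neg_dotProduct, dotProduct_smul,
        dotProduct_comm β, smul_eq_mul]
      nlinarith [mul_nonneg hL.le (neg_nonneg.mpr (hl.dot_le i))]

/-- An oracle for `DVS` evaluates nonnegative least squares problems. -/
theorem oracle_conePts {O : Oracle} (hO : O.Solves DVS) {N d : ℕ} {v : Fin N → Fin d → ℚ}
    {β : Fin d → ℚ} {L : ℚ} (hL : 0 < L) (hv : FamIndep v Finset.univ)
    {l : Fin N → ℚ} (hl : IsNNLS v β l) (hlL : ∑ i, l i ≤ L) :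
    O ⟨[d, N + 1], rowMajor (conePts v β L)⟩ = [resid v β l ⬝ᵥ resid v β l] := by
  obtain ⟨y, hy, hOy⟩ := hO
    (⟨d, N + 1, conePts v β L, N.succ_pos, conePts_affineIndependent β hL hv⟩ : DVSInst)
  refine Eq.trans hOy ?_
  obtain ⟨q, rfl⟩ : ∃ q : ℚ, q = y := ⟨y, rfl⟩
  change [q] = _
  have hy' : (q : ℝ) = _ := hy
  rw [DVSInst.simplex, conePts_infDist hL hl hlL] at hy'
  rw [show q = _ from Rat.cast_injective hy']

/-! ## Feasibility tests and extraction of coefficients by distances -/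

theorem append_dotProduct_append {m n : ℕ} (x x' : Fin m → ℚ) (y y' : Fin n → ℚ) :
    Fin.append x y ⬝ᵥ Fin.append x' y' = x ⬝ᵥ x' + y ⬝ᵥ y' := by
  simp [dotProduct, Fin.sum_univ_add]

section General

variable {ι κ : Type*} [Fintype ι] [Fintype κ] [DecidableEq ι]

/-- The family `a` with the vectors outside `S` replaced by `0`. -/
def restr {R : Type*} [Zero R] (a : ι → κ → R) (S : Finset ι) : ι → κ → R :=
  fun i => if i ∈ S then a i else 0

/-- `β` is in the cone generated by the vectors `a i` with `i ∈ S`. -/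
def ConeMem (a : ι → κ → ℚ) (β : κ → ℚ) (S : Finset ι) : Prop :=
  ∃ μ : ι → ℚ, (∀ i, 0 ≤ μ i) ∧ resid (restr a S) β μ = 0

theorem ConeMem.mono {a : ι → κ → ℚ} {β : κ → ℚ} {S T : Finset ι} (h : ConeMem a β S)
    (hST : S ⊆ T) : ConeMem a β T := by
  obtain ⟨μ, hμ, h0⟩ := h
  refine ⟨fun i => if i ∈ S then μ i else 0, fun i => by dsimp only; split_ifs <;> simp [hμ], ?_⟩
  rw [← h0, resid, resid]
  congr 1
  refine Finset.sum_congr rfl fun i _ => ?_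
  by_cases hi : i ∈ S
  · simp [restr, hi, hST hi]
  · simp [restr, hi]

theorem IsNNLS.resid_eq_zero {v : ι → κ → ℚ} {β : κ → ℚ} {l μ : ι → ℚ} (h : IsNNLS v β l)
    (hμ : ∀ i, 0 ≤ μ i) (h0 : resid v β μ = 0) : resid v β l = 0 := by
  have h1 := h.resid_sq_le hμ
  rw [h0, dotProduct_zero] at h1
  exact dotProduct_self_eq_zero.mp (le_antisymm h1 (dotProduct_self_nonneg_rat _))

theorem restr_intCast (a : ι → κ → ℤ) (S : Finset ι) :
    restr (fun i k => (a i k : ℚ)) S = fun i k => ((restr a S i k : ℤ) : ℚ) := by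
  funext i k
  simp only [restr]
  split_ifs <;> simp

theorem sum_smul_restr (a : ι → κ → ℚ) {S : Finset ι} {g : ι → ℚ} (hg : ∀ i, i ∉ S → g i = 0) :
    ∑ i, g i • restr a S i = ∑ i, g i • a i := by
  refine Finset.sum_congr rfl fun i _ => ?_
  by_cases hi : i ∈ S
  · simp [restr, hi]
  · simp [hg i hi]

theorem restr_dot_abs_le {a : ι → κ → ℤ} {x : κ → ℤ} {X : ℤ} (hX : 0 ≤ X) (S : Finset ι) {i : ι}
    (h : |a i ⬝ᵥ x| ≤ X) : |restr a S i ⬝ᵥ x| ≤ X := by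
  simp only [restr]
  split_ifs
  · exact h
  · simpa using hX

/-- Integer data with a bound for the subdeterminants of the Gram matrix. -/
structure GramBound (a : ι → κ → ℤ) (β : κ → ℤ) (B : ℕ) : Prop where
  exists_bound : ∃ X : ℤ, 1 ≤ X ∧ (∀ i j, |a i ⬝ᵥ a j| ≤ X) ∧ (∀ i, |a i ⬝ᵥ β| ≤ X) ∧
    (Fintype.card ι).factorial * X ^ Fintype.card ι ≤ B

theorem GramBound.one_le {a : ι → κ → ℤ} {β : κ → ℤ} {B : ℕ} (h : GramBound a β B) : 1 ≤ B := by
  obtain ⟨X, hX, -, -, h⟩ := h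
  have h1 : (0 : ℤ) < (Fintype.card ι).factorial * X ^ Fintype.card ι := by positivity
  omega

theorem GramBound.restr {a : ι → κ → ℤ} {β : κ → ℤ} {B : ℕ} (h : GramBound a β B) (S : Finset ι) :
    GramBound (restr a S) β B := by
  obtain ⟨X, hX, h1, h2, h3⟩ := h
  refine ⟨X, hX, fun i j => ?_, fun i => restr_dot_abs_le (by linarith) S (h2 i), h3⟩
  refine restr_dot_abs_le (by linarith) S ?_
  rw [dotProduct_comm]
  refine restr_dot_abs_le (by linarith) S ?_
  rw [dotProduct_comm]
  exact h1 i j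

/-- Used when a column is projected to the span of the others and so plays the role of the target.
-/
theorem GramBound.target {a : ι → κ → ℤ} {β : κ → ℤ} {B : ℕ} (h : GramBound a β B) (j : ι) :
    GramBound a (a j) B := by
  obtain ⟨X, hX, h1, h2, h3⟩ := h
  exact ⟨X, hX, h1, fun i => h1 i j, h3⟩

theorem GramBound.coeffs {a : ι → κ → ℤ} {β : κ → ℤ} {B : ℕ} (h : GramBound a β B) {S : Finset ι}
    (hS : FamIndep (fun i k => (a i k : ℚ)) S) {l : ι → ℚ} (hl : ∀ i, i ∉ S → l i = 0)
    (hort : ∀ i ∈ S, resid (fun i k => (a i k : ℚ)) (fun k => (β k : ℚ)) l ⬝ᵥ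
      (fun k => (a i k : ℚ)) = 0) :
    ∃ (Q : ℤ) (z : ι → ℤ), 1 ≤ Q ∧ Q ≤ B ∧ ∀ i, (Q : ℚ) * l i = z i ∧ |z i| ≤ B := by
  obtain ⟨X, hX, h1, h2, h3⟩ := h
  obtain ⟨Q, z, hQ, hQB, hz⟩ := exists_small_coeffs hS hl hort hX h1 h2
  exact ⟨Q, z, hQ, hQB.trans h3, fun i => ⟨(hz i).1, (hz i).2.trans h3⟩⟩

theorem abs_le_of_mul_eq {Q z : ℤ} {B : ℕ} {x : ℚ} (hQ : 1 ≤ Q) (h : (Q : ℚ) * x = z)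
    (hz : |z| ≤ B) : |x| ≤ B := by
  have hQ' : (1 : ℚ) ≤ Q := by exact_mod_cast hQ
  have hz' : |(z : ℚ)| ≤ B := by exact_mod_cast hz
  rw [← h, abs_mul, abs_of_pos (by linarith : (0 : ℚ) < Q)] at hz'
  nlinarith [abs_nonneg x]

/-- A positive rational with a denominator at most B cannot be smaller than 1/B. This gap separates
zero from nonzero distances and coefficients. -/
theorem one_le_mul_of_pos {Q z : ℤ} {B : ℕ} {x : ℚ} (hQ : 1 ≤ Q) (hQB : Q ≤ B)
    (h : (Q : ℚ) * x = z) (hx : 0 < x) : 1 ≤ (B : ℚ) * x := by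
  have hQ' : (1 : ℚ) ≤ Q := by exact_mod_cast hQ
  have hQB' : (Q : ℚ) ≤ B := by exact_mod_cast hQB
  have hz : (0 : ℚ) < z := by rw [← h]; positivity
  have hz1 : (1 : ℚ) ≤ z := by
    have : (0 : ℤ) < z := by exact_mod_cast hz
    exact_mod_cast this
  nlinarith

/-- The common denominator of the coefficients also clears inner products of the residual with
integer vectors. -/
theorem mul_resid_dot_eq_int {a : ι → κ → ℤ} {β x : κ → ℤ} {l : ι → ℚ} {Q : ℤ} {z : ι → ℤ}
    (hz : ∀ i, (Q : ℚ) * l i = z i) :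
    (Q : ℚ) * (resid (fun i k => (a i k : ℚ)) (fun k => (β k : ℚ)) l ⬝ᵥ (fun k => (x k : ℚ))) =
      ((Q * (β ⬝ᵥ x) - ∑ i, z i * (a i ⬝ᵥ x) : ℤ) : ℚ) := by
  rw [resid_dotProduct]
  push_cast
  rw [mul_sub, Finset.mul_sum, ← intCast_dotProduct]
  congr 1
  refine Finset.sum_congr rfl fun i _ => ?_
  rw [← mul_assoc, hz, intCast_dotProduct]

theorem GramBound.isNNLS_coeffs {a : ι → κ → ℤ} {β : κ → ℤ} {B : ℕ} (h : GramBound a β B)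
    {l : ι → ℚ} (hl : IsNNLS (fun i k => (a i k : ℚ)) (fun k => (β k : ℚ)) l) :
    ∃ (Q : ℤ) (z : ι → ℤ), 1 ≤ Q ∧ Q ≤ B ∧ ∀ i, (Q : ℚ) * l i = z i ∧ |z i| ≤ B :=
  h.coeffs hl.indep (fun _ hi => notMem_supp.mp hi) fun i hi => hl.ortho i (mem_supp.mp hi)

/-- The value of an integer nonnegative least squares problem has a small numerator and
denominator. -/
theorem GramBound.value {a : ι → κ → ℤ} {β : κ → ℤ} {B : ℕ} (h : GramBound a β B)
    {l : ι → ℚ} (hl : IsNNLS (fun i k => (a i k : ℚ)) (fun k => (β k : ℚ)) l) :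
    ∃ Q P : ℤ, 1 ≤ Q ∧ Q ≤ B ∧
      (Q : ℚ) * (resid (fun i k => (a i k : ℚ)) (fun k => (β k : ℚ)) l ⬝ᵥ
        resid (fun i k => (a i k : ℚ)) (fun k => (β k : ℚ)) l) = P ∧
      0 ≤ P ∧ P ≤ B * (β ⬝ᵥ β) := by
  obtain ⟨Q, z, hQ, hQB, hz⟩ := h.isNNLS_coeffs hl
  have h1 := mul_resid_dot_eq_int (a := a) (β := β) (x := β) fun i => (hz i).1
  -- The squared residual equals β ⬝ᵥ r, which is linear in r, so Q rather than Q² clears it.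
  rw [dotProduct_comm, ← resid_self_eq hl.mul_dot] at h1
  have hQ' : (1 : ℚ) ≤ Q := by exact_mod_cast hQ
  have hQB' : (Q : ℚ) ≤ B := by exact_mod_cast hQB
  have h0 := dotProduct_self_nonneg_rat (resid (fun i k => (a i k : ℚ)) (fun k => (β k : ℚ)) l)
  refine ⟨Q, _, hQ, hQB, h1, ?_, ?_⟩
  · have := mul_nonneg (by linarith : (0 : ℚ) ≤ Q) h0
    rw [h1] at this
    exact_mod_cast this
  · have h2 := hl.resid_sq_le (μ := fun _ => 0) fun _ => le_rfl
    have h3 : resid (fun i k => (a i k : ℚ)) (fun k => (β k : ℚ)) (fun _ => 0) =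
        fun k => (β k : ℚ) := by simp [resid]
    rw [h3, intCast_dotProduct] at h2
    have h4 := mul_le_mul hQB' h2 h0 (by linarith)
    rw [h1] at h4
    exact_mod_cast h4

/-- This makes the scale L of the simplex explicit: it only has to exceed the coefficient sum. -/
theorem GramBound.isNNLS_sum_le {a : ι → κ → ℤ} {β : κ → ℤ} {B : ℕ} (h : GramBound a β B)
    {l : ι → ℚ} (hl : IsNNLS (fun i k => (a i k : ℚ)) (fun k => (β k : ℚ)) l) :
    ∑ i, l i ≤ Fintype.card ι * B := by
  obtain ⟨Q, z, hQ, hQB, hz⟩ := h.isNNLS_coeffs hl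
  have : ∀ i ∈ Finset.univ, l i ≤ (B : ℚ) := fun i _ =>
    (le_abs_self _).trans (abs_le_of_mul_eq hQ (hz i).1 (hz i).2)
  simpa using Finset.sum_le_card_nsmul _ _ _ this

/-- Bounds from a bound for the entries. -/
theorem gramBound_of_entries {a : ι → κ → ℤ} {β : κ → ℤ} {M X : ℕ} (hX : 1 ≤ X)
    (hM : Fintype.card κ * M ^ 2 ≤ X)
    (ha : ∀ i k, |a i k| ≤ M) (hβ : ∀ k, |β k| ≤ M) :
    GramBound a β ((Fintype.card ι * X) ^ Fintype.card ι) := by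
  have key : ∀ x y : κ → ℤ, (∀ k, |x k| ≤ M) → (∀ k, |y k| ≤ M) → |x ⬝ᵥ y| ≤ X := by
    intro x y hx hy
    refine (Finset.abs_sum_le_sum_abs _ _).trans ?_
    have : ∀ k ∈ Finset.univ, |x k * y k| ≤ (M : ℤ) ^ 2 := fun k _ => by
      rw [abs_mul, sq]
      exact mul_le_mul (hx k) (hy k) (abs_nonneg _) (by positivity)
    refine (Finset.sum_le_card_nsmul _ _ _ this).trans ?_
    rw [nsmul_eq_mul, Finset.card_univ]
    exact_mod_cast hM
  refine ⟨X, by exact_mod_cast hX, fun i j => key _ _ (ha i) (ha j), fun i => key _ _ (ha i) hβ, ?_⟩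
  -- The factorial is enlarged to a power, so that the bound is a product of equal factors, which
  -- one loop can compute.
  rw [mul_pow]
  push_cast
  gcongr
  exact_mod_cast Nat.factorial_le_pow _

end General

/-! ### Lifted queries: deciding membership and reading coefficients -/

section Query

variable {N r : ℕ}

/-- The vectors of a query: scaled columns with an additional coordinate for each of them. -/
def qvec {R : Type*} [CommRing R] (E : R) (a : Fin N → Fin r → R) (S : Finset (Fin N))
    (t : Fin N → R) : Fin N → Fin (r + N) → R :=
  fun i => Fin.append (E • restr a S i) (Pi.single i (t i))

/-- The target of a query. -/
def qtgt {R : Type*} [CommRing R] (E : R) (β : Fin r → R) (j : ℕ) (y : R) : Fin (r + N) → R :=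
  Fin.append (E • β) (fun i => if (i : ℕ) = j then y else 0)

theorem resid_qvec (E : ℚ) (a : Fin N → Fin r → ℚ) (S : Finset (Fin N)) (t : Fin N → ℚ)
    (β : Fin r → ℚ) (j : ℕ) (y : ℚ) (l : Fin N → ℚ) :
    resid (qvec E a S t) (qtgt E β j y) l =
      Fin.append (E • resid (restr a S) β l)
        (fun i => (if (i : ℕ) = j then y else 0) - l i * t i) := by
  funext k
  refine Fin.addCases (fun k => ?_) (fun k => ?_) k
  · simp [resid, qvec, qtgt, Finset.sum_apply, mul_sub, Finset.mul_sum, mul_left_comm]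
  · simp [resid, qvec, qtgt, Finset.sum_apply, Pi.single_apply]

/-- A vector with a nonzero private coordinate drops out of every relation. Those outside S need
one, since their first block is zero. -/
theorem famIndep_qvec {E : ℚ} (hE : E ≠ 0) {a : Fin N → Fin r → ℚ} {S : Finset (Fin N)}
    {t : Fin N → ℚ} (hS : ∀ i, i ∉ S → t i ≠ 0) (h : FamIndep a (S.filter fun i => t i = 0)) :
    FamIndep (qvec E a S t) Finset.univ := by
  intro g _ h0
  have h1 : ∀ i, t i ≠ 0 → g i = 0 := by
    intro i hi
    have := congrFun h0 (Fin.natAdd r i)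
    simpa [qvec, Finset.sum_apply, Pi.single_apply, hi] using this
  refine h g (fun i hi => ?_) ?_
  · by_cases ht : t i = 0
    · exact absurd (Finset.mem_filter.mpr ⟨by_contra fun hS' => hS i hS' ht, ht⟩) hi
    · exact h1 i ht
  · have hoff : ∀ i, i ∉ S → g i = 0 := fun i hi => h1 i (hS i hi)
    rw [← sum_smul_restr a hoff]
    funext k
    have := congrFun h0 (Fin.castAdd N k)
    simp only [qvec, Finset.sum_apply, Pi.smul_apply, Fin.append_left, smul_eq_mul,
      Pi.zero_apply, mul_left_comm _ E, ← Finset.mul_sum, mul_eq_zero, hE, false_or] at this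
    simpa [Finset.sum_apply] using this

theorem qvec_intCast (E : ℤ) (a : Fin N → Fin r → ℤ) (S : Finset (Fin N)) (t : Fin N → ℤ) :
    qvec (E : ℚ) (fun i k => (a i k : ℚ)) S (fun i => (t i : ℚ)) =
      fun i k => ((qvec E a S t i k : ℤ) : ℚ) := by
  funext i k
  refine Fin.addCases (fun k => ?_) (fun k => ?_) k
  · simp [qvec, restr_intCast]
  · simp only [qvec, Fin.append_right, Pi.single_apply]
    split_ifs <;> simp

theorem qtgt_intCast (E : ℤ) (β : Fin r → ℤ) (j : ℕ) (y : ℤ) :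
    (qtgt (E : ℚ) (fun k => (β k : ℚ)) j (y : ℚ) : Fin (r + N) → ℚ) =
      fun k => ((qtgt E β j y k : ℤ) : ℚ) := by
  funext k
  refine Fin.addCases (fun k => ?_) (fun k => ?_) k
  · simp [qtgt]
  · simp only [qtgt, Fin.append_right]
    split_ifs <;> simp

/-- Membership in the cone is decided by a distance. -/
theorem coneMem_iff_lt {a : Fin N → Fin r → ℤ} {β : Fin r → ℤ} {B E : ℕ} (hB : GramBound a β B)
    (hE : E = (N + 1) * B ^ 2) (S : Finset (Fin N)) (j : ℕ) {l : Fin N → ℚ}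
    (hl : IsNNLS (qvec (E : ℚ) (fun i k => (a i k : ℚ)) S (fun _ => 1))
      (qtgt (E : ℚ) (fun k => (β k : ℚ)) j 0) l) :
    ConeMem (fun i k => (a i k : ℚ)) (fun k => (β k : ℚ)) S ↔
      resid (qvec (E : ℚ) (fun i k => (a i k : ℚ)) S (fun _ => 1))
          (qtgt (E : ℚ) (fun k => (β k : ℚ)) j 0) l ⬝ᵥ
        resid (qvec (E : ℚ) (fun i k => (a i k : ℚ)) S (fun _ => 1))
          (qtgt (E : ℚ) (fun k => (β k : ℚ)) j 0) l < E := by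
  obtain ⟨l₀, hl₀⟩ := exists_isNNLS (restr (fun i k => (a i k : ℚ)) S) (fun k => (β k : ℚ))
  have hB1 := hB.one_le
  have hB1' : (1 : ℚ) ≤ B := by exact_mod_cast hB1
  have hEq : (E : ℚ) = (N + 1) * B ^ 2 := by rw [hE]; push_cast; ring
  have hl₀' := hl₀
  rw [restr_intCast] at hl₀'
  obtain ⟨Q, z, hQ, hQB, hz⟩ := (hB.restr S).isNNLS_coeffs hl₀'
  have hval : ∀ l : Fin N → ℚ, resid (qvec (E : ℚ) (fun i k => (a i k : ℚ)) S (fun _ => 1))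
          (qtgt (E : ℚ) (fun k => (β k : ℚ)) j 0) l ⬝ᵥ
        resid (qvec (E : ℚ) (fun i k => (a i k : ℚ)) S (fun _ => 1))
          (qtgt (E : ℚ) (fun k => (β k : ℚ)) j 0) l =
      E ^ 2 * (resid (restr (fun i k => (a i k : ℚ)) S) (fun k => (β k : ℚ)) l ⬝ᵥ
        resid (restr (fun i k => (a i k : ℚ)) S) (fun k => (β k : ℚ)) l) + ∑ i, l i ^ 2 := by
    intro l
    rw [resid_qvec, append_dotProduct_append, smul_dotProduct, dotProduct_smul]
    congr 1
    · simp only [smul_eq_mul]; ring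
    · simp [dotProduct, sq]
  constructor
  · rintro ⟨μ, hμ, h0⟩
    have hz0 := hl₀.resid_eq_zero hμ h0
    -- The solution l₀ of the unlifted problem is a competitor with zero residual and entries at
    -- most B, so its value is at most N B² < E.
    refine lt_of_le_of_lt (hl.resid_sq_le hl₀.nonneg) ?_
    rw [hval, hz0, dotProduct_zero, mul_zero, zero_add, hEq]
    have : ∀ i ∈ Finset.univ, l₀ i ^ 2 ≤ (B : ℚ) ^ 2 := fun i _ => by
      rw [← sq_abs]
      exact pow_le_pow_left₀ (abs_nonneg _) (abs_le_of_mul_eq hQ (hz i).1 (hz i).2) 2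
    have h2 := Finset.sum_le_card_nsmul _ _ _ this
    simp only [Finset.card_univ, Fintype.card_fin, nsmul_eq_mul] at h2
    nlinarith
  · intro hlt
    by_contra hnot
    rw [hval] at hlt
    have hne : resid (restr (fun i k => (a i k : ℚ)) S) (fun k => (β k : ℚ)) l₀ ≠ 0 :=
      fun h => hnot ⟨l₀, hl₀.nonneg, h⟩
    have hpos : 0 < resid (restr (fun i k => (a i k : ℚ)) S) (fun k => (β k : ℚ)) l₀ ⬝ᵥ
        resid (restr (fun i k => (a i k : ℚ)) S) (fun k => (β k : ℚ)) l₀ :=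
      lt_of_le_of_ne (dotProduct_self_nonneg_rat _) fun h =>
        hne (dotProduct_self_eq_zero.mp h.symm)
    obtain ⟨Q', P, hQ', hQB', hP, -, -⟩ := (hB.restr S).value hl₀'
    rw [← restr_intCast] at hP
    -- Outside the cone the squared distance is at least 1/B, so the value is at least E²/B ≥ E.
    have h1 := one_le_mul_of_pos hQ' hQB' hP hpos
    have h2 := hl₀.resid_sq_le hl.nonneg
    have h3 : (0 : ℚ) ≤ ∑ i, l i ^ 2 := Finset.sum_nonneg fun i _ => sq_nonneg _
    set D := resid (restr (fun i k => (a i k : ℚ)) S) (fun k => (β k : ℚ)) l₀ ⬝ᵥ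
        resid (restr (fun i k => (a i k : ℚ)) S) (fun k => (β k : ℚ)) l₀
    have hN : (0 : ℚ) ≤ N := by positivity
    have h4 : (B : ℚ) ≤ E := by rw [hEq]; nlinarith [mul_nonneg hN (sq_nonneg (B : ℚ))]
    have hE0 : (0 : ℚ) < E := by linarith
    have h5 : (E : ℚ) ^ 2 * D < E := by nlinarith [mul_le_mul_of_nonneg_left h2 (sq_nonneg (E : ℚ))]
    have h6 : (E : ℚ) * D < 1 := by
      by_contra! h; nlinarith [mul_le_mul_of_nonneg_left h hE0.le]
    nlinarith [mul_le_mul_of_nonneg_right h4 hpos.le]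

/-- The unique solution for a minimal set of columns. -/
theorem exists_minimal_solution {a : Fin N → Fin r → ℤ} {β : Fin r → ℤ} {B : ℕ}
    (hB : GramBound a β B) {S : Finset (Fin N)}
    (hS : ConeMem (fun i k => (a i k : ℚ)) (fun k => (β k : ℚ)) S)
    (hmin : ∀ j ∈ S, ¬ ConeMem (fun i k => (a i k : ℚ)) (fun k => (β k : ℚ)) (S.erase j)) :
    FamIndep (fun i k => (a i k : ℚ)) S ∧ ∃ l : Fin N → ℚ, (∀ i, 0 ≤ l i) ∧
      (∀ i, i ∉ S → l i = 0) ∧ (∀ i ∈ S, 0 < l i) ∧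
      (∑ i, l i • fun k => (a i k : ℚ)) = (fun k => (β k : ℚ)) ∧
      ∃ (Q : ℤ) (z : Fin N → ℤ), 1 ≤ Q ∧ Q ≤ B ∧ ∀ i, (Q : ℚ) * l i = z i ∧ |z i| ≤ B := by
  obtain ⟨l, hl⟩ := exists_isNNLS (restr (fun i k => (a i k : ℚ)) S) (fun k => (β k : ℚ))
  obtain ⟨μ, hμ, h0⟩ := hS
  have hz0 := hl.resid_eq_zero hμ h0
  have hoff : ∀ i, i ∉ S → l i = 0 := by
    intro i hi
    by_contra hne
    -- A column outside S is zero in the restricted family and cannot belong to an independent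
    -- support.
    have := hl.indep (Pi.single i 1) (fun k hk => by
      rw [Pi.single_apply, if_neg]; rintro rfl; exact hk (mem_supp.mpr hne)) (by
      refine Finset.sum_eq_zero fun k _ => ?_
      by_cases hki : k = i
      · subst hki; simp [restr, hi]
      · simp [hki]) i
    simp at this
  have hpos : ∀ i ∈ S, 0 < l i := by
    intro j hj
    refine lt_of_le_of_ne (hl.nonneg j) fun hz => hmin j hj ⟨l, hl.nonneg, ?_⟩
    rw [← hz0, resid, resid]
    congr 1
    refine Finset.sum_congr rfl fun i _ => ?_
    by_cases hij : i = j
    · subst hij; simp [← hz]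
    · simp [restr, hij]
  have hsupp : supp l = S := by
    ext i
    rw [mem_supp]
    exact ⟨fun h => by by_contra hi; exact h (hoff i hi), fun hi => (hpos i hi).ne'⟩
  have hl' := hl
  rw [restr_intCast] at hl'
  refine ⟨fun g hg h => hl.indep g (hsupp ▸ hg) ((sum_smul_restr _ hg).trans h), l, hl.nonneg,
    hoff, hpos, ?_, (hB.restr S).isNNLS_coeffs hl'⟩
  rw [← sum_smul_restr _ hoff]
  exact (sub_eq_zero.mp hz0).symm

/-- The distances for three positions of one coordinate of the target determine a coefficient. -/
theorem value_eq_mul_sq {a : Fin N → Fin r → ℤ} {β : Fin r → ℤ} {B E : ℕ} (hB : GramBound a β B)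
    (hE : E = (N + 1) * B ^ 2) {S : Finset (Fin N)}
    (hind : FamIndep (fun i k => (a i k : ℚ)) S) {l : Fin N → ℚ}
    (hoff : ∀ i, i ∉ S → l i = 0) (hpos : ∀ i ∈ S, 0 < l i)
    (hsum : (∑ i, l i • fun k => (a i k : ℚ)) = (fun k => (β k : ℚ)))
    {Q : ℤ} {z : Fin N → ℤ} (hQ : 1 ≤ Q) (hQB : Q ≤ B)
    (hz : ∀ i, (Q : ℚ) * l i = z i ∧ |z i| ≤ B) {j : Fin N} (hj : j ∈ S) :
    ∃ c : ℚ, c ≠ 0 ∧ ∀ y : ℚ, 0 ≤ y → y ≤ 2 → ∀ l' : Fin N → ℚ,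
      IsNNLS (qvec (E : ℚ) (fun i k => (a i k : ℚ)) S fun i => if i ∈ S ∧ i ≠ j then 0 else 1)
        (qtgt (E : ℚ) (fun k => (β k : ℚ)) j y) l' →
      resid (qvec (E : ℚ) (fun i k => (a i k : ℚ)) S fun i => if i ∈ S ∧ i ≠ j then 0 else 1)
          (qtgt (E : ℚ) (fun k => (β k : ℚ)) j y) l' ⬝ᵥ
        resid (qvec (E : ℚ) (fun i k => (a i k : ℚ)) S fun i => if i ∈ S ∧ i ≠ j then 0 else 1)
          (qtgt (E : ℚ) (fun k => (β k : ℚ)) j y) l' = c * (l j - y) ^ 2 := by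
  have hB1' : (1 : ℚ) ≤ B := by exact_mod_cast hB.one_le
  have hindj := hind.mono (Finset.erase_subset j S)
  -- The vector e defined below is the part of a_j orthogonal to the other columns of S. Its squared
  -- length D is at least 1/B, by integrality.
  obtain ⟨μ, hμoff, hμ⟩ := exists_projection hindj (fun k => (a j k : ℚ))
  obtain ⟨Q', z', hQ', hQB', hz'⟩ := (hB.target j).coeffs hindj hμoff hμ
  set e := resid (fun i k => (a i k : ℚ)) (fun k => (a j k : ℚ)) μ with he
  have hμj : μ j = 0 := hμoff j (by simp)
  have hmul : ∀ i, μ i * (e ⬝ᵥ fun k => (a i k : ℚ)) = 0 := fun i => by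
    by_cases hi : i ∈ S.erase j
    · rw [hμ i hi, mul_zero]
    · rw [hμoff i hi, zero_mul]
  have hee : e ⬝ᵥ e = e ⬝ᵥ fun k => (a j k : ℚ) := by rw [resid_self_eq hmul, dotProduct_comm]
  have hD : 0 < e ⬝ᵥ e := by
    refine lt_of_le_of_ne (dotProduct_self_nonneg_rat _) fun h => ?_
    have h0 : e = 0 := dotProduct_self_eq_zero.mp h.symm
    have := hind (fun i => (if i = j then 1 else 0) - μ i) (fun i hi => by
      have hij : i ≠ j := fun h => hi (h ▸ hj)
      rw [if_neg hij, hμoff i (fun h => hi (Finset.mem_of_mem_erase h)), sub_zero]) (by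
      rw [← h0, he, resid]
      simp only [sub_smul, Finset.sum_sub_distrib, ite_smul, one_smul, zero_smul,
        Finset.sum_ite_eq', Finset.mem_univ, if_true]) j
    simp [hμj] at this
  have hBD : 1 ≤ (B : ℚ) * (e ⬝ᵥ e) := by
    have h1 := mul_resid_dot_eq_int (a := a) (β := a j) (x := a j) fun i => (hz' i).1
    rw [← he, ← hee] at h1
    exact one_le_mul_of_pos hQ' hQB' h1 hD
  set D := e ⬝ᵥ e with hDdef
  set F : ℚ := E ^ 2 * D with hF
  have hN1 : (2 : ℚ) ≤ N + 1 := by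
    have : 1 ≤ N := Nat.one_le_iff_ne_zero.mpr fun h => by subst h; exact j.elim0
    have : (1 : ℚ) ≤ N := by exact_mod_cast this
    linarith
  have hE2 : (E : ℚ) ≥ 2 * B ^ 2 := by
    rw [hE]; push_cast; nlinarith [sq_nonneg (B : ℚ)]
  have hFB : (B + 2) * B ^ 2 ≤ F := by
    have h1 : (E : ℚ) ^ 2 ≥ (2 * B ^ 2) ^ 2 := pow_le_pow_left₀ (by positivity) hE2 2
    have h2 : F ≥ (2 * B ^ 2) ^ 2 * D := mul_le_mul_of_nonneg_right h1 hD.le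
    have h3 : (2 * (B : ℚ) ^ 2) ^ 2 * D = 4 * B ^ 3 * (B * D) := by ring
    have h4 : 4 * (B : ℚ) ^ 3 * 1 ≤ 4 * B ^ 3 * (B * D) :=
      mul_le_mul_of_nonneg_left hBD (by positivity)
    nlinarith [sq_nonneg (B : ℚ), mul_nonneg (sub_nonneg.mpr hB1') (sq_nonneg (B : ℚ))]
  have hFpos : 0 < F := lt_of_lt_of_le (by positivity) hFB
  -- With coefficient s at j and the others readjusted, the value is F(l_j - s)² + (y - s)². Its
  -- minimum is F/(F+1) · (l_j - y)², attained at the s below.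
  refine ⟨F / (F + 1), by positivity, fun y hy0 hy2 l' hl' => ?_⟩
  set s : ℚ := (l j * F + y) / (F + 1) with hs
  have hs0 : 0 ≤ s := div_nonneg (by nlinarith [hpos j hj]) (by linarith)
  have hsl : l j - s = (l j - y) / (F + 1) := by rw [hs]; field_simp; ring
  have hsy : y - s = (y - l j) * F / (F + 1) := by rw [hs]; field_simp; ring
  -- The other columns take over the projection of (l_j - s) a_j, which leaves the residual (l_j -
  -- s) e.
  set x : Fin N → ℚ := fun i => if i = j then s else l i + (l j - s) * μ i with hx
  have hxoff : ∀ i, i ∉ S → x i = 0 := fun i hi => by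
    have hij : i ≠ j := fun h => hi (h ▸ hj)
    simp [hx, hij, hoff i hi, hμoff i fun h => hi (Finset.mem_of_mem_erase h)]
  have hlB : ∀ i, |l i| ≤ B := fun i => abs_le_of_mul_eq hQ (hz i).1 (hz i).2
  -- The sign constraints are inactive: l_i ≥ 1/B and |μ_i| ≤ B, while |l_j - s| = |l_j - y|/(F+1) ≤
  -- 1/B² because F is at least (B+2)B².
  have hx0 : ∀ i, 0 ≤ x i := by
    intro i
    by_cases hi : i ∈ S
    · simp only [hx]
      split_ifs with hij
      · exact hs0
      · have h1 : 1 ≤ (B : ℚ) * l i := one_le_mul_of_pos hQ hQB (hz i).1 (hpos i hi)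
        have h2 : |μ i| ≤ B := abs_le_of_mul_eq hQ' (hz' i).1 (hz' i).2
        have h3 : |l j - y| ≤ B + 2 := by
          have := hlB j
          rw [abs_le] at this ⊢
          constructor <;> linarith
        have h4 : |l j - s| * B ^ 2 ≤ 1 := by
          rw [hsl, abs_div, abs_of_pos (by linarith : 0 < F + 1), div_mul_eq_mul_div,
            div_le_one (by linarith)]
          calc |l j - y| * B ^ 2 ≤ (B + 2) * B ^ 2 := by gcongr
            _ ≤ F + 1 := by linarith
        have h5 : |(l j - s) * μ i| * B ≤ 1 := by
          rw [abs_mul]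
          calc |l j - s| * |μ i| * B ≤ |l j - s| * B * B := by gcongr
            _ = |l j - s| * B ^ 2 := by ring
            _ ≤ 1 := h4
        have h6 := neg_abs_le ((l j - s) * μ i)
        have h7 : |(l j - s) * μ i| ≤ l i := by
          by_contra! h
          nlinarith
        linarith
    · rw [hxoff i hi]
  have hres : resid (restr (fun i k => (a i k : ℚ)) S) (fun k => (β k : ℚ)) x = (l j - s) • e := by
    rw [resid, sum_smul_restr _ hxoff, ← hsum, ← Finset.sum_sub_distrib, he, resid, smul_sub,
      Finset.smul_sum]
    have h1 : (l j - s) • (fun k => (a j k : ℚ)) =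
        ∑ i, (if i = j then (l j - s) else 0) • fun k => (a i k : ℚ) := by
      simp
    rw [h1, ← Finset.sum_sub_distrib]
    refine Finset.sum_congr rfl fun i _ => ?_
    rw [← sub_smul, smul_smul, ← sub_smul]
    congr 1
    simp only [hx]
    split_ifs with hij
    · rw [hij, hμj]; ring
    · ring
  have hresq : resid (qvec (E : ℚ) (fun i k => (a i k : ℚ)) S
        fun i => if i ∈ S ∧ i ≠ j then 0 else 1) (qtgt (E : ℚ) (fun k => (β k : ℚ)) j y) x =
      Fin.append ((E : ℚ) • (l j - s) • e) (Pi.single j (y - s)) := by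
    rw [resid_qvec, hres]
    congr 1
    funext i
    by_cases hij : i = j
    · subst hij; simp [hx]
    · have hij' : (i : ℕ) ≠ j := fun h => hij (Fin.ext h)
      by_cases hi : i ∈ S
      · simp [hij, hij', hi]
      · simp [hij, hij', hi, hxoff i hi]
  have hdot : ∀ i, resid (qvec (E : ℚ) (fun i k => (a i k : ℚ)) S
        fun i => if i ∈ S ∧ i ≠ j then 0 else 1) (qtgt (E : ℚ) (fun k => (β k : ℚ)) j y) x ⬝ᵥ
      qvec (E : ℚ) (fun i k => (a i k : ℚ)) S (fun i => if i ∈ S ∧ i ≠ j then 0 else 1) i = 0 := by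
    intro i
    rw [hresq, qvec, append_dotProduct_append]
    by_cases hij : i = j
    · subst hij
      simp only [restr, hj, if_true, smul_dotProduct, dotProduct_smul, ← hee, ne_eq, not_true,
        and_false, if_false, smul_eq_mul, single_dotProduct, Pi.single_eq_same]
      rw [hsl, hsy, hF]
      have : (E : ℚ) ^ 2 * D + 1 ≠ 0 := by rw [← hF]; positivity
      field_simp
      ring
    · have h2 : (Pi.single j (y - s) : Fin N → ℚ) ⬝ᵥ
          Pi.single i (if i ∈ S ∧ i ≠ j then (0 : ℚ) else 1) = 0 := by
        rw [single_dotProduct, Pi.single_eq_of_ne (Ne.symm hij), mul_zero]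
      rw [h2, add_zero]
      by_cases hi : i ∈ S
      · simp only [restr, hi, if_true, smul_dotProduct, dotProduct_smul,
          hμ i (Finset.mem_erase.mpr ⟨hij, hi⟩), smul_zero]
      · simp [restr, hi]
  -- The minimizer l' beats x because x is nonnegative; x beats l' because its residual is
  -- orthogonal to all vectors of the query.
  have hle1 := hl'.resid_sq_le hx0
  have hle2 := resid_sq_le (μ := l') fun i => by rw [hdot i, mul_zero]
  rw [le_antisymm hle1 hle2, hresq, append_dotProduct_append]
  simp only [smul_dotProduct, dotProduct_smul, smul_eq_mul, single_dotProduct, Pi.single_eq_same,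
    ← hDdef]
  rw [hsl, hsy, hF]
  have : (E : ℚ) ^ 2 * D + 1 ≠ 0 := by rw [← hF]; positivity
  field_simp
  ring

end Query

/-! ## Linear programs as membership problems in cones -/

/-- The entries of the columns of the system `A x⁺ - A x⁻ + s = b`, `Aᵀ y = σ c`,
`σ cᵀ (x⁺ - x⁻) = bᵀ y`, scaled with `W`; the scaled data are given as the list `e`. -/
def col {R : Type*} [CommRing R] (m n : ℕ) (e : ℕ → R) (W σ : R) (i k : ℕ) : R :=
  if i < n then
    if k < m then e (k * n + i) else if k < m + n then 0 else σ * e (m * n + m + i)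
  else if i < n + n then
    if k < m then -e (k * n + (i - n)) else if k < m + n then 0
    else -(σ * e (m * n + m + (i - n)))
  else if i < n + n + m then
    if k = i - (n + n) then W else 0
  else
    if k < m then 0 else if k < m + n then e ((i - (n + n + m)) * n + (k - m))
    else -e (m * n + (i - (n + n + m)))

/-- The right hand side of the system. -/
def rhs {R : Type*} [CommRing R] (m n : ℕ) (e : ℕ → R) (σ : R) (k : ℕ) : R :=
  if k < m then e (m * n + k) else if k < m + n then σ * e (m * n + m + (k - m)) else 0

/-- The columns as a family of vectors. -/
def cols {R : Type*} [CommRing R] (m n : ℕ) (e : ℕ → R) (W σ : R) :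
    Fin (n + n + (m + m)) → Fin (m + n + 1) → R := fun i k => col m n e W σ i k

/-- The right hand side as a vector. -/
def rhsV {R : Type*} [CommRing R] (m n : ℕ) (e : ℕ → R) (σ : R) : Fin (m + n + 1) → R :=
  fun k => rhs m n e σ k

theorem cols_intCast (m n : ℕ) (e : ℕ → ℤ) (W σ : ℤ) :
    cols m n (fun j => (e j : ℚ)) W σ = fun i k => ((cols m n e W σ i k : ℤ) : ℚ) := by
  funext i k
  simp only [cols, col]
  split_ifs <;> simp

theorem rhsV_intCast (m n : ℕ) (e : ℕ → ℤ) (σ : ℤ) :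
    rhsV m n (fun j => (e j : ℚ)) σ = fun k => ((rhsV m n e σ k : ℤ) : ℚ) := by
  funext k
  simp only [rhsV, rhs]
  split_ifs <;> simp

theorem sum_mul_sum_swap {R : Type*} [CommRing R] {m n : ℕ} (p : Fin m → R)
    (A : Fin m → Fin n → R) (x : Fin n → R) :
    ∑ k, p k * ∑ j, A k j * x j = ∑ j, (∑ k, p k * A k j) * x j := by
  simp only [Finset.mul_sum, Finset.sum_mul]
  rw [Finset.sum_comm]
  simp only [mul_assoc]

/-- The list `e` consists of the data of `I` scaled with `W`. -/
structure IsScaled (I : LPInst) (W : ℚ) (e : ℕ → ℚ) : Prop where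
  A_eq : ∀ (i : Fin I.m) (j : Fin I.n), e (i * I.n + j) = W * I.A i j
  b_eq : ∀ i : Fin I.m, e (I.m * I.n + i) = W * I.b i
  c_eq : ∀ j : Fin I.n, e (I.m * I.n + I.m + j) = W * I.c j

section LPTheory

variable {I : LPInst} {W σ : ℚ} {e : ℕ → ℚ}

/-- The columns of the positive parts of the unknowns. -/
def ixPos {m n : ℕ} (j : Fin n) : Fin (n + n + (m + m)) := Fin.castAdd (m + m) (Fin.castAdd n j)

/-- The columns of the negative parts of the unknowns. -/
def ixNeg {m n : ℕ} (j : Fin n) : Fin (n + n + (m + m)) := Fin.castAdd (m + m) (Fin.natAdd n j)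

/-- The columns of the slack variables. -/
def ixSlack {m n : ℕ} (k : Fin m) : Fin (n + n + (m + m)) := Fin.natAdd (n + n) (Fin.castAdd m k)

/-- The columns of the dual variables. -/
def ixDual {m n : ℕ} (k : Fin m) : Fin (n + n + (m + m)) := Fin.natAdd (n + n) (Fin.natAdd m k)

/-- The rows of the primal constraints. -/
def rowPrimal {m n : ℕ} (k : Fin m) : Fin (m + n + 1) := Fin.castAdd 1 (Fin.castAdd n k)

/-- The rows of the dual constraints. -/
def rowDual {m n : ℕ} (j : Fin n) : Fin (m + n + 1) := Fin.castAdd 1 (Fin.natAdd m j)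

/-- The row that compares the objectives. -/
def rowObj {m n : ℕ} : Fin (m + n + 1) := Fin.natAdd (m + n) 0

theorem ixPos_val {m n : ℕ} (j : Fin n) : (ixPos (m := m) j : ℕ) = j := by simp [ixPos]

theorem ixNeg_val {m n : ℕ} (j : Fin n) : (ixNeg (m := m) j : ℕ) = n + j := by
  simp [ixNeg, add_comm]

theorem ixSlack_val {m n : ℕ} (k : Fin m) : (ixSlack (n := n) k : ℕ) = n + n + k := by
  simp [ixSlack]

theorem ixDual_val {m n : ℕ} (k : Fin m) : (ixDual (n := n) k : ℕ) = n + n + (m + k) := by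
  simp only [ixDual, Fin.val_natAdd]

theorem rowPrimal_val {m n : ℕ} (k : Fin m) : (rowPrimal (n := n) k : ℕ) = k := by
  simp [rowPrimal]

theorem rowDual_val {m n : ℕ} (j : Fin n) : (rowDual (m := m) j : ℕ) = m + j := by
  simp [rowDual]

theorem rowObj_val {m n : ℕ} : (rowObj (m := m) (n := n) : ℕ) = m + n := by simp [rowObj]

theorem sum_rows {m n : ℕ} (f : Fin (m + n + 1) → ℚ) :
    ∑ k, f k = ∑ k, f (rowPrimal k) + ∑ j, f (rowDual j) + f rowObj := by
  rw [Fin.sum_univ_add, Fin.sum_univ_add, Fin.sum_univ_one]; rfl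

theorem sum_columns {m n : ℕ} (f : Fin (n + n + (m + m)) → ℚ) :
    ∑ i, f i = ∑ j, f (ixPos j) + ∑ j, f (ixNeg j) + (∑ k, f (ixSlack k) + ∑ k, f (ixDual k)) := by
  rw [Fin.sum_univ_add, Fin.sum_univ_add, Fin.sum_univ_add]; rfl

/-! ### Blocks of the primal-dual system -/

section Entries

variable (h : IsScaled I W e) (j j' : Fin I.n) (k k' : Fin I.m)
include h

theorem cols_pos_primal : cols I.m I.n e W σ (ixPos j) (rowPrimal k) = W * I.A k j := by
  have := j.2; have := k.2
  rw [← h.A_eq]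
  simp only [cols, col, ixPos_val, rowPrimal_val]
  simp (disch := omega) only [if_pos]

theorem cols_pos_dual : cols I.m I.n e W σ (ixPos j) (rowDual j') = 0 := by
  have := j.2; have := j'.2
  simp only [cols, col, ixPos_val, rowDual_val]
  simp (disch := omega) only [if_pos, if_neg]

theorem cols_pos_obj : cols I.m I.n e W σ (ixPos j) rowObj = W * (σ * I.c j) := by
  have := j.2
  rw [mul_left_comm, ← h.c_eq]
  simp only [cols, col, ixPos_val, rowObj_val]
  simp (disch := omega) only [if_pos, if_neg]

theorem cols_neg_primal : cols I.m I.n e W σ (ixNeg j) (rowPrimal k) = -(W * I.A k j) := by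
  have := j.2; have := k.2
  rw [← h.A_eq]
  simp only [cols, col, ixNeg_val, rowPrimal_val, add_tsub_cancel_left]
  simp (disch := omega) only [if_pos, if_neg]

theorem cols_neg_dual : cols I.m I.n e W σ (ixNeg j) (rowDual j') = 0 := by
  have := j.2; have := j'.2
  simp only [cols, col, ixNeg_val, rowDual_val]
  simp (disch := omega) only [if_pos, if_neg]

theorem cols_neg_obj : cols I.m I.n e W σ (ixNeg j) rowObj = -(W * (σ * I.c j)) := by
  have := j.2
  rw [mul_left_comm, ← h.c_eq]
  simp only [cols, col, ixNeg_val, rowObj_val, add_tsub_cancel_left]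
  simp (disch := omega) only [if_pos, if_neg]

theorem cols_slack_primal : cols I.m I.n e W σ (ixSlack k') (rowPrimal k) =
    if k = k' then W else 0 := by
  have := k'.2; have := k.2
  simp only [cols, col, ixSlack_val, rowPrimal_val,
    add_tsub_cancel_left, Fin.ext_iff]
  simp (disch := omega) only [if_neg, if_pos (by omega : I.n + I.n + k'.1 < I.n + I.n + I.m)]

theorem cols_slack_dual : cols I.m I.n e W σ (ixSlack k') (rowDual j) = 0 := by
  have := k'.2; have := j.2
  simp only [cols, col, ixSlack_val, rowDual_val, add_tsub_cancel_left]
  simp (disch := omega) only [if_pos, if_neg]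

theorem cols_slack_obj : cols I.m I.n e W σ (ixSlack k') rowObj = 0 := by
  have := k'.2
  simp only [cols, col, ixSlack_val, rowObj_val, add_tsub_cancel_left]
  simp (disch := omega) only [if_pos, if_neg]

theorem cols_dual_primal : cols I.m I.n e W σ (ixDual k') (rowPrimal k) = 0 := by
  have := k'.2; have := k.2
  simp only [cols, col, ixDual_val, rowPrimal_val]
  simp (disch := omega) only [if_pos, if_neg]

theorem cols_dual_dual : cols I.m I.n e W σ (ixDual k') (rowDual j) = W * I.A k' j := by
  have := k'.2; have := j.2
  have h1 : I.n + I.n + (I.m + k'.1) - (I.n + I.n + I.m) = k' := by omega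
  rw [← h.A_eq]
  simp only [cols, col, ixDual_val, rowDual_val, add_tsub_cancel_left, h1]
  simp (disch := omega) only [if_pos, if_neg]

theorem cols_dual_obj : cols I.m I.n e W σ (ixDual k') rowObj = -(W * I.b k') := by
  have := k'.2
  have h1 : I.n + I.n + (I.m + k'.1) - (I.n + I.n + I.m) = k' := by omega
  rw [← h.b_eq]
  simp only [cols, col, ixDual_val, rowObj_val, h1]
  simp (disch := omega) only [if_pos, if_neg]

theorem rhsV_primal : rhsV I.m I.n e σ (rowPrimal k) = W * I.b k := by
  have := k.2
  rw [← h.b_eq]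
  simp only [rhsV, rhs, rowPrimal_val]
  simp (disch := omega) only [if_pos]

theorem rhsV_dual : rhsV I.m I.n e σ (rowDual j) = W * (σ * I.c j) := by
  have := j.2
  rw [mul_left_comm, ← h.c_eq]
  simp only [rhsV, rhs, rowDual_val, add_tsub_cancel_left]
  simp (disch := omega) only [if_pos, if_neg]

theorem rhsV_obj : rhsV I.m I.n e σ rowObj = 0 := by
  simp only [rhsV, rhs, rowObj_val]
  simp (disch := omega) only [if_neg]

end Entries

/-- The equations of the system. -/
theorem equations (h : IsScaled I W e) (hW : 0 < W) {l : Fin (I.n + I.n + (I.m + I.m)) → ℚ}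
    (hl : resid (cols I.m I.n e W σ) (rhsV I.m I.n e σ) l = 0) :
    (∀ k, ∑ j, I.A k j * (l (ixPos j) - l (ixNeg j)) + l (ixSlack k) = I.b k) ∧
    (∀ j, ∑ k, l (ixDual k) * I.A k j = σ * I.c j) ∧
    σ * ∑ j, I.c j * (l (ixPos j) - l (ixNeg j)) = ∑ k, l (ixDual k) * I.b k := by
  have key : ∀ k, ∑ i, l i * cols I.m I.n e W σ i k = rhsV I.m I.n e σ k := fun k => by
    have := congrFun (sub_eq_zero.mp hl) k
    rw [this]; simp [Finset.sum_apply]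
  refine ⟨fun k => ?_, fun j => ?_, ?_⟩
  · have := key (rowPrimal k)
    rw [sum_columns, rhsV_primal h] at this
    simp only [cols_pos_primal h, cols_neg_primal h, cols_slack_primal h, cols_dual_primal h,
      mul_ite, mul_zero, Finset.sum_ite_eq, Finset.mem_univ, if_true, Finset.sum_const_zero,
      add_zero, ← Finset.sum_add_distrib] at this
    apply mul_left_cancel₀ hW.ne'
    rw [← this, mul_add, Finset.mul_sum]
    congr 1
    · exact Finset.sum_congr rfl fun j _ => by ring
    · ring
  · have := key (rowDual j)
    rw [sum_columns, rhsV_dual h] at this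
    simp only [cols_pos_dual h, cols_neg_dual h, cols_slack_dual h, cols_dual_dual h, mul_zero,
      Finset.sum_const_zero, zero_add] at this
    apply mul_left_cancel₀ hW.ne'
    rw [← this, Finset.mul_sum]
    exact Finset.sum_congr rfl fun j _ => by ring
  · have := key rowObj
    rw [sum_columns, rhsV_obj h] at this
    simp only [cols_pos_obj h, cols_neg_obj h, cols_slack_obj h, cols_dual_obj h, mul_zero,
      Finset.sum_const_zero, zero_add, ← Finset.sum_add_distrib] at this
    apply mul_left_cancel₀ hW.ne'
    rw [← sub_eq_zero, ← this, Finset.mul_sum, Finset.mul_sum, Finset.mul_sum,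
      sub_eq_add_neg, ← Finset.sum_neg_distrib]
    congr 1
    · exact Finset.sum_congr rfl fun j _ => by ring
    · exact Finset.sum_congr rfl fun j _ => by ring

/-- Farkas' lemma for the system. -/
theorem alternative (h : IsScaled I W e) (hW : 0 < W)
    (hnot : ¬ ConeMem (cols I.m I.n e W σ) (rhsV I.m I.n e σ) Finset.univ) :
    ∃ (p : Fin I.m → ℚ) (q : Fin I.n → ℚ) (τ : ℚ), (∀ k, p k ≤ 0) ∧
      (∀ j, ∑ k, p k * I.A k j + τ * (σ * I.c j) = 0) ∧
      (∀ k, ∑ j, I.A k j * q j ≤ τ * I.b k) ∧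
      0 < ∑ k, p k * I.b k + ∑ j, σ * I.c j * q j := by
  -- The residual of the nearest point separates the right hand side from the cone; its three row
  -- blocks are p, q and τ.
  obtain ⟨l, hl⟩ := exists_isNNLS (cols I.m I.n e W σ) (rhsV I.m I.n e σ)
  set w := resid (cols I.m I.n e W σ) (rhsV I.m I.n e σ) l with hw
  have hw0 : w ≠ 0 := fun h0 => hnot ⟨l, hl.nonneg, by
    have : restr (cols I.m I.n e W σ) Finset.univ = cols I.m I.n e W σ := by
      funext i; simp [restr]
    rw [this]; exact h0⟩
  have hpos : 0 < rhsV I.m I.n e σ ⬝ᵥ w := by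
    rw [hw, ← resid_self_eq hl.mul_dot]
    exact lt_of_le_of_ne (dotProduct_self_nonneg_rat _) fun h0 =>
      hw0 (dotProduct_self_eq_zero.mp h0.symm)
  have hdot := hl.dot_le
  rw [← hw] at hdot
  have hle : ∀ x : ℚ, W * x ≤ 0 → x ≤ 0 := fun x hx => by
    by_contra! h0; nlinarith [mul_pos hW h0]
  refine ⟨fun k => w (rowPrimal k), fun j => w (rowDual j), w rowObj, fun k => ?_, fun j => ?_,
    fun k => ?_, ?_⟩
  · have := hdot (ixSlack k)
    simp only [dotProduct, sum_rows, cols_slack_primal h, cols_slack_dual h, cols_slack_obj h,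
      mul_ite, mul_zero, Finset.sum_ite_eq', Finset.mem_univ, if_true, Finset.sum_const_zero,
      add_zero] at this
    exact hle _ (by linarith)
  · have h1 := hdot (ixPos j)
    have h2 := hdot (ixNeg j)
    simp only [dotProduct, sum_rows, cols_pos_primal h, cols_pos_dual h, cols_pos_obj h,
      cols_neg_primal h, cols_neg_dual h, cols_neg_obj h, mul_neg, Finset.sum_neg_distrib,
      mul_zero, Finset.sum_const_zero, add_zero] at h1 h2
    have h3 : ∑ k, w (rowPrimal k) * (W * I.A k j) = W * ∑ k, w (rowPrimal k) * I.A k j := by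
      rw [Finset.mul_sum]; exact Finset.sum_congr rfl fun k _ => by ring
    rw [h3] at h1 h2
    -- The columns of x⁺ and x⁻ are opposite, so their two inequalities combine to an equation.
    apply le_antisymm
    · exact hle _ (by linarith)
    · have := hle (-(∑ k, w (rowPrimal k) * I.A k j + w rowObj * (σ * I.c j))) (by linarith)
      linarith
  · have := hdot (ixDual k)
    simp only [dotProduct, sum_rows, cols_dual_primal h, cols_dual_dual h, cols_dual_obj h,
      mul_zero, Finset.sum_const_zero, zero_add] at this
    have h3 : ∑ j, w (rowDual j) * (W * I.A k j) = W * ∑ j, I.A k j * w (rowDual j) := by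
      rw [Finset.mul_sum]; exact Finset.sum_congr rfl fun k _ => by ring
    rw [h3] at this
    have := hle (∑ j, I.A k j * w (rowDual j) - w rowObj * I.b k) (by linarith)
    linarith
  · simp only [dotProduct, sum_rows, rhsV_primal h, rhsV_dual h, rhsV_obj h, zero_mul,
      add_zero] at hpos
    by_contra! hcon
    have h3 : ∑ k, W * I.b k * w (rowPrimal k) + ∑ j, W * (σ * I.c j) * w (rowDual j) =
        W * (∑ k, w (rowPrimal k) * I.b k + ∑ j, σ * I.c j * w (rowDual j)) := by
      rw [mul_add, Finset.mul_sum, Finset.mul_sum]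
      congr 1
      · exact Finset.sum_congr rfl fun j _ => by ring
      · exact Finset.sum_congr rfl fun j _ => by ring
    rw [h3] at hpos
    nlinarith

theorem feasible_of_resid (h : IsScaled I W e) (hW : 0 < W)
    {l : Fin (I.n + I.n + (I.m + I.m)) → ℚ} (hl0 : ∀ i, 0 ≤ l i)
    (hl : resid (cols I.m I.n e W σ) (rhsV I.m I.n e σ) l = 0) (k : Fin I.m) :
    ∑ j, I.A k j * (l (ixPos j) - l (ixNeg j)) ≤ I.b k := by
  have := (equations h hW hl).1 k
  linarith [hl0 (ixSlack k)]

/-- For σ = 0 the certificate satisfies p ≤ 0, pᵀA = 0 and pᵀb > 0. Applied to a real point with Ax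
≤ b it gives 0 ≥ pᵀb, so real feasibility is excluded by rational data. -/
theorem infeasible_of_not_coneMem (h : IsScaled I W e) (hW : 0 < W)
    (hnot : ¬ ConeMem (cols I.m I.n e W 0) (rhsV I.m I.n e 0) Finset.univ) :
    I.IsCorrect .infeasible := by
  obtain ⟨p, q, τ, hp, hA, -, hpos⟩ := alternative h hW hnot
  simp only [zero_mul, mul_zero, add_zero, Finset.sum_const_zero] at hA hpos
  change I.feasible = ∅
  rw [Set.eq_empty_iff_forall_notMem]
  intro x hx
  have h1 := sum_mul_sum_swap (fun k => (p k : ℝ)) (fun k j => (I.A k j : ℝ)) x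
  have h2 : ∀ j, ∑ k, (p k : ℝ) * (I.A k j : ℝ) = 0 := fun j => by exact_mod_cast hA j
  simp only [h2, zero_mul, Finset.sum_const_zero] at h1
  have h3 : (0 : ℝ) < ∑ k, (p k : ℝ) * (I.b k : ℝ) := by exact_mod_cast hpos
  have h4 : ∑ k, (p k : ℝ) * (I.b k : ℝ) ≤ ∑ k, (p k : ℝ) * ∑ j, (I.A k j : ℝ) * x j := by
    refine Finset.sum_le_sum fun k _ => mul_le_mul_of_nonpos_left (hx k) ?_
    exact_mod_cast hp k
  linarith

/-- Weak duality: the dual block is nonnegative with Aᵀy = c, and bᵀy equals the objective at x, so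
it bounds the objective at every feasible real point. -/
theorem optimal_of_resid (h : IsScaled I W e) (hW : 0 < W)
    {l : Fin (I.n + I.n + (I.m + I.m)) → ℚ} (hl0 : ∀ i, 0 ≤ l i)
    (hl : resid (cols I.m I.n e W 1) (rhsV I.m I.n e 1) l = 0) :
    I.IsCorrect (.optimal fun j => l (ixPos j) - l (ixNeg j)) := by
  obtain ⟨-, h2, h3⟩ := equations h hW hl
  simp only [one_mul] at h2 h3
  have h1 := feasible_of_resid h hW hl0 hl
  refine ⟨fun k => by beta_reduce; exact_mod_cast h1 k, fun z hz => ?_⟩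
  have h4 : I.objective (fun j => ((l (ixPos j) - l (ixNeg j) : ℚ) : ℝ)) =
      ∑ k, (l (ixDual k) : ℝ) * (I.b k : ℝ) := by
    unfold LPInst.objective; beta_reduce; exact_mod_cast h3
  rw [h4]
  have h5 := sum_mul_sum_swap (fun k => (l (ixDual k) : ℝ)) (fun k j => (I.A k j : ℝ)) z
  have h6 : ∀ j, ∑ k, (l (ixDual k) : ℝ) * (I.A k j : ℝ) = I.c j := fun j => by
    exact_mod_cast h2 j
  simp only [h6] at h5
  unfold LPInst.objective
  rw [← h5]
  refine Finset.sum_le_sum fun k _ => mul_le_mul_of_nonneg_left (hz k) ?_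
  exact_mod_cast hl0 _

/-- A certificate with τ > 0 would contradict itself once Aq ≤ τb is weighted with p. So τ ≤ 0, and
from a feasible x the direction q - τx is an improving ray. -/
theorem infinite_of_not_coneMem (h : IsScaled I W e) (hW : 0 < W)
    (hfeas : ConeMem (cols I.m I.n e W 0) (rhsV I.m I.n e 0) Finset.univ)
    (hnot : ¬ ConeMem (cols I.m I.n e W 1) (rhsV I.m I.n e 1) Finset.univ) :
    I.IsCorrect .infinite := by
  obtain ⟨l, hl0, hl⟩ := hfeas
  have hrestr : restr (cols I.m I.n e W 0) Finset.univ = cols I.m I.n e W 0 := by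
    funext i; simp [restr]
  rw [hrestr] at hl
  have hx := feasible_of_resid h hW hl0 hl
  set x : Fin I.n → ℚ := fun j => l (ixPos j) - l (ixNeg j)
  obtain ⟨p, q, τ, hp, hA, hq, hpos⟩ := alternative h hW hnot
  simp only [one_mul] at hA hpos
  have hpA : ∀ j, ∑ k, p k * I.A k j = -(τ * I.c j) := fun j => by linarith [hA j]
  have hsw : ∀ x : Fin I.n → ℚ, ∑ k, p k * ∑ j, I.A k j * x j = -(τ * ∑ j, I.c j * x j) := by
    intro x
    rw [sum_mul_sum_swap p I.A x]
    simp only [hpA, Finset.mul_sum, ← Finset.sum_neg_distrib]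
    exact Finset.sum_congr rfl fun j _ => by ring
  have hτ : τ ≤ 0 := by
    by_contra! hτ
    have h1 : ∑ k, p k * (τ * I.b k) ≤ ∑ k, p k * ∑ j, I.A k j * q j :=
      Finset.sum_le_sum fun k _ => mul_le_mul_of_nonpos_left (hq k) (hp k)
    rw [hsw] at h1
    have h2 : ∑ k, p k * (τ * I.b k) = τ * ∑ k, p k * I.b k := by
      rw [Finset.mul_sum]; exact Finset.sum_congr rfl fun j _ => by ring
    rw [h2] at h1
    nlinarith [mul_pos hτ hpos]
  -- Since -τ ≥ 0, adding -τ times Ax ≤ b to Aq ≤ τb gives Ad ≤ 0; the cases τ = 0 and τ < 0 need no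
  -- separation.
  set d : Fin I.n → ℚ := fun j => q j - τ * x j with hd
  have hAd : ∀ k, ∑ j, I.A k j * d j ≤ 0 := fun k => by
    have h1 : ∑ j, I.A k j * d j = ∑ j, I.A k j * q j - τ * ∑ j, I.A k j * x j := by
      rw [Finset.mul_sum, ← Finset.sum_sub_distrib]
      exact Finset.sum_congr rfl fun j _ => by rw [hd]; ring
    rw [h1]
    nlinarith [hq k, mul_le_mul_of_nonpos_left (hx k) hτ]
  have hcd : 0 < ∑ j, I.c j * d j := by
    have h1 : ∑ j, I.c j * d j = ∑ j, I.c j * q j - τ * ∑ j, I.c j * x j := by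
      rw [Finset.mul_sum, ← Finset.sum_sub_distrib]
      exact Finset.sum_congr rfl fun j _ => by rw [hd]; ring
    have h2 : ∑ k, p k * I.b k ≤ ∑ k, p k * ∑ j, I.A k j * x j :=
      Finset.sum_le_sum fun k _ => mul_le_mul_of_nonpos_left (hx k) (hp k)
    rw [hsw] at h2
    rw [h1]
    linarith
  have hray : ∀ t : ℚ, 0 ≤ t → (fun j => ((x j + t * d j : ℚ) : ℝ)) ∈ I.feasible := by
    intro t ht k
    have h1 : ∑ j, I.A k j * (x j + t * d j) ≤ I.b k := by
      have : ∑ j, I.A k j * (x j + t * d j) = ∑ j, I.A k j * x j + t * ∑ j, I.A k j * d j := by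
        rw [Finset.mul_sum, ← Finset.sum_add_distrib]
        exact Finset.sum_congr rfl fun j _ => by ring
      rw [this]
      nlinarith [hx k, mul_le_mul_of_nonneg_left (hAd k) ht]
    beta_reduce
    exact_mod_cast h1
  refine ⟨⟨_, hray 0 le_rfl⟩, ?_⟩
  rintro ⟨M, hM⟩
  obtain ⟨t, ht⟩ := exists_nat_gt ((M - ((∑ j, I.c j * x j : ℚ) : ℝ)) /
    ((∑ j, I.c j * d j : ℚ) : ℝ))
  have hcd' : (0 : ℝ) < ((∑ j, I.c j * d j : ℚ) : ℝ) := by exact_mod_cast hcd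
  rw [div_lt_iff₀ hcd'] at ht
  have h1 := hM ⟨_, hray t (Nat.cast_nonneg t), rfl⟩
  have h2 : I.objective (fun j => ((x j + t * d j : ℚ) : ℝ)) =
      ((∑ j, I.c j * x j : ℚ) : ℝ) + t * ((∑ j, I.c j * d j : ℚ) : ℝ) := by
    unfold LPInst.objective
    have : ∑ j, I.c j * (x j + t * d j) = ∑ j, I.c j * x j + t * ∑ j, I.c j * d j := by
      rw [Finset.mul_sum, ← Finset.sum_add_distrib]
      exact Finset.sum_congr rfl fun j _ => by ring
    beta_reduce
    exact_mod_cast this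
  rw [h2] at h1
  linarith

end LPTheory

/-! ## Rules for executions -/

/-- The program halts after at most `T` steps in a store with the property `P`. -/
def Runs (O : Oracle) (K S : ℕ) (c : Program) (s : State) (T : ℕ) (P : State → Prop) : Prop :=
  ∃ s' t, Exec O K S c s s' t ∧ t ≤ T ∧ P s'

section Rules

variable {O : Oracle} {K S : ℕ}

theorem Runs.mono {c : Program} {s : State} {T T' : ℕ} {P P' : State → Prop}
    (h : Runs O K S c s T P) (hT : T ≤ T') (hP : ∀ s', P s' → P' s') : Runs O K S c s T' P' := by
  obtain ⟨s', t, h1, h2, h3⟩ := h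
  exact ⟨s', t, h1, h2.trans hT, hP _ h3⟩

theorem Runs.skip {s : State} {P : State → Prop} (h : P s) : Runs O K S .skip s 1 P :=
  ⟨s, 1, .skip s, le_rfl, h⟩

theorem Runs.seq {c c' : Program} {s : State} {T T' : ℕ} {P Q : State → Prop}
    (h : Runs O K S c s T P) (h' : ∀ s', P s' → Runs O K S c' s' T' Q) :
    Runs O K S (.seq c c') s (T + T') Q := by
  obtain ⟨s', t, h1, h2, h3⟩ := h
  obtain ⟨s'', t', h4, h5, h6⟩ := h' s' h3
  exact ⟨s'', t + t', .seq h1 h4, by omega, h6⟩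

theorem Runs.setIdx {v : ℕ} {e : IExpr} {s : State} {P : State → Prop} (hK : e.eval s ≤ K)
    (h : P (s.setIdx v (e.eval s))) : Runs O K S (.setIdx v e) s (e.cost + 1) P :=
  ⟨_, _, .setIdx v e s hK, le_rfl, h⟩

theorem Runs.setCell {a : ℕ} {i : IExpr} {e : QExpr} {s : State} {P : State → Prop}
    (hS : ratSize (e.eval s) ≤ S) (h : P (s.setCell a (i.eval s) (e.eval s))) :
    Runs O K S (.setCell a i e) s (i.cost + e.cost + 1) P :=
  ⟨_, _, .setCell a i e s hS, le_rfl, h⟩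

theorem Runs.branch {b : Test} {c c' : Program} {s : State} {T : ℕ} {P : State → Prop}
    (h : b.Holds s → Runs O K S c s T P) (h' : ¬ b.Holds s → Runs O K S c' s T P) :
    Runs O K S (.branch b c c') s (b.cost + T) P := by
  by_cases hb : b.Holds s
  · obtain ⟨s', t, h1, h2, h3⟩ := h hb
    exact ⟨s', _, .branchTrue hb h1, by omega, h3⟩
  · obtain ⟨s', t, h1, h2, h3⟩ := h' hb
    exact ⟨s', _, .branchFalse hb h1, by omega, h3⟩

/-- The loop `for v := 0, …, e - 1 do c`. -/
def forLoop (v : ℕ) (e : IExpr) (c : Program) : Program :=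
  .seq (.setIdx v (.const 0))
    (.loop (.ilt (.var v) e) (.seq c (.setIdx v (.add (.var v) (.const 1)))))

/-- The invariant must fix the counter and the value of the limit e, which is evaluated again in
each round. The time is stated with D instead of n, so that it becomes a function of the dimension
alone. -/
theorem Runs.forLoop {v : ℕ} {e : IExpr} {c : Program} {s : State} {T n D : ℕ}
    (I : ℕ → State → Prop) (hD : n ≤ D) (hK : D ≤ K) (h0 : I 0 (s.setIdx v 0))
    (hv : ∀ k s, I k s → s.idx v = k ∧ e.eval s = n)
    (hc : ∀ k, k < n → ∀ s, I k s →
      Runs O K S c s T fun s' => s'.idx v = k ∧ I (k + 1) (s'.setIdx v (k + 1))) :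
    Runs O K S (StrongPoly.forLoop v e c) s (2 + (D + 1) * (e.cost + 6 + T)) (I n) := by
  have key : ∀ d k, k + d = n → ∀ s, I k s → Runs O K S
      (.loop (.ilt (.var v) e) (.seq c (.setIdx v (.add (.var v) (.const 1))))) s
      ((d + 1) * (e.cost + 6 + T)) (I n) := by
    intro d
    induction d with
    | zero =>
      intro k hk s hs
      obtain rfl : k = n := by omega
      obtain ⟨h1, h2⟩ := hv _ s hs
      refine ⟨s, _, .loopFalse ?_, ?_, hs⟩
      · simp [Test.Holds, IExpr.eval, h1, h2]
      · simp only [Test.cost, IExpr.cost]; omega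
    | succ d ih =>
      intro k hk s hs
      obtain ⟨h1, h2⟩ := hv k s hs
      obtain ⟨s', t, h3, h4, h5, h6⟩ := hc k (by omega) s hs
      obtain ⟨s'', t', h7, h8, h9⟩ := ih (k + 1) (by omega) _ h6
      have h10 : (IExpr.add (.var v) (.const 1)).eval s' = k + 1 := by simp [IExpr.eval, h5]
      have h11 := Exec.setIdx (O := O) (K := K) (S := S) v (.add (.var v) (.const 1)) s'
        (by rw [h10]; omega)
      rw [h10] at h11
      refine ⟨s'', _, .loopTrue ?_ (.seq h3 h11) h7, ?_, h9⟩
      · simp [Test.Holds, IExpr.eval, h1, h2]; omega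
      -- A round costs e.cost + 2 for the test, at most T for the body and 4 for the increment.
      · simp only [Test.cost, IExpr.cost]
        have : (d + 1 + 1) * (e.cost + 6 + T) =
          (d + 1) * (e.cost + 6 + T) + (e.cost + 6 + T) := by ring
        omega
  refine Runs.mono (Runs.seq (P := fun s' => s' = s.setIdx v 0)
    (Runs.setIdx (by simp [IExpr.eval]) (by simp [IExpr.eval]))
    fun s' hs' => key n 0 (by omega) s' (hs' ▸ h0)) ?_ fun _ h => h
  simp only [IExpr.cost]
  gcongr

/-- The stores `s` and `s'` differ at most in the index variables in `V` and the arrays in `A`. -/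
structure Agree (V A : List ℕ) (s s' : State) : Prop where
  idx : ∀ v, v ∉ V → s'.idx v = s.idx v
  mem : ∀ a, a ∉ A → s'.mem a = s.mem a

theorem Agree.refl (V A : List ℕ) (s : State) : Agree V A s s := ⟨fun _ _ => rfl, fun _ _ => rfl⟩

theorem Agree.setIdx {V A : List ℕ} {s s' : State} (h : Agree V A s s') {v : ℕ} (hv : v ∈ V)
    (k : ℕ) : Agree V A s (s'.setIdx v k) :=
  ⟨fun u hu => by
    have : u ≠ v := fun h => hu (h ▸ hv)
    simp [State.setIdx, this, h.idx u hu], h.mem⟩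

theorem Agree.setCell {V A : List ℕ} {s s' : State} (h : Agree V A s s') {a : ℕ} (ha : a ∈ A)
    (i : ℕ) (x : ℚ) : Agree V A s (s'.setCell a i x) :=
  ⟨h.idx, fun b hb => by
    have : b ≠ a := fun h => hb (h ▸ ha)
    funext j
    simp [State.setCell, this, h.mem b hb]⟩

theorem Agree.setList {V A : List ℕ} {s s' : State} (h : Agree V A s s') {a : ℕ} (ha : a ∈ A)
    (l : List ℚ) : Agree V A s (s'.setList a l) :=
  ⟨h.idx, fun b hb => by
    have : b ≠ a := fun h => hb (h ▸ ha)
    funext j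
    simp [State.setList, this, h.mem b hb]⟩

theorem Agree.weaken {V V' A A' : List ℕ} {s s' : State} (h : Agree V A s s') (hV : V ⊆ V')
    (hA : A ⊆ A') : Agree V' A' s s' :=
  ⟨fun v hv => h.idx v fun h => hv (hV h), fun a ha => h.mem a fun h => ha (hA h)⟩

theorem setIdx_idx_self (s : State) (v k : ℕ) : (s.setIdx v k).idx v = k := by
  simp [State.setIdx]

theorem setIdx_idx_ne (s : State) {u v : ℕ} (h : u ≠ v) (k : ℕ) :
    (s.setIdx v k).idx u = s.idx u := by
  simp [State.setIdx, h]

theorem setIdx_mem (s : State) (v k : ℕ) : (s.setIdx v k).mem = s.mem := rfl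

theorem setCell_mem_self (s : State) (a i : ℕ) (x : ℚ) : (s.setCell a i x).mem a i = x := by
  simp [State.setCell]

theorem setCell_mem_ne (s : State) (a : ℕ) {i j : ℕ} (h : j ≠ i) (x : ℚ) :
    (s.setCell a i x).mem a j = s.mem a j := by
  simp [State.setCell, h]

/-- The program that writes the product of `g` and of the values of `f` for `v < e` to the entry
`d` of the array `a`. -/
def productProg (a d v : ℕ) (e : IExpr) (g f : QExpr) : Program :=
  .seq (.setCell a (.const d) g)
    (StrongPoly.forLoop v e (.setCell a (.const d) (.mul (.cell a (.const d)) f)))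

/-- The evaluation hypotheses concern every store that differs from s only in the counter and the
accumulator, so they can be checked without following the loop. Every partial product is stored, so
each needs a size bound. -/
theorem Runs.productProg {a d v : ℕ} {e : IExpr} {f g : QExpr} {s : State} {n D : ℕ} {F : ℕ → ℚ}
    {x : ℚ} (hD : n ≤ D) (hK : D ≤ K) (hg : g.eval s = x)
    (he : ∀ s', Agree [v] [a] s s' → (∀ j, j ≠ d → s'.mem a j = s.mem a j) → e.eval s' = n)
    (hf : ∀ s', Agree [v] [a] s s' → (∀ j, j ≠ d → s'.mem a j = s.mem a j) → s'.idx v < n →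
      f.eval s' = F (s'.idx v))
    (hS : ∀ k, k ≤ n → ratSize (x * ∏ i ∈ Finset.range k, F i) ≤ S) :
    Runs O K S (StrongPoly.productProg a d v e g f) s
      ((g.cost + 2) + (2 + (D + 1) * (e.cost + 6 + (f.cost + 5))))
      (fun s' => Agree [v] [a] s s' ∧ (∀ j, j ≠ d → s'.mem a j = s.mem a j) ∧
        s'.mem a d = x * ∏ i ∈ Finset.range n, F i) := by
  refine Runs.seq (P := fun s' => Agree [v] [a] s s' ∧ (∀ j, j ≠ d → s'.mem a j = s.mem a j) ∧
    s'.mem a d = x) (Runs.mono (Runs.setCell ?_ ?_) (T := 1 + g.cost + 1) (by omega)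
    fun _ h => h) ?_
  · rw [hg]; simpa using hS 0 (by omega)
  · rw [hg]
    exact ⟨(Agree.refl _ _ _).setCell (by simp) _ _, fun j hj => setCell_mem_ne _ _ hj _,
      setCell_mem_self _ _ _ _⟩
  rintro s₁ ⟨h1, h2, h3⟩
  refine Runs.mono (Runs.forLoop (n := n) (D := D) (fun k s' => s'.idx v = k ∧
    Agree [v] [a] s s' ∧ (∀ j, j ≠ d → s'.mem a j = s.mem a j) ∧
    s'.mem a d = x * ∏ i ∈ Finset.range k, F i) hD hK ?_ ?_ ?_) le_rfl fun s' h => h.2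
  · exact ⟨setIdx_idx_self _ _ _, h1.setIdx (by simp) _, h2, by simpa [setIdx_mem] using h3⟩
  · rintro k s' ⟨h4, h5, h6, -⟩
    exact ⟨h4, he s' h5 h6⟩
  · rintro k hk s' ⟨h4, h5, h6, h7⟩
    have hev : (QExpr.mul (.cell a (.const d)) f).eval s' =
        x * ∏ i ∈ Finset.range (k + 1), F i := by
      simp only [QExpr.eval, IExpr.eval, hf s' h5 h6 (by omega), h4, h7, Finset.prod_range_succ]
      ring
    refine Runs.mono (Runs.setCell ?_ ?_) (T := 1 + (1 + 1 + f.cost + 1) + 1) (by omega)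
      fun _ h => h
    · rw [hev]; exact hS (k + 1) hk
    · rw [hev]
      exact ⟨h4, setIdx_idx_self _ _ _, (h5.setCell (by simp) _ _).setIdx (by simp) _,
        fun j hj => (setCell_mem_ne _ _ hj _).trans (h6 j hj), setCell_mem_self _ _ _ _⟩

/-- Filling a table of `n₁` rows of length `n₂`. -/
theorem Runs.fillTable {a u v : ℕ} (huv : u ≠ v) {e₁ e₂ : IExpr} {f : QExpr} {s : State}
    {n₁ n₂ D : ℕ} {F : ℕ → ℕ → ℚ} (hD₁ : n₁ ≤ D) (hD₂ : n₂ ≤ D) (hK : D ≤ K)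
    (he : ∀ s', Agree [u, v] [a] s s' → e₁.eval s' = n₁ ∧ e₂.eval s' = n₂)
    (hf : ∀ s', Agree [u, v] [a] s s' → s'.idx u < n₁ → s'.idx v < n₂ →
      f.eval s' = F (s'.idx u) (s'.idx v))
    (hS : ∀ i k, i < n₁ → k < n₂ → ratSize (F i k) ≤ S) :
    Runs O K S (StrongPoly.forLoop u e₁ (StrongPoly.forLoop v e₂
      (.setCell a (.add (.mul (.var u) e₂) (.var v)) f))) s
      (2 + (D + 1) * (e₁.cost + 6 + (2 + (D + 1) * (e₂.cost + 6 + (e₂.cost + f.cost + 5)))))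
      (fun s' => Agree [u, v] [a] s s' ∧
        ∀ i k, i < n₁ → k < n₂ → s'.mem a (i * n₂ + k) = F i k) := by
  refine Runs.mono (Runs.forLoop (n := n₁) (D := D) (fun i s' => s'.idx u = i ∧
      Agree [u, v] [a] s s' ∧ ∀ i' k, i' < i → k < n₂ → s'.mem a (i' * n₂ + k) = F i' k)
    hD₁ hK ?_ ?_ ?_) le_rfl fun s' h => h.2
  · exact ⟨setIdx_idx_self _ _ _, (Agree.refl _ _ _).setIdx (by simp) 0, fun i' k h => by omega⟩
  · rintro i s' ⟨h1, h2, -⟩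
    exact ⟨h1, (he s' h2).1⟩
  · rintro i hi s' ⟨h1, h2, h3⟩
    refine Runs.mono (Runs.forLoop (n := n₂) (D := D) (fun k s'' => s''.idx v = k ∧ s''.idx u = i ∧
        Agree [u, v] [a] s s'' ∧ (∀ i' k', i' < i → k' < n₂ → s''.mem a (i' * n₂ + k') = F i' k') ∧
        ∀ k', k' < k → s''.mem a (i * n₂ + k') = F i k') hD₂ hK ?_ ?_ ?_) le_rfl ?_
    · exact ⟨setIdx_idx_self _ _ _, by rw [setIdx_idx_ne _ huv, h1],
        h2.setIdx (by simp) 0, h3, fun k h => by omega⟩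
    · rintro k s'' ⟨h4, -, h5, -⟩
      exact ⟨h4, (he s'' h5).2⟩
    · rintro k hk s'' ⟨h4, h5, h6, h7, h8⟩
      have hidx : (IExpr.add (.mul (.var u) e₂) (.var v)).eval s'' = i * n₂ + k := by
        simp only [IExpr.eval, h4, h5, (he s'' h6).2]
      have hval : f.eval s'' = F i k := by
        rw [hf s'' h6 (by omega) (by omega), h4, h5]
      refine Runs.mono (Runs.setCell ?_ ?_)
        (T := (1 + e₂.cost + 1 + 1 + 1) + f.cost + 1) (by omega) fun _ h => h
      · rw [hval]; exact hS i k hi hk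
      · rw [hidx, hval]
        refine ⟨h4, setIdx_idx_self _ _ _, ?_, ?_, ?_, ?_⟩
        · rw [setIdx_idx_ne _ huv]; exact h5
        · exact (h6.setCell (by simp) _ _).setIdx (by simp) _
        · intro i' k' hi' hk'
          rw [setIdx_mem, setCell_mem_ne]
          · exact h7 i' k' hi' hk'
          -- Earlier rows end before row i begins, so the new entry overwrites none of them.
          · have : (i' + 1) * n₂ ≤ i * n₂ := Nat.mul_le_mul_right _ hi'
            have h9 : (i' + 1) * n₂ = i' * n₂ + n₂ := by ring
            omega
        · intro k' hk'
          rw [setIdx_mem]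
          rcases Nat.lt_succ_iff_lt_or_eq.mp hk' with h | rfl
          · rw [setCell_mem_ne _ _ (by omega)]; exact h8 k' h
          · exact setCell_mem_self _ _ _ _
    · rintro s'' ⟨-, h5, h6, h7, h8⟩
      refine ⟨h5, setIdx_idx_self _ _ _, h6.setIdx (by simp) _, fun i' k hi' hk => ?_⟩
      rw [setIdx_mem]
      rcases Nat.lt_succ_iff_lt_or_eq.mp hi' with h | rfl
      · exact h7 i' k h hk
      · exact h8 k hk

/-- Filling an array. -/
theorem Runs.fillArray {a v : ℕ} {e o : IExpr} {f : QExpr} {s : State} {n D off : ℕ} {F : ℕ → ℚ}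
    (hD : n ≤ D) (hK : D ≤ K)
    (he : ∀ s', Agree [v] [a] s s' → e.eval s' = n ∧ o.eval s' = off + s'.idx v)
    (hf : ∀ s', Agree [v] [a] s s' → s'.idx v < n → f.eval s' = F (s'.idx v))
    (hS : ∀ i, i < n → ratSize (F i) ≤ S) :
    Runs O K S (StrongPoly.forLoop v e (.setCell a o f)) s
      (2 + (D + 1) * (e.cost + 6 + (o.cost + f.cost + 1)))
      (fun s' => Agree [v] [a] s s' ∧ (∀ i, i < n → s'.mem a (off + i) = F i) ∧
        ∀ j, j < off → s'.mem a j = s.mem a j) := by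
  refine Runs.mono (Runs.forLoop (n := n) (D := D) (fun i s' => s'.idx v = i ∧
      Agree [v] [a] s s' ∧ (∀ i', i' < i → s'.mem a (off + i') = F i') ∧
        ∀ j, j < off → s'.mem a j = s.mem a j) hD hK ?_ ?_ ?_) le_rfl fun s' h => h.2
  · exact ⟨setIdx_idx_self _ _ _, (Agree.refl _ _ _).setIdx (by simp) 0, fun i' h => by omega,
      fun j _ => rfl⟩
  · rintro i s' ⟨h1, h2, -⟩
    exact ⟨h1, (he s' h2).1⟩
  · rintro i hi s' ⟨h1, h2, h3, h4⟩
    have hval : f.eval s' = F i := by rw [hf s' h2 (by omega), h1]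
    have hidx : o.eval s' = off + i := by rw [(he s' h2).2, h1]
    refine Runs.setCell ?_ ?_
    · rw [hval]; exact hS i hi
    · rw [hval, hidx]
      refine ⟨h1, setIdx_idx_self _ _ _, (h2.setCell (by simp) _ _).setIdx (by simp) _, ?_, ?_⟩
      · intro i' hi'
        rw [setIdx_mem]
        rcases Nat.lt_succ_iff_lt_or_eq.mp hi' with h | rfl
        · rw [setCell_mem_ne _ _ (by omega)]; exact h3 i' h
        · exact setCell_mem_self _ _ _ _
      · intro j hj
        rw [setIdx_mem, setCell_mem_ne _ _ (by omega)]; exact h4 j hj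

end Rules

/-! ## Encodings and sizes -/

theorem rowMajor_eq_map_range {m n : ℕ} (A : Fin m → Fin n → ℚ) (f : ℕ → ℚ)
    (h : ∀ (i : Fin m) (j : Fin n), f (i * n + j) = A i j) :
    rowMajor A = (List.range (m * n)).map f := by
  have h1 : (List.range (m * n)).map f = List.ofFn fun t : Fin (m * n) => f t := by
    rw [List.ofFn_eq_map, ← List.map_coe_finRange_eq_range, List.map_map]; rfl
  rw [h1, List.ofFn_mul, rowMajor]
  congr 1
  congr 1
  funext i
  congr 1
  funext j
  exact (h i j).symm

theorem length_rowMajor {m n : ℕ} (A : Fin m → Fin n → ℚ) : (rowMajor A).length = m * n := by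
  simp [rowMajor, List.length_flatten, Function.comp_def]

theorem getD_rowMajor {m n : ℕ} (A : Fin m → Fin n → ℚ) (i : Fin m) (j : Fin n) :
    (rowMajor A).getD (i * n + j) 0 = A i j := by
  have hj := j.2
  have hlt : (i : ℕ) * n + j < m * n := by
    have : ((i : ℕ) + 1) * n ≤ m * n := Nat.mul_le_mul_right _ i.2
    have h2 : ((i : ℕ) + 1) * n = i * n + n := by ring
    omega
  have hn : 0 < n := by omega
  obtain ⟨f, hf⟩ : ∃ f : ℕ → ℚ, ∀ (i : Fin m) (j : Fin n), f (i * n + j) = A i j := by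
    have hm : 0 < m := i.pos
    -- Division with remainder inverts the row-major numbering.
    refine ⟨fun t => if h : t / n < m then A ⟨t / n, h⟩ ⟨t % n, Nat.mod_lt _ hn⟩ else 0,
      fun i j => ?_⟩
    have h1 : ((i : ℕ) * n + j) / n = i := by
      rw [mul_comm, Nat.mul_add_div hn, Nat.div_eq_of_lt j.2, add_zero]
    have h2 : ((i : ℕ) * n + j) % n = j := by rw [Nat.mul_add_mod', Nat.mod_eq_of_lt j.2]
    simp only [h1, h2, i.2, dif_pos]
  rw [rowMajor_eq_map_range A f hf, List.getD_eq_getElem?_getD, List.getElem?_map,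
    List.getElem?_range hlt]
  exact hf i j

/-- The entries of the input; beyond the input there are zeros. -/
def LPInst.entry (I : LPInst) (j : ℕ) : ℚ := (LP.encInst I).nums.getD j 0

theorem LPInst.nums_eq (I : LPInst) : (LP.encInst I).nums =
    rowMajor (fun i j => I.A i j) ++ List.ofFn I.b ++ List.ofFn I.c := rfl

theorem LPInst.length_nums (I : LPInst) :
    (LP.encInst I).nums.length = I.m * I.n + I.m + I.n := by
  simp [I.nums_eq, length_rowMajor, add_assoc]

theorem LPInst.entry_A (I : LPInst) (i : Fin I.m) (j : Fin I.n) :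
    I.entry (i * I.n + j) = I.A i j := by
  have hj := j.2
  have hlt : (i : ℕ) * I.n + j < I.m * I.n := by
    have : ((i : ℕ) + 1) * I.n ≤ I.m * I.n := Nat.mul_le_mul_right _ i.2
    have h2 : ((i : ℕ) + 1) * I.n = i * I.n + I.n := by ring
    omega
  rw [LPInst.entry, I.nums_eq]
  rw [List.append_assoc, List.getD_append _ _ _ _ (by rw [length_rowMajor]; exact hlt),
    getD_rowMajor]

theorem LPInst.entry_b (I : LPInst) (i : Fin I.m) : I.entry (I.m * I.n + i) = I.b i := by
  rw [LPInst.entry, I.nums_eq]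
  rw [List.append_assoc, List.getD_append_right _ _ _ _ (by rw [length_rowMajor]; omega),
    length_rowMajor, add_tsub_cancel_left, List.getD_append _ _ _ _ (by simp)]
  simp [List.getD_eq_getElem?_getD]

theorem LPInst.entry_c (I : LPInst) (j : Fin I.n) : I.entry (I.m * I.n + I.m + j) = I.c j := by
  rw [LPInst.entry, I.nums_eq]
  rw [List.getD_append_right _ _ _ _ (by simp [length_rowMajor])]
  simp [List.getD_eq_getElem?_getD, length_rowMajor]

theorem LPInst.entry_ge (I : LPInst) {j : ℕ} (hj : I.m * I.n + I.m + I.n ≤ j) :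
    I.entry j = 0 := by
  rw [LPInst.entry, List.getD_eq_default]
  rw [I.length_nums]; exact hj

/-- The dimension of a linear program. -/
def LPInst.dim (I : LPInst) : ℕ := I.m * I.n + I.m + I.n

theorem LPInst.dim_eq (I : LPInst) : (LP.encInst I).dimension = I.dim := I.length_nums

/-- A common multiple of the denominators that also bounds the entries. -/
def LPInst.bigW (I : LPInst) : ℕ :=
  ∏ j ∈ Finset.range I.dim, (I.entry j).den * ((I.entry j).num.natAbs ^ 2 + 1)

/-- The number of columns. -/
def LPInst.N (I : LPInst) : ℕ := I.n + I.n + (I.m + I.m)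

/-- The number of rows. -/
def LPInst.r (I : LPInst) : ℕ := I.m + I.n + 1

/-- A bound for the subdeterminants of the Gram matrix of the columns. -/
def LPInst.bigB (I : LPInst) : ℕ := (I.N * (I.r * I.bigW ^ 4)) ^ I.N

/-- The scale of the queries. -/
def LPInst.bigE (I : LPInst) : ℕ := (I.N + 1) * I.bigB ^ 2

/-- A bound for the inner products of the vectors in the queries. -/
def LPInst.bigX (I : LPInst) : ℕ := (I.r + I.N) * (2 * I.bigE * I.bigW ^ 2) ^ 2

/-- A bound for the subdeterminants of the Gram matrices of the queries. -/
def LPInst.bigC (I : LPInst) : ℕ := (I.N * I.bigX) ^ I.N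

/-- The scale of the simplices in the queries. -/
def LPInst.bigL (I : LPInst) : ℕ := (I.N + 1) * I.bigC

/-- The entries of the input scaled with `bigW`. -/
def LPInst.scaled (I : LPInst) (j : ℕ) : ℤ := (I.entry j).num * (I.bigW / (I.entry j).den : ℕ)

/-- Each factor of `bigW` is a multiple of a denominator and dominates a numerator. Using num² + 1
avoids absolute values in the program and keeps the product nonzero. -/
theorem LPInst.factor_dvd (I : LPInst) {j : ℕ} (hj : j < I.dim) :
    (I.entry j).den * ((I.entry j).num.natAbs ^ 2 + 1) ∣ I.bigW :=
  Finset.dvd_prod_of_mem (fun j => (I.entry j).den * ((I.entry j).num.natAbs ^ 2 + 1))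
    (Finset.mem_range.mpr hj)

theorem LPInst.bigW_pos (I : LPInst) : 0 < I.bigW :=
  Finset.prod_pos fun j _ => Nat.mul_pos (I.entry j).den_pos (by positivity)

theorem LPInst.scaled_eq (I : LPInst) (j : ℕ) :
    (I.scaled j : ℚ) = (I.entry j).num * I.bigW / (I.entry j).den := by
  by_cases hj : j < I.dim
  · have h1 : (I.entry j).den ∣ I.bigW := (Dvd.intro _ rfl).trans (I.factor_dvd hj)
    have h2 : ((I.entry j).den : ℚ) ≠ 0 := by exact_mod_cast (I.entry j).den_pos.ne'
    rw [LPInst.scaled]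
    rw [Int.cast_mul, Int.cast_natCast, Nat.cast_div h1 h2]
    ring
  · simp [LPInst.scaled, I.entry_ge (not_lt.mp hj)]

theorem LPInst.scaled_eq_mul (I : LPInst) (j : ℕ) :
    (I.scaled j : ℚ) = I.bigW * I.entry j := by
  rw [I.scaled_eq]
  conv_rhs => rw [← Rat.num_div_den (I.entry j)]
  ring

theorem LPInst.isScaled (I : LPInst) : IsScaled I I.bigW fun j => (I.scaled j : ℚ) where
  A_eq i j := by rw [I.scaled_eq_mul, I.entry_A]
  b_eq i := by rw [I.scaled_eq_mul, I.entry_b]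
  c_eq j := by rw [I.scaled_eq_mul, I.entry_c]

theorem LPInst.abs_scaled_le (I : LPInst) (j : ℕ) : |I.scaled j| ≤ (I.bigW ^ 2 : ℕ) := by
  by_cases hj : j < I.dim
  · have h1 := Nat.le_of_dvd I.bigW_pos ((Dvd.intro_left _ rfl).trans (I.factor_dvd hj))
    have h2 : (I.entry j).num.natAbs ≤ I.bigW := by nlinarith [sq_nonneg ((I.entry j).num.natAbs)]
    have h3 : I.bigW / (I.entry j).den ≤ I.bigW := Nat.div_le_self _ _
    rw [LPInst.scaled, abs_mul, Int.abs_eq_natAbs, Nat.abs_cast, sq]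
    exact_mod_cast Nat.mul_le_mul h2 h3
  · simp [LPInst.scaled, I.entry_ge (not_lt.mp hj)]

theorem abs_col_le {m n : ℕ} {e : ℕ → ℤ} {W σ M : ℤ} (he : ∀ j, |e j| ≤ M) (hW : |W| ≤ M)
    (hσ : |σ| ≤ 1) (i k : ℕ) : |col m n e W σ i k| ≤ M := by
  have h0 : |(0 : ℤ)| ≤ M := by rw [abs_zero]; exact (abs_nonneg _).trans hW
  have hσs : ∀ j, |σ * e j| ≤ M := fun j => by
    rw [abs_mul]
    exact (mul_le_of_le_one_left (abs_nonneg _) hσ).trans (he j)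
  unfold col
  split_ifs <;> first | exact he _ | exact hσs _ | exact hW | exact h0 | skip
  all_goals rw [abs_neg]
  all_goals first | exact he _ | exact hσs _

theorem abs_rhs_le {m n : ℕ} {e : ℕ → ℤ} {σ M : ℤ} (he : ∀ j, |e j| ≤ M)
    (hσ : |σ| ≤ 1) (k : ℕ) : |rhs m n e σ k| ≤ M := by
  have h0 : |(0 : ℤ)| ≤ M := by rw [abs_zero]; exact (abs_nonneg _).trans (he 0)
  have hσs : ∀ j, |σ * e j| ≤ M := fun j => by
    rw [abs_mul]
    exact (mul_le_of_le_one_left (abs_nonneg _) hσ).trans (he j)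
  unfold rhs
  split_ifs <;> first | exact he _ | exact hσs _ | exact h0

theorem LPInst.abs_col_le (I : LPInst) {σ : ℤ} (hσ : |σ| ≤ 1) (i k : ℕ) :
    |col I.m I.n I.scaled I.bigW σ i k| ≤ (I.bigW ^ 2 : ℕ) :=
  StrongPoly.abs_col_le I.abs_scaled_le
    (by rw [Nat.abs_cast]; exact_mod_cast Nat.le_self_pow two_ne_zero _) hσ i k

theorem LPInst.abs_rhs_le (I : LPInst) {σ : ℤ} (hσ : |σ| ≤ 1) (k : ℕ) :
    |rhs I.m I.n I.scaled σ k| ≤ (I.bigW ^ 2 : ℕ) :=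
  StrongPoly.abs_rhs_le I.abs_scaled_le hσ k

theorem LPInst.gramBound (I : LPInst) {σ : ℤ} (hσ : |σ| ≤ 1) :
    GramBound (cols I.m I.n I.scaled I.bigW σ) (rhsV I.m I.n I.scaled σ) I.bigB := by
  have h := gramBound_of_entries (a := cols I.m I.n I.scaled I.bigW σ)
    (β := rhsV I.m I.n I.scaled σ) (M := I.bigW ^ 2) (X := I.r * I.bigW ^ 4)
    (Nat.mul_pos (by simp [LPInst.r]) (pow_pos I.bigW_pos _))
    (by rw [Fintype.card_fin, ← pow_mul]; rfl)
    (fun i k => I.abs_col_le hσ i k) fun k => I.abs_rhs_le hσ k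
  rwa [Fintype.card_fin] at h

theorem LPInst.bigB_pos (I : LPInst) : 1 ≤ I.bigB := (I.gramBound (σ := 0) (by simp)).one_le

theorem LPInst.bigE_pos (I : LPInst) : 1 ≤ I.bigE :=
  Nat.mul_pos (Nat.succ_pos _) (pow_pos I.bigB_pos _)

theorem LPInst.bigX_pos (I : LPInst) : 1 ≤ I.bigX := by
  have := I.bigE_pos
  have := I.bigW_pos
  have h : 1 ≤ I.r + I.N := by unfold LPInst.r; omega
  exact Nat.mul_pos h (by positivity)

theorem LPInst.bigC_pos (I : LPInst) : 1 ≤ I.bigC := by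
  unfold LPInst.bigC
  -- Without columns the base is 0, but the exponent is 0 too.
  rcases Nat.eq_zero_or_pos I.N with h | h
  · simp [h]
  · exact Nat.one_le_pow _ _ (Nat.mul_pos h I.bigX_pos)

theorem LPInst.bigL_pos (I : LPInst) : 1 ≤ I.bigL := Nat.mul_pos (Nat.succ_pos _) I.bigC_pos

/-! ### Bounds in terms of the encoding length -/

/-- The encoding length of the input plus one. -/
def LPInst.u (I : LPInst) : ℕ := (LP.encInst I).bitSize + 1

theorem two_le_ratSize (x : ℚ) : 2 ≤ ratSize x := by
  have : 0 < Nat.size x.den := Nat.size_pos.mpr x.den_pos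
  unfold ratSize; omega

theorem LPInst.bitSize_eq (I : LPInst) :
    (LP.encInst I).bitSize = ∑ j ∈ Finset.range I.dim, ratSize (I.entry j) := by
  rw [Datum.bitSize, LPInst.dim, ← I.length_nums]
  simp only [LPInst.entry]
  generalize (LP.encInst I).nums = l
  induction l with
  | nil => simp
  | cons x l ih =>
    rw [List.map_cons, List.sum_cons, ih, List.length_cons, Finset.sum_range_succ']
    simp [add_comm]

/-- Every rational number has encoding length at least 2. Hence the numbers of rows and columns are
absorbed into powers of 2 with exponent u. -/
theorem LPInst.two_mul_dim_lt (I : LPInst) : 2 * I.dim < I.u := by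
  rw [LPInst.u, I.bitSize_eq]
  have := Finset.card_nsmul_le_sum (Finset.range I.dim) (fun j => ratSize (I.entry j)) 2
    fun j _ => two_le_ratSize _
  simp at this
  omega

theorem LPInst.bigW_le (I : LPInst) : I.bigW ≤ 2 ^ (2 * I.u) := by
  calc I.bigW ≤ ∏ j ∈ Finset.range I.dim, 2 ^ (2 * ratSize (I.entry j)) := by
        refine Finset.prod_le_prod' fun j _ => ?_
        have h1 : (I.entry j).den ≤ 2 ^ (Nat.size (I.entry j).den) := (Nat.lt_size_self _).le
        have h2 : (I.entry j).num.natAbs ^ 2 + 1 ≤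
            (2 ^ (Nat.size (I.entry j).num.natAbs)) ^ 2 :=
          Nat.pow_lt_pow_left (Nat.lt_size_self _) two_ne_zero
        calc _ ≤ 2 ^ (Nat.size (I.entry j).den) * (2 ^ (Nat.size (I.entry j).num.natAbs)) ^ 2 :=
              Nat.mul_le_mul h1 h2
          _ = 2 ^ (Nat.size (I.entry j).den + Nat.size (I.entry j).num.natAbs * 2) := by
              rw [← pow_mul, ← pow_add]
          _ ≤ _ := Nat.pow_le_pow_right (by norm_num) (by unfold ratSize; omega)
    _ = 2 ^ (2 * ∑ j ∈ Finset.range I.dim, ratSize (I.entry j)) := by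
        rw [Finset.prod_pow_eq_pow_sum, Finset.mul_sum]
    _ ≤ 2 ^ (2 * I.u) := by
        rw [LPInst.u, I.bitSize_eq]
        exact Nat.pow_le_pow_right (by norm_num) (by omega)

theorem LPInst.N_le (I : LPInst) : I.N ≤ 2 * I.dim := by
  unfold LPInst.N LPInst.dim; omega

theorem LPInst.r_le (I : LPInst) : I.r ≤ I.dim + 1 := by
  unfold LPInst.r LPInst.dim; omega

theorem LPInst.u_pos (I : LPInst) : 1 ≤ I.u := Nat.succ_pos _

theorem mul_le_two_pow {a b s t v : ℕ} (ha : a ≤ 2 ^ s) (hb : b ≤ 2 ^ t) (h : s + t ≤ v) :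
    a * b ≤ 2 ^ v :=
  (Nat.mul_le_mul ha hb).trans (by rw [← pow_add]; exact Nat.pow_le_pow_right (by norm_num) h)

theorem pow_le_two_pow {a s k v : ℕ} (ha : a ≤ 2 ^ s) (h : s * k ≤ v) : a ^ k ≤ 2 ^ v :=
  (Nat.pow_le_pow_left ha k).trans
    (by rw [← pow_mul]; exact Nat.pow_le_pow_right (by norm_num) h)

theorem LPInst.N_lt_u (I : LPInst) : I.N < I.u := I.N_le.trans_lt I.two_mul_dim_lt

theorem LPInst.N_succ_le (I : LPInst) : I.N + 1 ≤ 2 ^ I.u :=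
  I.N_lt_u.trans_le Nat.lt_two_pow_self.le

theorem LPInst.r_le_pow (I : LPInst) : I.r ≤ 2 ^ I.u :=
  (by have := I.r_le; have := I.two_mul_dim_lt; omega : I.r ≤ I.u).trans Nat.lt_two_pow_self.le

theorem LPInst.u_le_sq (I : LPInst) : I.u ≤ I.u ^ 2 := Nat.le_self_pow two_ne_zero _

theorem LPInst.sq_le_cube (I : LPInst) : I.u ^ 2 ≤ I.u ^ 3 :=
  Nat.pow_le_pow_right I.u_pos (by norm_num)

/-- The base has at most u + u + 8u bits, from N, r and the fourth power of `bigW`, and N < u copies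
are multiplied. The N-th power in `bigC` repeats this once, hence the cubic exponents below. -/
theorem LPInst.bigB_le (I : LPInst) : I.bigB ≤ 2 ^ (10 * I.u ^ 2) := by
  have h1 : I.N * (I.r * I.bigW ^ 4) ≤ 2 ^ (10 * I.u) :=
    mul_le_two_pow (Nat.le_of_succ_le I.N_succ_le)
      (mul_le_two_pow I.r_le_pow (pow_le_two_pow I.bigW_le le_rfl) le_rfl) (by omega)
  refine pow_le_two_pow h1 ?_
  have := Nat.mul_le_mul_left (10 * I.u) I.N_lt_u.le
  calc _ ≤ _ := this
    _ = _ := by ring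

theorem LPInst.bigE_le (I : LPInst) : I.bigE ≤ 2 ^ (21 * I.u ^ 2) :=
  mul_le_two_pow I.N_succ_le (pow_le_two_pow I.bigB_le le_rfl) (by have := I.u_le_sq; omega)

theorem LPInst.EW_le (I : LPInst) : I.bigE * I.bigW ^ 2 ≤ 2 ^ (25 * I.u ^ 2) :=
  mul_le_two_pow I.bigE_le (pow_le_two_pow I.bigW_le le_rfl) (by have := I.u_le_sq; omega)

theorem LPInst.two_EW_le (I : LPInst) : 2 * I.bigE * I.bigW ^ 2 ≤ 2 ^ (26 * I.u ^ 2) := by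
  rw [mul_assoc]
  refine mul_le_two_pow (s := 1) (by norm_num) I.EW_le ?_
  have := I.u_le_sq; have := I.u_pos; omega

theorem LPInst.bigX_le (I : LPInst) : I.bigX ≤ 2 ^ (54 * I.u ^ 2) := by
  have h1 : I.r + I.N ≤ 2 ^ (2 * I.u) := by
    have h1 := I.r_le_pow
    have h2 := I.N_succ_le
    have h3 : 2 * 2 ^ I.u ≤ 2 ^ (2 * I.u) :=
      mul_le_two_pow (s := 1) (by norm_num) le_rfl (by have := I.u_pos; omega)
    omega
  exact mul_le_two_pow h1 (pow_le_two_pow I.two_EW_le le_rfl) (by have := I.u_le_sq; omega)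

theorem LPInst.bigC_le (I : LPInst) : I.bigC ≤ 2 ^ (55 * I.u ^ 3) := by
  have h1 : I.N * I.bigX ≤ 2 ^ (55 * I.u ^ 2) :=
    mul_le_two_pow (Nat.le_of_succ_le I.N_succ_le) I.bigX_le (by have := I.u_le_sq; omega)
  refine pow_le_two_pow h1 ?_
  calc _ ≤ 55 * I.u ^ 2 * I.u := Nat.mul_le_mul_left _ I.N_lt_u.le
    _ = _ := by ring

theorem LPInst.bigL_le (I : LPInst) : I.bigL ≤ 2 ^ (56 * I.u ^ 3) :=
  mul_le_two_pow I.N_succ_le I.bigC_le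
    (by have := I.u_le_sq; have := I.sq_le_cube; omega)

/-- The bound for the encoding lengths. -/
def LPInst.bigS (I : LPInst) : ℕ := 300 * I.u ^ 3

/-- The reduced numerator and denominator divide P and Q, so any representation as a fraction bounds
the size. -/
theorem ratSize_le {x : ℚ} {Q P : ℤ} {s : ℕ} (hQ : 1 ≤ Q) (hQs : Q ≤ 2 ^ s) (h : (Q : ℚ) * x = P)
    (hP : |P| ≤ 2 ^ s) : ratSize x ≤ 2 * s + 3 := by
  have hQ0 : (Q : ℚ) ≠ 0 := by
    have : Q ≠ 0 := by omega
    exact_mod_cast this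
  have hx : x = Rat.divInt P Q := by
    rw [Rat.divInt_eq_div, ← h]; field_simp
  have hden : x.den ≤ 2 ^ s := by
    have h1 : (x.den : ℤ) ∣ Q := hx ▸ Rat.den_dvd P Q
    exact_mod_cast (Int.le_of_dvd (by omega) h1).trans hQs
  have hnum : x.num.natAbs ≤ 2 ^ s := by
    by_cases hP0 : P = 0
    · have : x = 0 := by rw [hx, hP0]; simp
      simp [this]
    · have h1 : x.num ∣ P := hx ▸ Rat.num_dvd P (by omega)
      have h2 := Nat.le_of_dvd (Int.natAbs_pos.mpr hP0) (Int.natAbs_dvd_natAbs.mpr h1)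
      have h3 : (P.natAbs : ℤ) ≤ 2 ^ s := by rwa [← Int.abs_eq_natAbs]
      exact h2.trans (by exact_mod_cast h3)
  have hlt : 2 ^ s < 2 ^ (s + 1) := Nat.pow_lt_pow_right (by norm_num) (by omega)
  have h1 : Nat.size x.den ≤ s + 1 := Nat.size_le.mpr (by omega)
  have h2 : Nat.size x.num.natAbs ≤ s + 1 := Nat.size_le.mpr (by omega)
  unfold ratSize
  omega

/-- The exponent 110u³ leaves room for the numerators of the answers, bounded by `bigC` times `bigX`
with exponent 55u³ + 54u²; and 2 · 110u³ + 3 ≤ 300u³. -/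
theorem LPInst.ratSize_le_bigS (I : LPInst) {x : ℚ} {Q P : ℤ} (hQ : 1 ≤ Q)
    (hQs : Q ≤ (2 ^ (110 * I.u ^ 3) : ℕ)) (h : (Q : ℚ) * x = P)
    (hP : |P| ≤ (2 ^ (110 * I.u ^ 3) : ℕ)) : ratSize x ≤ I.bigS := by
  have h1 := ratSize_le (s := 110 * I.u ^ 3) hQ (by exact_mod_cast hQs) h (by exact_mod_cast hP)
  have h2 : 1 ≤ I.u ^ 3 := Nat.one_le_pow _ _ I.u_pos
  unfold LPInst.bigS
  omega

theorem LPInst.ratSize_int_le (I : LPInst) {z : ℤ} (hz : |z| ≤ (2 ^ (110 * I.u ^ 3) : ℕ)) :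
    ratSize (z : ℚ) ≤ I.bigS :=
  I.ratSize_le_bigS le_rfl (by exact_mod_cast Nat.one_le_two_pow) (by simp) hz

theorem LPInst.ratSize_nat_le (I : LPInst) {z : ℕ} (hz : z ≤ 2 ^ (110 * I.u ^ 3)) :
    ratSize (z : ℚ) ≤ I.bigS := by
  have := I.ratSize_int_le (z := z) (by rw [Nat.abs_cast]; exact_mod_cast hz)
  simpa using this

/-! ## The queries -/

/-- The integer columns of the system. -/
def LPInst.zcols (I : LPInst) (σ : ℕ) : Fin I.N → Fin I.r → ℤ :=
  cols I.m I.n I.scaled I.bigW σ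

/-- The integer right hand side of the system. -/
def LPInst.zrhs (I : LPInst) (σ : ℕ) : Fin I.r → ℤ := rhsV I.m I.n I.scaled σ

/-- The columns of the system, as rational vectors. -/
def LPInst.qcols (I : LPInst) (σ : ℕ) : Fin I.N → Fin I.r → ℚ := fun i k => (I.zcols σ i k : ℚ)

/-- The right hand side of the system, as a rational vector. -/
def LPInst.qrhs (I : LPInst) (σ : ℕ) : Fin I.r → ℚ := fun k => (I.zrhs σ k : ℚ)

theorem LPInst.gramBound_z (I : LPInst) {σ : ℕ} (hσ : σ ≤ 1) :
    GramBound (I.zcols σ) (I.zrhs σ) I.bigB :=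
  I.gramBound (by rw [Nat.abs_cast]; exact_mod_cast hσ)

theorem LPInst.cols_eq (I : LPInst) (σ : ℕ) :
    cols I.m I.n (fun j => (I.scaled j : ℚ)) I.bigW σ = I.qcols σ := by
  have := cols_intCast I.m I.n I.scaled I.bigW σ
  simp only [Int.cast_natCast] at this
  exact this

theorem LPInst.rhsV_eq (I : LPInst) (σ : ℕ) :
    rhsV I.m I.n (fun j => (I.scaled j : ℚ)) σ = I.qrhs σ := by
  have := rhsV_intCast I.m I.n I.scaled σ
  simp only [Int.cast_natCast] at this
  exact this

theorem LPInst.qcols_apply (I : LPInst) (σ : ℕ) (i : Fin I.N) (k : Fin I.r) :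
    I.qcols σ i k = col I.m I.n (fun j => (I.scaled j : ℚ)) I.bigW σ i k := by
  rw [← I.cols_eq]; rfl

theorem LPInst.qrhs_apply (I : LPInst) (σ : ℕ) (k : Fin I.r) :
    I.qrhs σ k = rhs I.m I.n (fun j => (I.scaled j : ℚ)) σ k := by
  rw [← I.rhsV_eq]; rfl

/-- The vectors of a query. -/
def LPInst.qV (I : LPInst) (σ : ℕ) (S : Finset (Fin I.N)) (t : Fin I.N → ℤ) :
    Fin I.N → Fin (I.r + I.N) → ℚ := qvec (I.bigE : ℚ) (I.qcols σ) S fun i => (t i : ℚ)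

/-- The target of a query. -/
def LPInst.qT (I : LPInst) (σ j y : ℕ) : Fin (I.r + I.N) → ℚ :=
  qtgt (I.bigE : ℚ) (I.qrhs σ) j (y : ℚ)

/-- A bound for the entries of the vectors and targets of the queries. -/
def LPInst.bigM (I : LPInst) : ℕ := 2 * I.bigE * I.bigW ^ 2

/-- The factor 2 in `bigM` accommodates the target positions y ≤ 2. -/
theorem LPInst.two_le_bigM (I : LPInst) : 2 ≤ I.bigM := by
  have h1 := I.bigE_pos
  have h2 : 0 < I.bigW ^ 2 := pow_pos I.bigW_pos 2
  have : 1 ≤ I.bigE * I.bigW ^ 2 := Nat.mul_pos h1 h2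
  unfold LPInst.bigM
  nlinarith

theorem LPInst.scale_le_bigM (I : LPInst) {z : ℤ} (hz : |z| ≤ (I.bigW ^ 2 : ℕ)) :
    |(I.bigE : ℤ) * z| ≤ I.bigM := by
  rw [abs_mul, Nat.abs_cast]
  calc (I.bigE : ℤ) * |z| ≤ I.bigE * (I.bigW ^ 2 : ℕ) := by gcongr
    _ ≤ 2 * (I.bigE * (I.bigW ^ 2 : ℕ)) := by
        have : (0 : ℤ) ≤ I.bigE * (I.bigW ^ 2 : ℕ) := by positivity
        linarith
    _ = I.bigM := by unfold LPInst.bigM; push_cast; ring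

theorem LPInst.exists_int_qV (I : LPInst) {σ : ℕ} (hσ : σ ≤ 1) (S : Finset (Fin I.N))
    {t : Fin I.N → ℤ} (ht : ∀ i, |t i| ≤ 1) :
    ∃ v : Fin I.N → Fin (I.r + I.N) → ℤ, I.qV σ S t = (fun i k => (v i k : ℚ)) ∧
      ∀ i k, |v i k| ≤ I.bigM := by
  refine ⟨qvec (I.bigE : ℤ) (I.zcols σ) S t, ?_, fun i k => ?_⟩
  · rw [← qvec_intCast]; simp only [Int.cast_natCast]; rfl
  · have h2 := I.two_le_bigM
    refine Fin.addCases (fun k => ?_) (fun k => ?_) k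
    · simp only [qvec, Fin.append_left, Pi.smul_apply, smul_eq_mul, restr]
      refine I.scale_le_bigM ?_
      split_ifs
      · exact I.abs_col_le (by rw [Nat.abs_cast]; exact_mod_cast hσ) i k
      · simp
    · simp only [qvec, Fin.append_right, Pi.single_apply]
      split_ifs
      · exact (ht i).trans (by exact_mod_cast (by omega : 1 ≤ I.bigM))
      · simp

theorem LPInst.exists_int_qT (I : LPInst) {σ : ℕ} (hσ : σ ≤ 1) (j : ℕ) {y : ℕ} (hy : y ≤ 2) :
    ∃ v : Fin (I.r + I.N) → ℤ, I.qT σ j y = (fun k => (v k : ℚ)) ∧ ∀ k, |v k| ≤ I.bigM := by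
  refine ⟨qtgt (I.bigE : ℤ) (I.zrhs σ) j y, ?_, fun k => ?_⟩
  · rw [← qtgt_intCast]; simp only [Int.cast_natCast]; rfl
  · have h2 := I.two_le_bigM
    refine Fin.addCases (fun k => ?_) (fun k => ?_) k
    · simp only [qtgt, Fin.append_left, Pi.smul_apply, smul_eq_mul]
      exact I.scale_le_bigM (I.abs_rhs_le (by rw [Nat.abs_cast]; exact_mod_cast hσ) k)
    · simp only [qtgt, Fin.append_right]
      split_ifs
      · rw [Nat.abs_cast]; exact_mod_cast hy.trans h2
      · simp

theorem LPInst.bigM_le (I : LPInst) : I.bigM ≤ 2 ^ (26 * I.u ^ 3) :=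
  I.two_EW_le.trans (Nat.pow_le_pow_right (by norm_num) (by have := I.sq_le_cube; omega))

/-- The size of the entries of a query. -/
theorem LPInst.ratSize_conePts_le (I : LPInst) {σ : ℕ} (hσ : σ ≤ 1) (S : Finset (Fin I.N))
    {t : Fin I.N → ℤ} (ht : ∀ i, |t i| ≤ 1) (j : ℕ) {y : ℕ} (hy : y ≤ 2)
    (i : Fin (I.N + 1)) (k : Fin (I.r + I.N)) :
    ratSize (conePts (I.qV σ S t) (I.qT σ j y) I.bigL i k) ≤ I.bigS := by
  obtain ⟨v, hv, hvb⟩ := I.exists_int_qV hσ S ht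
  obtain ⟨b, hb, hbb⟩ := I.exists_int_qT hσ j hy
  have hpos : 0 < I.u ^ 3 := pow_pos I.u_pos 3
  have hLM : I.bigL * I.bigM + I.bigM ≤ 2 ^ (110 * I.u ^ 3) := by
    have h1 : I.bigL * I.bigM ≤ 2 ^ (82 * I.u ^ 3) :=
      mul_le_two_pow I.bigL_le I.bigM_le (by omega)
    have h2 : I.bigM ≤ 2 ^ (82 * I.u ^ 3) :=
      I.bigM_le.trans (Nat.pow_le_pow_right (by norm_num) (by omega))
    have h3 : 2 * 2 ^ (82 * I.u ^ 3) ≤ 2 ^ (110 * I.u ^ 3) :=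
      mul_le_two_pow (s := 1) (by norm_num) le_rfl (by omega)
    omega
  have hLM' : (I.bigL : ℤ) * I.bigM + I.bigM ≤ (2 ^ (110 * I.u ^ 3) : ℕ) := by exact_mod_cast hLM
  rw [hv, hb]
  refine Fin.lastCases ?_ (fun i => ?_) i
  · have h : conePts (fun i k => (v i k : ℚ)) (fun k => (b k : ℚ)) I.bigL (Fin.last I.N) k =
        ((-b k : ℤ) : ℚ) := by rw [conePts_last]; simp
    rw [h]
    refine I.ratSize_int_le ?_
    rw [abs_neg]
    have : (0 : ℤ) ≤ I.bigL * I.bigM := mul_nonneg (Int.natCast_nonneg _) (Int.natCast_nonneg _)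
    linarith [hbb k]
  · have h : conePts (fun i k => (v i k : ℚ)) (fun k => (b k : ℚ)) I.bigL i.castSucc k =
        ((I.bigL * v i k - b k : ℤ) : ℚ) := by rw [conePts_castSucc]; simp
    rw [h]
    refine I.ratSize_int_le ?_
    refine (abs_sub _ _).trans ?_
    rw [abs_mul, Nat.abs_cast]
    have : (I.bigL : ℤ) * |v i k| ≤ I.bigL * I.bigM :=
      mul_le_mul_of_nonneg_left (hvb i k) (Int.natCast_nonneg _)
    linarith [hbb k]

/-- The answer to a query. -/
theorem LPInst.query_answer (I : LPInst) {O : Oracle} (hO : O.Solves DVS) {σ : ℕ} (hσ : σ ≤ 1)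
    (S : Finset (Fin I.N)) {t : Fin I.N → ℤ} (ht : ∀ i, |t i| ≤ 1) (j : ℕ) {y : ℕ} (hy : y ≤ 2)
    (hind : FamIndep (I.qV σ S t) Finset.univ) :
    ∃ l, IsNNLS (I.qV σ S t) (I.qT σ j y) l ∧
      O ⟨[I.r + I.N, I.N + 1], rowMajor (conePts (I.qV σ S t) (I.qT σ j y) I.bigL)⟩ =
        [resid (I.qV σ S t) (I.qT σ j y) l ⬝ᵥ resid (I.qV σ S t) (I.qT σ j y) l] ∧
      ratSize (resid (I.qV σ S t) (I.qT σ j y) l ⬝ᵥ resid (I.qV σ S t) (I.qT σ j y) l) ≤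
        I.bigS := by
  obtain ⟨l, hl⟩ := exists_isNNLS (I.qV σ S t) (I.qT σ j y)
  obtain ⟨v, hv, hvb⟩ := I.exists_int_qV hσ S ht
  obtain ⟨b, hb, hbb⟩ := I.exists_int_qT hσ j hy
  -- Cramer's rule is used a second time, now for the lifted integer vectors; it bounds both the
  -- coefficient sum, for the scale `bigL`, and the answer.
  have hG : GramBound v b I.bigC := by
    have h := gramBound_of_entries (a := v) (β := b) (M := I.bigM) (X := I.bigX) I.bigX_pos
      (by rw [Fintype.card_fin]; rfl) hvb hbb
    rwa [Fintype.card_fin] at h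
  have hl' := hl
  rw [hv, hb] at hl'
  refine ⟨l, hl, oracle_conePts hO (by exact_mod_cast I.bigL_pos) hind hl ?_, ?_⟩
  · refine (hG.isNNLS_sum_le hl').trans ?_
    rw [Fintype.card_fin, LPInst.bigL]
    push_cast
    have : (0 : ℚ) ≤ I.bigC := by positivity
    nlinarith
  · obtain ⟨Q, P, hQ, hQC, hP, hP0, hPC⟩ := hG.value hl'
    have hpos : 0 < I.u ^ 3 := pow_pos I.u_pos 3
    rw [hv, hb]
    refine I.ratSize_le_bigS hQ ?_ hP ?_
    · refine hQC.trans ?_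
      exact_mod_cast I.bigC_le.trans (Nat.pow_le_pow_right (by norm_num) (by omega))
    · rw [abs_of_nonneg hP0]
      have hbX : b ⬝ᵥ b ≤ I.bigX := by
        have h1 : ∀ k ∈ Finset.univ, b k * b k ≤ (I.bigM : ℤ) ^ 2 := fun k _ => by
          rw [← abs_mul_abs_self, sq]
          exact mul_le_mul (hbb k) (hbb k) (abs_nonneg _) (by positivity)
        refine (Finset.sum_le_card_nsmul _ _ _ h1).trans ?_
        rw [nsmul_eq_mul, Finset.card_univ, Fintype.card_fin]
        exact_mod_cast le_rfl
      have h2 : (I.bigC : ℤ) * (b ⬝ᵥ b) ≤ I.bigC * I.bigX :=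
        mul_le_mul_of_nonneg_left hbX (by positivity)
      have h3 : I.bigC * I.bigX ≤ 2 ^ (110 * I.u ^ 3) :=
        mul_le_two_pow I.bigC_le I.bigX_le (by have := I.sq_le_cube; omega)
      exact (hPC.trans h2).trans (by exact_mod_cast h3)

/-- The entries of a query as computed by the program. -/
def queryEntry (I : LPInst) (σ : ℕ) (act t : ℕ → ℚ) (j y i k : ℕ) : ℚ :=
  if k < I.r then
    (if i < I.N then I.bigL * I.bigE * act i *
      col I.m I.n (fun j => (I.scaled j : ℚ)) I.bigW σ i k else 0) -
      I.bigE * rhs I.m I.n (fun j => (I.scaled j : ℚ)) σ k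
  else (if i = k - I.r then I.bigL * t i else 0) - if k - I.r = j then (y : ℚ) else 0

theorem conePts_eq_queryEntry (I : LPInst) (σ : ℕ) (S : Finset (Fin I.N)) (t : Fin I.N → ℤ)
    (j y : ℕ) {act t' : ℕ → ℚ} (hact : ∀ i : Fin I.N, act i = if i ∈ S then 1 else 0)
    (ht : ∀ i : Fin I.N, t' i = t i) (i : Fin (I.N + 1)) (k : Fin (I.r + I.N)) :
    conePts (I.qV σ S t) (I.qT σ j y) I.bigL i k = queryEntry I σ act t' j y i k := by
  refine Fin.lastCases ?_ (fun i => ?_) i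
  · rw [conePts_last]
    refine Fin.addCases (fun k => ?_) (fun k => ?_) k
    · simp [queryEntry, LPInst.qT, qtgt, I.qrhs_apply]
    -- The vertex -β has index N, to which no extra coordinate belongs.
    · have : I.N ≠ k := k.2.ne'
      simp [queryEntry, LPInst.qT, qtgt, this]
  · rw [conePts_castSucc]
    refine Fin.addCases (fun k => ?_) (fun k => ?_) k
    · by_cases hi : i ∈ S
      · simp [queryEntry, LPInst.qT, LPInst.qV, qvec, restr, qtgt, I.qrhs_apply, I.qcols_apply,
          hact, hi, mul_assoc]
      · simp [queryEntry, LPInst.qT, LPInst.qV, qvec, restr, qtgt, I.qrhs_apply, hact, hi]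
    · by_cases hik : i = k
      · subst hik
        simp [queryEntry, LPInst.qT, LPInst.qV, qvec, qtgt, ht]
      · have : (i : ℕ) ≠ k := fun h => hik (Fin.ext h)
        simp [queryEntry, LPInst.qT, LPInst.qV, qvec, qtgt, this, Ne.symm hik]

/-! ## The program -/

/-- Polynomial functions. -/
def IsPoly (f : ℕ → ℕ) : Prop := ∃ p : Polynomial ℕ, ∀ x, f x = p.eval x

theorem IsPoly.const (c : ℕ) : IsPoly fun _ => c := ⟨.C c, fun x => by simp⟩

theorem IsPoly.id : IsPoly fun x => x := ⟨.X, fun x => by simp⟩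

theorem IsPoly.add {f g : ℕ → ℕ} (hf : IsPoly f) (hg : IsPoly g) : IsPoly fun x => f x + g x := by
  obtain ⟨p, hp⟩ := hf
  obtain ⟨q, hq⟩ := hg
  exact ⟨p + q, fun x => by simp [hp, hq]⟩

theorem IsPoly.mul {f g : ℕ → ℕ} (hf : IsPoly f) (hg : IsPoly g) : IsPoly fun x => f x * g x := by
  obtain ⟨p, hp⟩ := hf
  obtain ⟨q, hq⟩ := hg
  exact ⟨p * q, fun x => by simp [hp, hq]⟩

/-- A bound for all indices. -/
def idxBound (d : ℕ) : ℕ := 4 * d + 4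

theorem isPoly_idxBound : IsPoly idxBound := ((IsPoly.const 4).mul .id).add (.const 4)

/-! ### Expressions -/

/-- The expression `if x < y then a else b`. -/
def iteLt (x y : IExpr) (a b : QExpr) : QExpr :=
  .add (.mul (.ofIdx (.sub (.const 1) (.sub (.const 1) (.sub y x)))) a)
    (.mul (.ofIdx (.sub (.const 1) (.sub y x))) b)

/-- The expression `if x = y then a else b`. -/
def iteEq (x y : IExpr) (a b : QExpr) : QExpr :=
  .add (.mul (.ofIdx (.sub (.const 1) (.add (.sub y x) (.sub x y)))) a)
    (.mul (.ofIdx (.sub (.const 1) (.sub (.const 1) (.add (.sub y x) (.sub x y))))) b)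

/-- Expressions have no conditionals, but truncated subtraction gives indicators: 1 - (y - x) is 1
if y ≤ x and 0 otherwise. Both alternatives are evaluated, which is harmless because division is
total. -/
theorem iteLt_eval (x y : IExpr) (a b : QExpr) (s : State) :
    (iteLt x y a b).eval s = if x.eval s < y.eval s then a.eval s else b.eval s := by
  simp only [iteLt, QExpr.eval, IExpr.eval]
  split_ifs with h
  · have h1 : 1 - (y.eval s - x.eval s) = 0 := by omega
    simp [h1]
  · have h1 : y.eval s - x.eval s = 0 := by omega
    simp [h1]

theorem iteEq_eval (x y : IExpr) (a b : QExpr) (s : State) :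
    (iteEq x y a b).eval s = if x.eval s = y.eval s then a.eval s else b.eval s := by
  simp only [iteEq, QExpr.eval, IExpr.eval]
  split_ifs with h
  · simp [h]
  · have h1 : 1 - (y.eval s - x.eval s + (x.eval s - y.eval s)) = 0 := by omega
    simp [h1]

/-- The number of rows of the matrix. -/
abbrev mX : IExpr := .var 0

/-- The number of columns of the matrix. -/
abbrev nX : IExpr := .var 1

/-- The number of columns of the system. -/
def colsX : IExpr := .add (.add nX nX) (.add mX mX)

/-- The number of rows of the system. -/
def rowsX : IExpr := .add (.add mX nX) (.const 1)

/-- The dimension of the input. -/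
def dimX : IExpr := .add (.add (.mul mX nX) mX) nX

/-- The number `bigW`. -/
def wX : QExpr := .cell 2 (.const 0)

/-- The number `bigB`. -/
def bX : QExpr := .cell 2 (.const 1)

/-- The number `bigE`. -/
def eX : QExpr := .cell 2 (.const 2)

/-- The number `bigL`. -/
def lX : QExpr := .cell 2 (.const 3)

/-- The answer of the oracle. -/
def ansX : QExpr := .cell 5 (.const 0)

/-- The scaled entries of the input. -/
def dataX (x : IExpr) : QExpr := .div (.mul (.cell 0 x) wX) (.cell 1 x)

/-- The negative of an expression. -/
def negX (e : QExpr) : QExpr := .sub (.const 0) e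

/-- The entries of the columns. -/
def colX (i k : IExpr) : QExpr :=
  iteLt i nX
    (iteLt k mX (dataX (.add (.mul k nX) i)) (iteLt k (.add mX nX) (.const 0)
      (.mul (.ofIdx (.var 5)) (dataX (.add (.add (.mul mX nX) mX) i)))))
    (iteLt i (.add nX nX)
      (iteLt k mX (negX (dataX (.add (.mul k nX) (.sub i nX))))
        (iteLt k (.add mX nX) (.const 0)
          (negX (.mul (.ofIdx (.var 5))
            (dataX (.add (.add (.mul mX nX) mX) (.sub i nX)))))))
      (iteLt i (.add (.add nX nX) mX)
        (iteEq k (.sub i (.add nX nX)) wX (.const 0))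
        (iteLt k mX (.const 0)
          (iteLt k (.add mX nX)
            (dataX (.add (.mul (.sub i (.add (.add nX nX) mX)) nX) (.sub k mX)))
            (negX (dataX (.add (.mul mX nX) (.sub i (.add (.add nX nX) mX)))))))))

/-- The entries of the right hand side. -/
def rhsX (k : IExpr) : QExpr :=
  iteLt k mX (dataX (.add (.mul mX nX) k))
    (iteLt k (.add mX nX)
      (.mul (.ofIdx (.var 5)) (dataX (.add (.add (.mul mX nX) mX) (.sub k mX)))) (.const 0))

/-- The additional coordinates of the vectors. -/
def liftX (i : IExpr) : QExpr :=
  .sub (.const 1)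
    (.mul (.ofIdx (.var 7)) (.mul (.cell 3 i) (iteEq i (.var 2) (.const 0) (.const 1))))

/-- The entries of the query. -/
def queryX (i k : IExpr) : QExpr :=
  iteLt k rowsX
    (.sub (iteLt i colsX (.mul (.mul (.mul lX eX) (.cell 3 i)) (colX i k)) (.const 0))
      (.mul eX (rhsX k)))
    (.sub (iteEq i (.sub k rowsX) (.mul lX (liftX i)) (.const 0))
      (iteEq (.sub k rowsX) (.var 2) (.ofIdx (.var 6)) (.const 0)))

/-- The store contains the size parameters, the data, and the constants of the algorithm. -/
structure Setup (I : LPInst) (s : State) : Prop where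
  hm : s.idx 0 = I.m
  hn : s.idx 1 = I.n
  data : ∀ j, s.mem 0 j * I.bigW / s.mem 1 j = I.scaled j
  hW : s.mem 2 0 = I.bigW
  hE : s.mem 2 2 = I.bigE
  hL : s.mem 2 3 = I.bigL

theorem Setup.agree {I : LPInst} {s s' : State} {V A : List ℕ} (h : Setup I s)
    (hs : Agree V A s s') (hV : ∀ v ∈ V, 1 < v) (hA : ∀ a ∈ A, 2 < a) : Setup I s' := by
  have hV' : ∀ v, v ≤ 1 → s'.idx v = s.idx v := fun v hv =>
    hs.idx v fun hv' => absurd (hV v hv') (by omega)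
  have hA' : ∀ a, a ≤ 2 → s'.mem a = s.mem a := fun a ha =>
    hs.mem a fun ha' => absurd (hA a ha') (by omega)
  exact ⟨by rw [hV' 0 (by omega), h.hm], by rw [hV' 1 le_rfl, h.hn],
    fun j => by rw [hA' 0 (by omega), hA' 1 (by omega), h.data], by rw [hA' 2 le_rfl, h.hW],
    by rw [hA' 2 le_rfl, h.hE], by rw [hA' 2 le_rfl, h.hL]⟩

/-! ### Values of the program's expressions -/

section Eval

variable {I : LPInst} {s : State}

theorem colsX_eval (hm : s.idx 0 = I.m) (hn : s.idx 1 = I.n) : colsX.eval s = I.N := by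
  simp [colsX, IExpr.eval, hm, hn, LPInst.N]

theorem rowsX_eval (hm : s.idx 0 = I.m) (hn : s.idx 1 = I.n) : rowsX.eval s = I.r := by
  simp [rowsX, IExpr.eval, hm, hn, LPInst.r]

theorem dimX_eval (hm : s.idx 0 = I.m) (hn : s.idx 1 = I.n) : dimX.eval s = I.dim := by
  simp [dimX, IExpr.eval, hm, hn, LPInst.dim]

theorem dataX_eval (h : Setup I s) (x : IExpr) : (dataX x).eval s = I.scaled (x.eval s) := by
  simp only [dataX, wX, QExpr.eval, IExpr.eval, h.hW, h.data]

theorem negX_eval (e : QExpr) : (negX e).eval s = -e.eval s := by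
  simp [negX, QExpr.eval]

theorem wX_eval (h : Setup I s) : wX.eval s = I.bigW := h.hW

theorem eX_eval (h : Setup I s) : eX.eval s = I.bigE := h.hE

theorem lX_eval (h : Setup I s) : lX.eval s = I.bigL := h.hL

theorem colX_eval (h : Setup I s) (i k : IExpr) : (colX i k).eval s =
    col I.m I.n (fun j => (I.scaled j : ℚ)) I.bigW (s.idx 5) (i.eval s) (k.eval s) := by
  simp only [colX, col, iteLt_eval, iteEq_eval, dataX_eval h, negX_eval, wX_eval h, QExpr.eval,
    IExpr.eval, h.hm, h.hn]

theorem rhsX_eval (h : Setup I s) (k : IExpr) : (rhsX k).eval s =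
    rhs I.m I.n (fun j => (I.scaled j : ℚ)) (s.idx 5) (k.eval s) := by
  simp only [rhsX, rhs, iteLt_eval, dataX_eval h, QExpr.eval, IExpr.eval, h.hm, h.hn]

theorem liftX_eval (i : IExpr) : (liftX i).eval s =
    1 - s.idx 7 * (s.mem 3 (i.eval s) * if i.eval s = s.idx 2 then 0 else 1) := by
  simp only [liftX, iteEq_eval, QExpr.eval, IExpr.eval]
  rfl

theorem queryX_eval (h : Setup I s) (i k : IExpr) : (queryX i k).eval s =
    queryEntry I (s.idx 5) (s.mem 3)
      (fun i => 1 - s.idx 7 * (s.mem 3 i * if i = s.idx 2 then 0 else 1))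
      (s.idx 2) (s.idx 6) (i.eval s) (k.eval s) := by
  simp only [queryX, queryEntry, iteLt_eval, iteEq_eval, colX_eval h, rhsX_eval h, liftX_eval,
    eX_eval h, lX_eval h, QExpr.eval, IExpr.eval, rowsX_eval h.hm h.hn, colsX_eval h.hm h.hn]

end Eval

/-! ### Queries -/

/-- Writing and sending a query. -/
def queryProg : Program :=
  .seq
    (forLoop 3 (.add colsX (.const 1)) (forLoop 4 (.add rowsX colsX)
      (.setCell 4 (.add (.mul (.var 3) (.add rowsX colsX)) (.var 4)) (queryX (.var 3) (.var 4)))))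
    (.call [.add rowsX colsX, .add colsX (.const 1)] 4
      (.mul (.add colsX (.const 1)) (.add rowsX colsX)) 5)

/-- The array `3` contains the indicator of `S`. -/
def IsAct (I : LPInst) (s : State) (S : Finset (Fin I.N)) : Prop :=
  ∀ i : Fin I.N, s.mem 3 i = if i ∈ S then 1 else 0

/-- The additional coordinates of the vectors in a query. -/
def LPInst.lift (I : LPInst) (φ j : ℕ) (S : Finset (Fin I.N)) : Fin I.N → ℤ :=
  fun i => if φ = 1 ∧ i ∈ S ∧ (i : ℕ) ≠ j then 0 else 1

/-- In test mode (φ ≠ 1) every vector has an extra coordinate, so nothing is required of S. In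
extraction mode some are switched off, and the columns in S must be independent. -/
theorem LPInst.famIndep_qV (I : LPInst) (σ j : ℕ) {φ : ℕ} {S : Finset (Fin I.N)}
    (h : φ = 1 → FamIndep (I.qcols σ) S) :
    FamIndep (I.qV σ S (I.lift φ j S)) Finset.univ := by
  refine famIndep_qvec (by exact_mod_cast (Nat.pos_iff_ne_zero.mp I.bigE_pos)) (fun i hi => ?_) ?_
  · simp [LPInst.lift, hi]
  · by_cases hφ : φ = 1
    · exact (h hφ).mono (Finset.filter_subset _ _)
    · intro g hg _ i
      refine hg i ?_
      simp [LPInst.lift, hφ]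

theorem LPInst.N_succ_le_idxBound (I : LPInst) : I.N + 1 ≤ idxBound I.dim := by
  have := I.N_le; unfold idxBound; omega

theorem LPInst.rN_le_idxBound (I : LPInst) : I.r + I.N ≤ idxBound I.dim := by
  have := I.N_le; have := I.r_le; unfold idxBound; omega

theorem LPInst.dim_le_idxBound (I : LPInst) : I.dim ≤ idxBound I.dim := by
  unfold idxBound; omega

/-- Index variables 5, 2, 6 and 7 hold σ, the distinguished column j, the position y and the mode φ.
The time bound is chosen before oracle and instance, so it is uniform. -/
theorem run_queryProg : ∃ T : ℕ → ℕ, IsPoly T ∧ ∀ (O : Oracle), O.Solves DVS →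
    ∀ (I : LPInst) (K : ℕ), idxBound I.dim ≤ K → ∀ (s : State) (S : Finset (Fin I.N)),
    Setup I s → IsAct I s S → s.idx 5 ≤ 1 → s.idx 6 ≤ 2 → s.idx 7 ≤ 1 →
    (s.idx 7 = 1 → FamIndep (I.qcols (s.idx 5)) S) →
    Runs O K I.bigS queryProg s (T I.dim) fun s' => Agree [3, 4] [4, 5] s s' ∧
      ratSize (s'.mem 5 0) ≤ I.bigS ∧
      ∃ l, IsNNLS (I.qV (s.idx 5) S (I.lift (s.idx 7) (s.idx 2) S))
          (I.qT (s.idx 5) (s.idx 2) (s.idx 6)) l ∧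
        s'.mem 5 0 = resid (I.qV (s.idx 5) S (I.lift (s.idx 7) (s.idx 2) S))
            (I.qT (s.idx 5) (s.idx 2) (s.idx 6)) l ⬝ᵥ
          resid (I.qV (s.idx 5) S (I.lift (s.idx 7) (s.idx 2) S))
            (I.qT (s.idx 5) (s.idx 2) (s.idx 6)) l := by
  refine ⟨fun d => 2 + (idxBound d + 1) * ((IExpr.add colsX (.const 1)).cost + 6 +
    (2 + (idxBound d + 1) * ((IExpr.add rowsX colsX).cost + 6 + ((IExpr.add rowsX colsX).cost +
      (queryX (.var 3) (.var 4)).cost + 5)))) +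
    (((List.map IExpr.cost [.add rowsX colsX, .add colsX (.const 1)]).sum +
      (IExpr.mul (.add colsX (.const 1)) (.add rowsX colsX)).cost + 2) +
      idxBound d * idxBound d), ?_, ?_⟩
  · have hD := isPoly_idxBound
    exact (((IsPoly.const 2).add ((hD.add (.const 1)).mul ((IsPoly.const _).add
      ((IsPoly.const 2).add ((hD.add (.const 1)).mul (.const _))))))).add
      ((IsPoly.const _).add (hD.mul hD))
  intro O hO I K hK s S hs hact hσ hy hφ hind
  have hlift : ∀ i, |I.lift (s.idx 7) (s.idx 2) S i| ≤ 1 := fun i => by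
    unfold LPInst.lift; split_ifs <;> simp
  obtain ⟨l, hl, hans, hsize⟩ := I.query_answer hO hσ S hlift (s.idx 2) hy
    (I.famIndep_qV (s.idx 5) (s.idx 2) hind)
  have hentry := conePts_eq_queryEntry I (s.idx 5) S (I.lift (s.idx 7) (s.idx 2) S) (s.idx 2)
    (s.idx 6) (act := s.mem 3)
    (t' := fun i => 1 - s.idx 7 * (s.mem 3 i * if i = s.idx 2 then 0 else 1)) hact (fun i => by
      have h01 : s.idx 7 = 0 ∨ s.idx 7 = 1 := by omega
      rw [hact i, LPInst.lift]
      rcases h01 with h | h <;> by_cases hi : i ∈ S <;> by_cases hij : (i : ℕ) = s.idx 2 <;>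
        simp [h, hi, hij])
  refine Runs.seq (Runs.fillTable (n₁ := I.N + 1) (n₂ := I.r + I.N)
    (F := queryEntry I (s.idx 5) (s.mem 3)
      (fun i => 1 - s.idx 7 * (s.mem 3 i * if i = s.idx 2 then 0 else 1)) (s.idx 2) (s.idx 6))
    (by norm_num) I.N_succ_le_idxBound I.rN_le_idxBound hK ?_ ?_ ?_) ?_
  · intro s' hs'
    have h := hs.agree hs' (by simp) (by simp)
    exact ⟨by simp [IExpr.eval, colsX_eval h.hm h.hn],
      by simp [IExpr.eval, colsX_eval h.hm h.hn, rowsX_eval h.hm h.hn]⟩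
  · intro s' hs' _ _
    have h := hs.agree hs' (by simp) (by simp)
    rw [queryX_eval h, hs'.idx 5 (by simp), hs'.idx 7 (by simp), hs'.idx 2 (by simp),
      hs'.idx 6 (by simp), hs'.mem 3 (by simp)]
    rfl
  · intro i k hi hk
    rw [← hentry ⟨i, hi⟩ ⟨k, hk⟩]
    exact I.ratSize_conePts_le hσ S hlift _ hy _ _
  · rintro s' ⟨hs', hmem⟩
    have h := hs.agree hs' (by simp) (by simp)
    have hq : s'.query [.add rowsX colsX, .add colsX (.const 1)] 4
        (.mul (.add colsX (.const 1)) (.add rowsX colsX)) =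
        ⟨[I.r + I.N, I.N + 1], rowMajor (conePts (I.qV (s.idx 5) S
          (I.lift (s.idx 7) (s.idx 2) S)) (I.qT (s.idx 5) (s.idx 2) (s.idx 6)) I.bigL)⟩ := by
      simp only [State.query, List.map_cons, List.map_nil, IExpr.eval, colsX_eval h.hm h.hn,
        rowsX_eval h.hm h.hn, Datum.mk.injEq, true_and]
      refine (rowMajor_eq_map_range _ _ fun i k => ?_).symm
      rw [hmem i k i.2 k.2, hentry]
    have hlen : (IExpr.mul (.add colsX (.const 1)) (.add rowsX colsX)).eval s' ≤
        idxBound I.dim * idxBound I.dim := by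
      simp only [IExpr.eval, colsX_eval h.hm h.hn, rowsX_eval h.hm h.hn]
      exact Nat.mul_le_mul I.N_succ_le_idxBound I.rN_le_idxBound
    refine ⟨_, _, Exec.call _ _ _ _ _ ?_, ?_, ?_, ?_⟩
    · rw [hq, hans]; simpa using hsize
    · rw [hq, hans]
      -- The answer has one entry; with the unit charge for the call this is the 2 in the time
      -- bound.
      simp only [List.length_singleton]
      omega
    · rw [hq, hans]
      exact (hs'.weaken (by simp) (by simp)).setList (by simp) _
    · rw [hq, hans]
      have h0 : ∀ x : ℚ, (s'.setList 5 [x]).mem 5 0 = x := fun x => by simp [State.setList]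
      rw [h0]
      exact ⟨hsize, l, hl, rfl⟩

/-! ### The constants of the algorithm -/

/-- The factors of `bigW`. -/
def wFactorX : QExpr :=
  .mul (.cell 1 (.var 2)) (.add (.mul (.cell 0 (.var 2)) (.cell 0 (.var 2))) (.const 1))

/-- The factors of `bigB`. -/
def bFactorX : QExpr :=
  .mul (.ofIdx colsX) (.mul (.ofIdx rowsX) (.mul (.mul wX wX) (.mul wX wX)))

/-- The number `bigM`. -/
def mBoundX : QExpr := .mul (.mul (.const 2) eX) (.mul wX wX)

/-- The factors of `bigC`. -/
def cFactorX : QExpr :=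
  .mul (.ofIdx colsX) (.mul (.ofIdx (.add rowsX colsX)) (.mul mBoundX mBoundX))

/-- Computing the constants of the algorithm. -/
def setupProg : Program :=
  .seq (productProg 2 0 2 dimX (.const 1) wFactorX)
    (.seq (productProg 2 1 2 colsX (.const 1) bFactorX)
      (.seq (.setCell 2 (.const 2) (.mul (.ofIdx (.add colsX (.const 1))) (.mul bX bX)))
        (productProg 2 3 2 colsX (.ofIdx (.add colsX (.const 1))) cFactorX)))

/-- The store contains the input. -/
structure HasInput (I : LPInst) (s : State) : Prop where
  hm : s.idx 0 = I.m
  hn : s.idx 1 = I.n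
  num : ∀ j, s.mem 0 j = (I.entry j).num
  den : ∀ j, s.mem 1 j = if j < I.dim then ((I.entry j).den : ℚ) else 0

theorem HasInput.agree {I : LPInst} {s s' : State} (h : HasInput I s) (hs : Agree [2] [2] s s') :
    HasInput I s' :=
  ⟨by rw [hs.idx 0 (by simp), h.hm], by rw [hs.idx 1 (by simp), h.hn],
    fun j => by rw [hs.mem 0 (by simp), h.num], fun j => by rw [hs.mem 1 (by simp), h.den]⟩

theorem hasInput_init (I : LPInst) : HasInput I (State.init (LP.encInst I)) where
  hm := rfl
  hn := rfl
  num _ := rfl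
  den j := by
    have h : (LP.encInst I).nums.length = I.dim := I.length_nums
    simp only [State.init, h]
    simp [LPInst.entry]

/-- Beyond the input the machine divides 0 by the default denominator 0 and gets 0, in agreement
with the zero entries there. -/
theorem HasInput.data {I : LPInst} {s : State} (h : HasInput I s) (j : ℕ) :
    s.mem 0 j * I.bigW / s.mem 1 j = I.scaled j := by
  rw [h.num, h.den, I.scaled_eq]
  split_ifs with hj
  · rfl
  · simp [I.entry_ge (not_lt.mp hj)]

theorem LPInst.ratSize_small (I : LPInst) {z e : ℕ} (hz : z ≤ 2 ^ e) (he : e ≤ 110 * I.u ^ 3) :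
    ratSize (z : ℚ) ≤ I.bigS :=
  I.ratSize_nat_le (hz.trans (Nat.pow_le_pow_right (by norm_num) he))

/-- The powers are formed by N successive multiplications. The factors are positive integers
whenever they occur, so the final values bound all partial products. -/
theorem run_setupProg : ∃ T : ℕ → ℕ, IsPoly T ∧ ∀ (O : Oracle) (I : LPInst) (K : ℕ),
    idxBound I.dim ≤ K → ∀ s : State, HasInput I s →
    Runs O K I.bigS setupProg s (T I.dim) (Setup I) := by
  refine ⟨fun d => (((QExpr.const 1).cost + 2) +
      (2 + (idxBound d + 1) * (dimX.cost + 6 + (wFactorX.cost + 5)))) +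
    ((((QExpr.const 1).cost + 2) +
      (2 + (idxBound d + 1) * (colsX.cost + 6 + (bFactorX.cost + 5)))) +
    (((IExpr.const 2).cost + (QExpr.mul (.ofIdx (.add colsX (.const 1))) (.mul bX bX)).cost + 1) +
    (((QExpr.ofIdx (.add colsX (.const 1))).cost + 2) +
      (2 + (idxBound d + 1) * (colsX.cost + 6 + (cFactorX.cost + 5)))))), ?_, ?_⟩
  · have hp : ∀ a b : ℕ, IsPoly fun d => a + (2 + (idxBound d + 1) * b) := fun a b =>
      (IsPoly.const a).add ((IsPoly.const 2).add ((isPoly_idxBound.add (.const 1)).mul (.const b)))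
    exact (hp _ _).add ((hp _ _).add ((IsPoly.const _).add (hp _ _)))
  intro O I K hK s hs
  have hu := I.u_pos
  have hu1 := I.u_le_sq
  have hu2 := I.sq_le_cube
  have hN : I.N ≤ idxBound I.dim := (Nat.le_succ _).trans I.N_succ_le_idxBound
  refine Runs.seq (Runs.productProg (n := I.dim) (x := 1)
    (F := fun j => (((I.entry j).den * ((I.entry j).num.natAbs ^ 2 + 1) : ℕ) : ℚ))
    I.dim_le_idxBound hK rfl ?_ ?_ ?_) ?_
  · intro s' h1 _
    exact dimX_eval (hs.agree h1).hm (hs.agree h1).hn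
  · intro s' h1 _ h2
    have h := hs.agree h1
    simp only [wFactorX, QExpr.eval, IExpr.eval, h.num, h.den, if_pos h2]
    push_cast
    rw [Nat.cast_natAbs, Int.cast_abs, sq_abs, sq]
  · intro k hk
    rw [one_mul, ← Nat.cast_prod]
    refine I.ratSize_small (e := 2 * I.u) (le_trans ?_ I.bigW_le) (by omega)
    refine Finset.prod_le_prod_of_subset_of_one_le' (Finset.range_mono hk) fun j _ _ => ?_
    exact Nat.mul_pos (I.entry j).den_pos (by positivity)
  rintro s₁ ⟨h1, -, hW⟩
  rw [one_mul, ← Nat.cast_prod] at hW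
  have hW1 : s₁.mem 2 0 = I.bigW := hW
  have hs1 := hs.agree h1
  have hpow : ∀ {y k : ℕ}, k ≤ I.N → (I.N = 0 ∨ 1 ≤ y) → y ^ k ≤ y ^ I.N := by
    intro y k hk hy
    rcases hy with h | h
    · rw [h] at hk ⊢
      rw [Nat.le_zero.mp hk]
    · exact Nat.pow_le_pow_right h hk
  refine Runs.seq (Runs.productProg (n := I.N) (x := 1)
    (F := fun _ => ((I.N * (I.r * I.bigW ^ 4) : ℕ) : ℚ)) hN hK rfl ?_ ?_ ?_) ?_
  · intro s' h2 _
    exact colsX_eval (hs1.agree h2).hm (hs1.agree h2).hn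
  · intro s' h2 h3 _
    have h := hs1.agree h2
    have h4 : s'.mem 2 0 = I.bigW := by rw [h3 0 (by norm_num), hW1]
    simp only [bFactorX, QExpr.eval, colsX_eval h.hm h.hn, rowsX_eval h.hm h.hn, wX, IExpr.eval, h4]
    push_cast
    ring
  · intro k hk
    rw [one_mul, ← Nat.cast_prod, Finset.prod_const, Finset.card_range]
    refine I.ratSize_small (e := 10 * I.u ^ 2) (le_trans (hpow hk ?_) I.bigB_le) (by omega)
    rcases Nat.eq_zero_or_pos I.N with h | h
    · exact .inl h
    · exact .inr (Nat.mul_pos h (Nat.mul_pos (by simp [LPInst.r]) (pow_pos I.bigW_pos 4)))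
  rintro s₂ ⟨h2, h3, hB⟩
  rw [one_mul, ← Nat.cast_prod, Finset.prod_const, Finset.card_range] at hB
  have hB2 : s₂.mem 2 1 = I.bigB := hB
  have hW2 : s₂.mem 2 0 = I.bigW := by rw [h3 0 (by norm_num), hW1]
  have hs2 := hs1.agree h2
  have hE : (QExpr.mul (.ofIdx (.add colsX (.const 1))) (.mul bX bX)).eval s₂ = I.bigE := by
    simp only [bX, QExpr.eval, IExpr.eval, colsX_eval hs2.hm hs2.hn, hB2, LPInst.bigE]
    push_cast
    ring
  refine Runs.seq (P := fun s' => HasInput I s' ∧ s'.mem 2 0 = I.bigW ∧ s'.mem 2 2 = I.bigE)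
    (Runs.setCell ?_ ?_) ?_
  · rw [hE]
    exact I.ratSize_small I.bigE_le (by omega)
  · rw [hE]
    exact ⟨hs2.agree ((Agree.refl _ _ _).setCell (by simp) _ _),
      (setCell_mem_ne _ _ (by simp [IExpr.eval]) _).trans hW2, setCell_mem_self _ _ _ _⟩
  rintro s₃ ⟨hs3, hW3, hE3⟩
  refine Runs.mono (Runs.productProg (n := I.N) (x := ((I.N + 1 : ℕ) : ℚ))
    (F := fun _ => ((I.N * I.bigX : ℕ) : ℚ)) hN hK ?_ ?_ ?_ ?_) le_rfl ?_
  · simp [QExpr.eval, IExpr.eval, colsX_eval hs3.hm hs3.hn]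
  · intro s' h2 _
    exact colsX_eval (hs3.agree h2).hm (hs3.agree h2).hn
  · intro s' h2 h3 _
    have h := hs3.agree h2
    have h4 : s'.mem 2 0 = I.bigW := by rw [h3 0 (by norm_num), hW3]
    have h5 : s'.mem 2 2 = I.bigE := by rw [h3 2 (by norm_num), hE3]
    simp only [cFactorX, mBoundX, QExpr.eval, colsX_eval h.hm h.hn, rowsX_eval h.hm h.hn, wX, eX,
      IExpr.eval, h4, h5, LPInst.bigX]
    push_cast
    ring
  · intro k hk
    rw [← Nat.cast_prod, Finset.prod_const, Finset.card_range, ← Nat.cast_mul]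
    refine I.ratSize_small (e := 56 * I.u ^ 3)
      (le_trans (Nat.mul_le_mul_left _ (hpow hk ?_)) I.bigL_le) (by omega)
    rcases Nat.eq_zero_or_pos I.N with h | h
    · exact .inl h
    · exact .inr (Nat.mul_pos h I.bigX_pos)
  · rintro s₄ ⟨h4, h5, hL⟩
    rw [← Nat.cast_prod, Finset.prod_const, Finset.card_range, ← Nat.cast_mul] at hL
    have hs4 := hs3.agree h4
    exact ⟨hs4.hm, hs4.hn, hs4.data, by rw [h5 0 (by norm_num), hW3],
      by rw [h5 2 (by norm_num), hE3], hL⟩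

/-! ### Feasibility tests -/

theorem LPInst.lift_zero (I : LPInst) (j : ℕ) (S : Finset (Fin I.N)) :
    I.lift 0 j S = fun _ => 1 := by
  funext i; simp [LPInst.lift]

/-- The system with the columns in `S` is solvable. -/
def LPInst.Solvable (I : LPInst) (σ : ℕ) (S : Finset (Fin I.N)) : Prop :=
  ConeMem (I.qcols σ) (I.qrhs σ) S

theorem LPInst.solvable_iff (I : LPInst) {σ : ℕ} (hσ : σ ≤ 1) (j : ℕ) (S : Finset (Fin I.N))
    {l : Fin I.N → ℚ} (hl : IsNNLS (I.qV σ S fun _ => 1) (I.qT σ j 0) l) :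
    I.Solvable σ S ↔ resid (I.qV σ S fun _ => 1) (I.qT σ j 0) l ⬝ᵥ
      resid (I.qV σ S fun _ => 1) (I.qT σ j 0) l < I.bigE := by
  have hV : I.qV σ S (fun _ => 1) = qvec (I.bigE : ℚ) (I.qcols σ) S (fun _ => 1) := by
    simp [LPInst.qV]
  have hT : I.qT σ j 0 = qtgt (I.bigE : ℚ) (I.qrhs σ) j 0 := by simp [LPInst.qT]
  rw [hV, hT] at hl ⊢
  exact coneMem_iff_lt (I.gramBound_z hσ) rfl S j hl

/-- The test whether the answer is less than `bigE`. -/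
def testX : Test := .qlt ansX eX

/-- The state before a feasibility test with `σ`. -/
structure Ready (I : LPInst) (σ : ℕ) (S : Finset (Fin I.N)) (s : State) : Prop
    extends Setup I s where
  act : IsAct I s S
  hσ : s.idx 5 = σ
  hy : s.idx 6 = 0
  hφ : s.idx 7 = 0

theorem Ready.agree {I : LPInst} {σ : ℕ} {S : Finset (Fin I.N)} {s s' : State} {V A : List ℕ}
    (h : Ready I σ S s) (hs : Agree V A s s')
    (hV : ∀ v ∈ V, 1 < v ∧ v ≠ 5 ∧ v ≠ 6 ∧ v ≠ 7) (hA : ∀ a ∈ A, 3 < a) : Ready I σ S s' where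
  toSetup := h.toSetup.agree hs (fun v hv => (hV v hv).1)
    fun a ha => lt_trans (by norm_num) (hA a ha)
  act := fun i => by rw [hs.mem 3 fun h => lt_irrefl _ (hA 3 h)]; exact h.act i
  hσ := by rw [hs.idx 5 fun h => (hV 5 h).2.1 rfl, h.hσ]
  hy := by rw [hs.idx 6 fun h => (hV 6 h).2.2.1 rfl, h.hy]
  hφ := by rw [hs.idx 7 fun h => (hV 7 h).2.2.2 rfl, h.hφ]

theorem run_test : ∃ T : ℕ → ℕ, IsPoly T ∧ ∀ (O : Oracle), O.Solves DVS →
    ∀ (I : LPInst) (K : ℕ), idxBound I.dim ≤ K → ∀ (s : State) (S : Finset (Fin I.N)) (σ : ℕ),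
    σ ≤ 1 → Ready I σ S s →
    Runs O K I.bigS queryProg s (T I.dim) fun s' => Agree [3, 4] [4, 5] s s' ∧ Ready I σ S s' ∧
      (testX.Holds s' ↔ I.Solvable σ S) := by
  obtain ⟨T, hT, hrun⟩ := run_queryProg
  refine ⟨T, hT, fun O hO I K hK s S σ hσ hs => ?_⟩
  refine Runs.mono (hrun O hO I K hK s S hs.toSetup hs.act (by rw [hs.hσ]; exact hσ)
    (by rw [hs.hy]; norm_num) (by rw [hs.hφ]; norm_num) (by rw [hs.hφ]; simp)) le_rfl ?_
  rintro s' ⟨hs', -, l, hl, hval⟩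
  have hr := hs.agree hs' (by simp) (by simp)
  refine ⟨hs', hr, ?_⟩
  rw [hs.hσ, hs.hy, hs.hφ, I.lift_zero] at hl hval
  rw [I.solvable_iff hσ _ S hl, ← hval]
  simp only [testX, ansX, Test.Holds, eX_eval hr.toSetup, QExpr.eval, IExpr.eval]

/-! ### Removing columns -/

/-- Removing columns while the system is solvable. -/
def greedyProg : Program :=
  forLoop 2 colsX (.seq (.setCell 3 (.var 2) (.const 0))
    (.seq queryProg (.branch testX .skip (.setCell 3 (.var 2) (.const 1)))))

theorem isAct_erase {I : LPInst} {s : State} {S : Finset (Fin I.N)} (h : IsAct I s S)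
    (j : Fin I.N) : IsAct I (s.setCell 3 j 0) (S.erase j) := by
  intro i
  by_cases hij : i = j
  · subst hij
    rw [setCell_mem_self]; simp
  · rw [setCell_mem_ne _ _ (fun h => hij (Fin.ext h)), h i]
    simp [hij]

theorem isAct_insert {I : LPInst} {s : State} {S : Finset (Fin I.N)} (h : IsAct I s S)
    (j : Fin I.N) : IsAct I (s.setCell 3 j 1) (insert j S) := by
  intro i
  by_cases hij : i = j
  · subst hij
    rw [setCell_mem_self]; simp
  · rw [setCell_mem_ne _ _ (fun h => hij (Fin.ext h)), h i]
    simp [hij]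

theorem LPInst.ratSize_const_le (I : LPInst) {z : ℕ} (hz : z ≤ 2) : ratSize (z : ℚ) ≤ I.bigS :=
  I.ratSize_small (e := 1) (by simpa using hz) (by
    have : 1 ≤ I.u ^ 3 := Nat.one_le_pow _ _ I.u_pos
    omega)

theorem Ready.setup_setCell {I : LPInst} {σ : ℕ} {S : Finset (Fin I.N)} {s : State}
    (h : Ready I σ S s) {S' : Finset (Fin I.N)} {i : ℕ} {x : ℚ}
    (hact : IsAct I (s.setCell 3 i x) S') : Ready I σ S' (s.setCell 3 i x) where
  toSetup := h.toSetup.agree ((Agree.refl [] [3] s).setCell (by simp) i x) (by simp) (by simp)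
  act := hact
  hσ := h.hσ
  hy := h.hy
  hφ := h.hφ

/-- One pass suffices, because solvability is monotone in the set of columns: a column that was
indispensable stays so after further removals. -/
theorem run_greedyProg : ∃ T : ℕ → ℕ, IsPoly T ∧ ∀ (O : Oracle), O.Solves DVS →
    ∀ (I : LPInst) (K : ℕ), idxBound I.dim ≤ K → ∀ (s : State) (S : Finset (Fin I.N)) (σ : ℕ),
    σ ≤ 1 → Ready I σ S s → I.Solvable σ S →
    Runs O K I.bigS greedyProg s (T I.dim) fun s' => ∃ S', Ready I σ S' s' ∧ I.Solvable σ S' ∧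
      ∀ j ∈ S', ¬ I.Solvable σ (S'.erase j) := by
  obtain ⟨T, hT, hrun⟩ := run_test
  refine ⟨fun d => 2 + (idxBound d + 1) * (colsX.cost + 6 + (((IExpr.var 2).cost +
    (QExpr.const 0).cost + 1) + (T d + (testX.cost + ((IExpr.var 2).cost +
    (QExpr.const 1).cost + 1))))), ?_, fun O hO I K hK s S σ hσ hs hsol => ?_⟩
  · exact (IsPoly.const 2).add ((isPoly_idxBound.add (.const 1)).mul ((IsPoly.const _).add
      ((IsPoly.const _).add (hT.add (.const _)))))
  refine Runs.mono (Runs.forLoop (n := I.N) (fun k s' => s'.idx 2 = k ∧ ∃ S', Ready I σ S' s' ∧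
    I.Solvable σ S' ∧ ∀ j ∈ S', (j : ℕ) < k → ¬ I.Solvable σ (S'.erase j))
    ((Nat.le_succ _).trans I.N_succ_le_idxBound) hK ?_ ?_ ?_) le_rfl ?_
  · exact ⟨setIdx_idx_self _ _ _, S, hs.agree ((Agree.refl [2] [] s).setIdx (by simp) 0) (by simp)
      (by simp), hsol, fun j _ h => by omega⟩
  · rintro k s' ⟨h1, S', h2, -⟩
    exact ⟨h1, colsX_eval h2.hm h2.hn⟩
  · rintro k hk s' ⟨h1, S', h2, h3, h4⟩
    set j : Fin I.N := ⟨k, hk⟩ with hj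
    have hnext : ∀ (x : State) (S'' : Finset (Fin I.N)), Ready I σ S'' x →
        Ready I σ S'' (x.setIdx 2 (k + 1)) := fun x S'' h =>
      h.agree ((Agree.refl [2] [] x).setIdx (by simp) (k + 1)) (by simp) (by simp)
    refine Runs.seq (P := fun x => x.idx 2 = k ∧ Ready I σ (S'.erase j) x)
      (Runs.setCell ?_ ?_) ?_
    · exact_mod_cast I.ratSize_const_le (z := 0) (by norm_num)
    · have h5 : (IExpr.var 2).eval s' = (j : ℕ) := h1
      rw [h5]
      exact ⟨h1, h2.setup_setCell (isAct_erase h2.act j)⟩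
    rintro s₁ ⟨h5, h6⟩
    refine Runs.seq (hrun O hO I K hK s₁ _ σ hσ h6) ?_
    rintro s₂ ⟨h7, h8, h9⟩
    have h10 : s₂.idx 2 = k := by rw [h7.idx 2 (by simp), h5]
    refine Runs.branch (fun ht => ?_) fun ht => ?_
    · refine Runs.mono (Runs.skip ?_) (by simp [IExpr.cost, QExpr.cost]) fun _ h => h
      refine ⟨h10, setIdx_idx_self _ _ _, S'.erase j, hnext _ _ h8, h9.mp ht, fun i hi hik h => ?_⟩
      have hij : i ≠ j := Finset.ne_of_mem_erase hi
      have hlt : (i : ℕ) < k := by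
        rcases Nat.lt_succ_iff_lt_or_eq.mp hik with h | h
        · exact h
        · exact absurd (Fin.ext h) hij
      refine h4 i (Finset.mem_of_mem_erase hi) hlt (ConeMem.mono h ?_)
      exact Finset.erase_subset_erase _ (Finset.erase_subset _ _)
    · refine Runs.setCell ?_ ?_
      · exact_mod_cast I.ratSize_const_le (z := 1) (by norm_num)
      have h11 : (IExpr.var 2).eval s₂ = (j : ℕ) := h10
      rw [h11]
      refine ⟨h10, setIdx_idx_self _ _ _, insert j (S'.erase j),
        hnext _ _ (h8.setup_setCell (isAct_insert h8.act j)), ConeMem.mono h3 fun i hi => ?_,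
        fun i hi hik h => ?_⟩
      · by_cases hij : i = j
        · simp [hij]
        · simp [hij, hi]
      · by_cases hij : i = j
        · subst hij
          refine ht (h9.mpr (ConeMem.mono h fun i hi => ?_))
          rw [Finset.mem_erase, Finset.mem_insert] at hi
          exact hi.2.resolve_left hi.1
        · have hlt : (i : ℕ) < k := by
            rcases Nat.lt_succ_iff_lt_or_eq.mp hik with h | h
            · exact h
            · exact absurd (Fin.ext h) hij
          have hi' : i ∈ S' := by
            rw [Finset.mem_insert, Finset.mem_erase] at hi
            exact (hi.resolve_left hij).2
          refine h4 i hi' hlt (ConeMem.mono h fun x hx => ?_)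
          rw [Finset.mem_erase, Finset.mem_insert, Finset.mem_erase] at hx
          rw [Finset.mem_erase]
          refine ⟨hx.1, ?_⟩
          rcases hx.2 with h | h
          · subst h
            -- If column j was already absent, erasing it changed nothing and the test would have
            -- succeeded; so restoring it never enlarges the set.
            by_contra hxS
            have hSe : S'.erase j = S' := Finset.erase_eq_of_notMem hxS
            exact ht (h9.mpr (by rw [hSe]; exact h3))
          · exact h.2
  · rintro s' ⟨-, S', h1, h2, h3⟩
    exact ⟨S', h1, h2, fun j hj => h3 j hj j.2⟩

/-! ### Computing the solution -/

/-- The first stored answer of the oracle. -/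
def ans0X : QExpr := .cell 6 (.const 0)

/-- The second stored answer of the oracle. -/
def ans1X : QExpr := .cell 6 (.const 1)

/-- The coefficient determined by three distances. -/
def coeffX : QExpr :=
  .mul (.cell 3 (.var 2))
    (.add (.div (.sub ans0X ans1X) (.add (.sub ans0X (.mul (.const 2) ans1X)) ansX))
      (.const (1 / 2)))

/-- Computing the solution of a system with independent columns. -/
def extractProg : Program :=
  forLoop 2 colsX
    (.seq (.seq (.setIdx 6 (.const 0)) queryProg) (.seq (.setCell 6 (.const 0) ansX)
      (.seq (.seq (.setIdx 6 (.const 1)) queryProg) (.seq (.setCell 6 (.const 1) ansX)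
        (.seq (.seq (.setIdx 6 (.const 2)) queryProg) (.setCell 7 (.var 2) coeffX))))))

/-- The unique solution `l` of the system with the columns in `S`. -/
structure IsSolution (I : LPInst) (σ : ℕ) (S : Finset (Fin I.N)) (l : Fin I.N → ℚ) : Prop where
  indep : FamIndep (I.qcols σ) S
  nonneg : ∀ i, 0 ≤ l i
  off : ∀ i, i ∉ S → l i = 0
  pos : ∀ i ∈ S, 0 < l i
  sum_eq : ∑ i, l i • I.qcols σ i = I.qrhs σ
  small : ∃ (Q : ℤ) (z : Fin I.N → ℤ), 1 ≤ Q ∧ Q ≤ I.bigB ∧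
    ∀ i, (Q : ℚ) * l i = z i ∧ |z i| ≤ I.bigB

theorem LPInst.exists_isSolution (I : LPInst) {σ : ℕ} (hσ : σ ≤ 1) {S : Finset (Fin I.N)}
    (hS : I.Solvable σ S) (hmin : ∀ j ∈ S, ¬ I.Solvable σ (S.erase j)) :
    ∃ l, IsSolution I σ S l := by
  obtain ⟨h1, l, h2, h3, h4, h5, h6⟩ := exists_minimal_solution (I.gramBound_z hσ) hS hmin
  exact ⟨l, h1, h2, h3, h4, h5, h6⟩

theorem LPInst.bigB_le' (I : LPInst) {k : ℕ} (hk : k ≤ 2) :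
    k * I.bigB ≤ 2 ^ (110 * I.u ^ 3) :=
  mul_le_two_pow (s := 1) (by simpa using hk) I.bigB_le (by
    have := I.sq_le_cube
    have : 1 ≤ I.u ^ 3 := Nat.one_le_pow _ _ I.u_pos
    omega)

theorem IsSolution.ratSize_le {I : LPInst} {σ : ℕ} {S : Finset (Fin I.N)} {l : Fin I.N → ℚ}
    (h : IsSolution I σ S l) (i : Fin I.N) : ratSize (l i) ≤ I.bigS := by
  obtain ⟨Q, z, hQ, hQB, hz⟩ := h.small
  have h1 := I.bigB_le' (k := 1) (by norm_num)
  rw [one_mul] at h1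
  exact I.ratSize_le_bigS hQ (hQB.trans (by exact_mod_cast h1)) (hz i).1
    ((hz i).2.trans (by exact_mod_cast h1))

theorem IsSolution.ratSize_sub_le {I : LPInst} {σ : ℕ} {S : Finset (Fin I.N)} {l : Fin I.N → ℚ}
    (h : IsSolution I σ S l) (i j : Fin I.N) : ratSize (l i - l j) ≤ I.bigS := by
  obtain ⟨Q, z, hQ, hQB, hz⟩ := h.small
  have h1 := I.bigB_le' (k := 1) (by norm_num)
  have h2 := I.bigB_le' (k := 2) (by norm_num)
  rw [one_mul] at h1
  refine I.ratSize_le_bigS (P := z i - z j) hQ (hQB.trans (by exact_mod_cast h1)) ?_ ?_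
  · rw [mul_sub, (hz i).1, (hz j).1]; push_cast; ring
  · refine (abs_sub _ _).trans ((add_le_add (hz i).2 (hz j).2).trans ?_)
    rw [← two_mul]
    exact_mod_cast h2

/-- The state during the computation of the solution. -/
structure Extracting (I : LPInst) (σ : ℕ) (S : Finset (Fin I.N)) (l : Fin I.N → ℚ) (k : ℕ)
    (s : State) : Prop extends Setup I s where
  act : IsAct I s S
  hσ : s.idx 5 = σ
  hφ : s.idx 7 = 1
  hj : s.idx 2 = k
  sol : ∀ i : Fin I.N, (i : ℕ) < k → s.mem 7 i = l i

theorem Extracting.agree {I : LPInst} {σ k : ℕ} {S : Finset (Fin I.N)} {l : Fin I.N → ℚ}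
    {s s' : State} {V A : List ℕ} (h : Extracting I σ S l k s) (hs : Agree V A s s')
    (hV : ∀ v ∈ V, 2 < v ∧ v ≠ 5 ∧ v ≠ 7) (hA : ∀ a ∈ A, 3 < a ∧ a ≠ 7) :
    Extracting I σ S l k s' where
  toSetup := h.toSetup.agree hs (fun v hv => lt_trans (by norm_num) (hV v hv).1)
    fun a ha => lt_trans (by norm_num) (hA a ha).1
  act := fun i => by rw [hs.mem 3 fun h => lt_irrefl _ (hA 3 h).1]; exact h.act i
  hσ := by rw [hs.idx 5 fun h => (hV 5 h).2.1 rfl, h.hσ]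
  hφ := by rw [hs.idx 7 fun h => (hV 7 h).2.2 rfl, h.hφ]
  hj := by rw [hs.idx 2 fun h => lt_irrefl _ (hV 2 h).1, h.hj]
  sol := fun i hi => by rw [hs.mem 7 fun h => (hA 7 h).2 rfl]; exact h.sol i hi

/-- The value of the query for the coefficient `k` with position `y`. -/
def IsAnswer (I : LPInst) (σ : ℕ) (S : Finset (Fin I.N)) (k y : ℕ) (q : ℚ) : Prop :=
  ∃ l', IsNNLS (I.qV σ S (I.lift 1 k S)) (I.qT σ k y) l' ∧
    q = resid (I.qV σ S (I.lift 1 k S)) (I.qT σ k y) l' ⬝ᵥ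
      resid (I.qV σ S (I.lift 1 k S)) (I.qT σ k y) l'

theorem IsSolution.answer {I : LPInst} {σ : ℕ} (hσ : σ ≤ 1) {S : Finset (Fin I.N)}
    {l : Fin I.N → ℚ} (h : IsSolution I σ S l) {j : Fin I.N} (hj : j ∈ S) :
    ∃ c : ℚ, c ≠ 0 ∧ ∀ y : ℕ, y ≤ 2 → ∀ q, IsAnswer I σ S j y q → q = c * (l j - y) ^ 2 := by
  obtain ⟨Q, z, hQ, hQB, hz⟩ := h.small
  obtain ⟨c, hc, hval⟩ := value_eq_mul_sq (I.gramBound_z hσ) rfl h.indep h.off h.pos h.sum_eq hQ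
    hQB hz hj
  refine ⟨c, hc, fun y hy q hq => ?_⟩
  obtain ⟨l', hl', rfl⟩ := hq
  have hV : I.qV σ S (I.lift 1 j S) = qvec (I.bigE : ℚ) (fun i k => (I.zcols σ i k : ℚ)) S
      (fun i => if i ∈ S ∧ i ≠ j then 0 else 1) := by
    unfold LPInst.qV LPInst.lift LPInst.qcols
    congr 1
    funext i
    simp [Fin.ext_iff]
  rw [hV] at hl' ⊢
  exact hval y (Nat.cast_nonneg y) (by exact_mod_cast hy) l' hl'

/-- The first difference of c(x - y)² is c(2x - 1) and the second is 2c; their quotient x - 1/2 no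
longer involves the unknown c. -/
theorem coeff_eq {c x : ℚ} (hc : c ≠ 0) :
    (c * (x - (0 : ℕ)) ^ 2 - c * (x - (1 : ℕ)) ^ 2) /
      (c * (x - (0 : ℕ)) ^ 2 - 2 * (c * (x - (1 : ℕ)) ^ 2) + c * (x - (2 : ℕ)) ^ 2) + 1 / 2 = x := by
  have h1 : c * (x - (0 : ℕ)) ^ 2 - 2 * (c * (x - (1 : ℕ)) ^ 2) + c * (x - (2 : ℕ)) ^ 2 =
      2 * c := by push_cast; ring
  rw [h1]
  push_cast
  field_simp
  ring

theorem run_position : ∃ T : ℕ → ℕ, IsPoly T ∧ ∀ (O : Oracle), O.Solves DVS →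
    ∀ (I : LPInst) (K : ℕ), idxBound I.dim ≤ K → ∀ (s : State) (S : Finset (Fin I.N)) (σ k y : ℕ)
    (l : Fin I.N → ℚ), σ ≤ 1 → y ≤ 2 → IsSolution I σ S l → Extracting I σ S l k s →
    Runs O K I.bigS (.seq (.setIdx 6 (.const y)) queryProg) s (T I.dim) fun s' =>
      Extracting I σ S l k s' ∧ s'.mem 6 = s.mem 6 ∧ IsAnswer I σ S k y (s'.mem 5 0) ∧
      ratSize (s'.mem 5 0) ≤ I.bigS := by
  obtain ⟨T, hT, hrun⟩ := run_queryProg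
  refine ⟨fun d => 2 + T d, (IsPoly.const 2).add hT,
    fun O hO I K hK s S σ k y l hσ hy hl hs => ?_⟩
  refine Runs.seq (P := fun x => x = s.setIdx 6 y) (Runs.setIdx ?_ rfl) ?_
  · simp only [IExpr.eval]; unfold idxBound at hK; omega
  rintro _ rfl
  have hag : Agree [6] [] s (s.setIdx 6 y) := (Agree.refl _ _ _).setIdx (by simp) y
  have hs' := hs.agree hag (by simp) (by simp)
  have hy' : (s.setIdx 6 y).idx 6 = y := setIdx_idx_self _ _ _
  refine Runs.mono (hrun O hO I K hK _ S hs'.toSetup hs'.act (by rw [hs'.hσ]; exact hσ)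
    (by rw [hy']; exact hy) (by rw [hs'.hφ]) (fun _ => by rw [hs'.hσ]; exact hl.indep)) le_rfl ?_
  rintro s'' ⟨h1, h2, l', h3, h4⟩
  rw [hs'.hσ, hs'.hφ, hs'.hj, hy'] at h3 h4
  exact ⟨hs'.agree h1 (by simp) (by simp), h1.mem 6 (by simp), ⟨l', h3, h4⟩, h2⟩

theorem Extracting.setCell {I : LPInst} {σ k : ℕ} {S : Finset (Fin I.N)} {l : Fin I.N → ℚ}
    {s : State} (h : Extracting I σ S l k s) (i : ℕ) (x : ℚ) :
    Extracting I σ S l k (s.setCell 6 i x) :=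
  h.agree ((Agree.refl [] [6] s).setCell (by simp) i x) (by simp) (by simp)

theorem Extracting.next {I : LPInst} {σ k : ℕ} {S : Finset (Fin I.N)} {l : Fin I.N → ℚ}
    {s : State} (h : Extracting I σ S l k s) (hk : k < I.N) :
    Extracting I σ S l (k + 1) ((s.setCell 7 k (l ⟨k, hk⟩)).setIdx 2 (k + 1)) where
  toSetup := h.toSetup.agree (((Agree.refl [2] [7] s).setCell (by simp) k _).setIdx (by simp) _)
    (by simp) (by simp)
  act := h.act
  hσ := h.hσ
  hφ := h.hφ
  hj := setIdx_idx_self _ _ _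
  sol i hi := by
    rw [setIdx_mem]
    rcases Nat.lt_succ_iff_lt_or_eq.mp hi with h' | h'
    · rw [setCell_mem_ne _ _ h'.ne]; exact h.sol i h'
    · rw [h', setCell_mem_self, ← show i = ⟨k, hk⟩ from Fin.ext h']

/-- The factor from the indicator array gives the correct value 0 for columns outside S, where the
formula from the answers is not used. -/
theorem coeffX_eval {I : LPInst} {σ k : ℕ} {S : Finset (Fin I.N)} {l : Fin I.N → ℚ} {s : State}
    (hσ : σ ≤ 1) (hl : IsSolution I σ S l) (h : Extracting I σ S l k s) (hk : k < I.N)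
    (h0 : IsAnswer I σ S k 0 (s.mem 6 0)) (h1 : IsAnswer I σ S k 1 (s.mem 6 1))
    (h2 : IsAnswer I σ S k 2 (s.mem 5 0)) : coeffX.eval s = l ⟨k, hk⟩ := by
  have hact : s.mem 3 k = if (⟨k, hk⟩ : Fin I.N) ∈ S then 1 else 0 := h.act ⟨k, hk⟩
  simp only [coeffX, ans0X, ans1X, ansX, QExpr.eval, IExpr.eval, h.hj, hact]
  split_ifs with hS
  · obtain ⟨c, hc, hval⟩ := hl.answer hσ hS
    rw [hval 0 (by norm_num) _ h0, hval 1 (by norm_num) _ h1, hval 2 le_rfl _ h2, one_mul]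
    exact coeff_eq hc
  · rw [zero_mul, hl.off _ hS]

/-- Each query overwrites the answer in array 5, so the first two answers are saved in array 6 and
the third is read in place. -/
theorem run_extractProg : ∃ T : ℕ → ℕ, IsPoly T ∧ ∀ (O : Oracle), O.Solves DVS →
    ∀ (I : LPInst) (K : ℕ), idxBound I.dim ≤ K → ∀ (s : State) (S : Finset (Fin I.N)) (σ : ℕ)
    (l : Fin I.N → ℚ), σ ≤ 1 → IsSolution I σ S l → Extracting I σ S l 0 (s.setIdx 2 0) →
    Runs O K I.bigS extractProg s (T I.dim) (Extracting I σ S l I.N) := by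
  obtain ⟨T, hT, hrun⟩ := run_position
  refine ⟨fun d => 2 + (idxBound d + 1) * (colsX.cost + 6 + (T d + (((IExpr.const 0).cost +
    ansX.cost + 1) + (T d + (((IExpr.const 1).cost + ansX.cost + 1) + (T d +
    ((IExpr.var 2).cost + coeffX.cost + 1))))))), ?_, fun O hO I K hK s S σ l hσ hl hs => ?_⟩
  · exact (IsPoly.const 2).add ((isPoly_idxBound.add (.const 1)).mul ((IsPoly.const _).add
      (hT.add ((IsPoly.const _).add (hT.add ((IsPoly.const _).add (hT.add (.const _))))))))
  refine Runs.forLoop (n := I.N) (Extracting I σ S l)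
    ((Nat.le_succ _).trans I.N_succ_le_idxBound) hK hs (fun k s' h => ⟨h.hj, colsX_eval h.hm h.hn⟩)
    fun k hk s' hs' => ?_
  refine Runs.seq (hrun O hO I K hK s' S σ k 0 l hσ (by norm_num) hl hs') ?_
  rintro s₁ ⟨h1, -, a1, z1⟩
  refine Runs.seq (P := fun x => Extracting I σ S l k x ∧ IsAnswer I σ S k 0 (x.mem 6 0))
    (Runs.setCell z1 ⟨h1.setCell _ _, ?_⟩) ?_
  · exact (setCell_mem_self s₁ 6 0 _).symm ▸ a1
  rintro s₂ ⟨h2, a2⟩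
  refine Runs.seq (hrun O hO I K hK s₂ S σ k 1 l hσ (by norm_num) hl h2) ?_
  rintro s₃ ⟨h3, m3, a3, z3⟩
  refine Runs.seq (P := fun x => Extracting I σ S l k x ∧ IsAnswer I σ S k 0 (x.mem 6 0) ∧
    IsAnswer I σ S k 1 (x.mem 6 1)) (Runs.setCell z3 ⟨h3.setCell _ _, ?_, ?_⟩) ?_
  · have h : (s₃.setCell 6 1 (ansX.eval s₃)).mem 6 0 = s₂.mem 6 0 := by
      rw [setCell_mem_ne _ _ (by norm_num), m3]
    exact h.symm ▸ a2
  · exact (setCell_mem_self s₃ 6 1 _).symm ▸ a3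
  rintro s₄ ⟨h4, a4, b4⟩
  refine Runs.seq (hrun O hO I K hK s₄ S σ k 2 l hσ le_rfl hl h4) ?_
  rintro s₅ ⟨h5, m5, a5, -⟩
  have hval := coeffX_eval hσ hl h5 hk (m5 ▸ a4) (m5 ▸ b4) a5
  refine Runs.setCell (by rw [hval]; exact hl.ratSize_le _) ?_
  rw [hval, show (IExpr.var 2).eval s₅ = k from h5.hj]
  exact ⟨h5.hj, h5.next hk⟩

/-! ### The output -/

/-- Writing the solution of the linear program. -/
def outProg : Program :=
  .seq (.setCell 0 (.const 0) (.const 0)) (forLoop 2 nX (.setCell 0 (.add (.const 1) (.var 2))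
    (.sub (.cell 7 (.var 2)) (.cell 7 (.add nX (.var 2))))))

/-- The output replaces the numerators of the input in array 0. From here on only the coefficients
in array 7 are read. -/
theorem run_outProg : ∃ T : ℕ → ℕ, IsPoly T ∧ ∀ (O : Oracle) (I : LPInst) (K : ℕ),
    idxBound I.dim ≤ K → ∀ (s : State) (S : Finset (Fin I.N)) (σ : ℕ) (l : Fin I.N → ℚ),
    IsSolution I σ S l → Extracting I σ S l I.N s →
    Runs O K I.bigS outProg s (T I.dim) fun s' =>
      s'.Outputs (0 :: List.ofFn fun j : Fin I.n => l (ixPos j) - l (ixNeg j)) := by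
  refine ⟨fun d => 3 + (2 + (idxBound d + 1) * (nX.cost + 6 +
    ((IExpr.add (.const 1) (.var 2)).cost +
      (QExpr.sub (.cell 7 (.var 2)) (.cell 7 (.add nX (.var 2)))).cost + 1))), ?_,
    fun O I K hK s S σ l hl hs => ?_⟩
  · exact (IsPoly.const 3).add ((IsPoly.const 2).add ((isPoly_idxBound.add (.const 1)).mul
      (.const _)))
  have hN : I.n + I.n ≤ I.N := Nat.le_add_right _ _
  have hD : I.n ≤ idxBound I.dim := by have := I.N_succ_le_idxBound; omega
  have hF : ∀ j : Fin I.n, s.mem 7 j - s.mem 7 (I.n + j) = l (ixPos j) - l (ixNeg j) := by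
    intro j
    rw [← hs.sol (ixPos j) (ixPos j).2, ← hs.sol (ixNeg j) (ixNeg j).2, ixPos_val, ixNeg_val]
  refine Runs.seq (P := fun x => x = s.setCell 0 0 0) (Runs.setCell ?_ rfl) ?_
  · exact_mod_cast I.ratSize_const_le (z := 0) (by norm_num)
  rintro _ rfl
  refine Runs.mono (Runs.fillArray (n := I.n) (off := 1)
    (F := fun i => s.mem 7 i - s.mem 7 (I.n + i)) hD hK ?_ ?_ ?_) le_rfl ?_
  · intro s' h
    exact ⟨(h.idx 1 (by simp)).trans hs.hn, rfl⟩
  · intro s' h _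
    have h7 : s'.mem 7 = s.mem 7 := by
      rw [h.mem 7 (by simp)]
      funext j
      simp [State.setCell]
    have h1 : s'.idx 1 = I.n := (h.idx 1 (by simp)).trans hs.hn
    simp only [QExpr.eval, IExpr.eval, h7, h1]
  · intro i hi
    rw [hF ⟨i, hi⟩]
    exact hl.ratSize_sub_le _ _
  · rintro s' ⟨-, h1, h2⟩ j hj
    cases j with
    | zero => exact (h2 0 one_pos).trans (setCell_mem_self _ _ _ _)
    | succ j =>
      have hj' : j < I.n := by simpa using hj
      refine (congrArg (s'.mem 0) (add_comm j 1)).trans ((h1 j hj').trans ((hF ⟨j, hj'⟩).trans ?_))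
      simp

/-! ### The reduction -/

/-- Solving a system that has been found solvable. -/
def solveProg : Program :=
  .seq greedyProg (.seq (.setIdx 7 (.const 1)) (.seq extractProg outProg))

theorem run_solveProg : ∃ T : ℕ → ℕ, IsPoly T ∧ ∀ (O : Oracle), O.Solves DVS →
    ∀ (I : LPInst) (K : ℕ), idxBound I.dim ≤ K → ∀ (s : State) (S : Finset (Fin I.N)) (σ : ℕ),
    σ ≤ 1 → Ready I σ S s → I.Solvable σ S →
    Runs O K I.bigS solveProg s (T I.dim) fun s' => ∃ S l, IsSolution I σ S l ∧
      s'.Outputs (0 :: List.ofFn fun j : Fin I.n => l (ixPos j) - l (ixNeg j)) := by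
  obtain ⟨T, hT, hrun⟩ := run_greedyProg
  obtain ⟨T', hT', hrun'⟩ := run_extractProg
  obtain ⟨T'', hT'', hrun''⟩ := run_outProg
  refine ⟨fun d => T d + (2 + (T' d + T'' d)), hT.add ((IsPoly.const 2).add (hT'.add hT'')),
    fun O hO I K hK s S σ hσ hs hsol => ?_⟩
  refine Runs.seq (hrun O hO I K hK s S σ hσ hs hsol) ?_
  rintro s₁ ⟨S', h1, h2, h3⟩
  obtain ⟨l, hl⟩ := I.exists_isSolution hσ h2 h3
  refine Runs.seq (P := fun x => x = s₁.setIdx 7 1) (Runs.setIdx ?_ rfl) ?_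
  · simp only [IExpr.eval]; unfold idxBound at hK; omega
  rintro _ rfl
  have hE : Extracting I σ S' l 0 ((s₁.setIdx 7 1).setIdx 2 0) :=
    { toSetup := h1.toSetup.agree (((Agree.refl [2, 7] [] s₁).setIdx (v := 7) (by simp) 1).setIdx
        (v := 2) (by simp) 0) (by simp) (by simp)
      act := h1.act
      hσ := h1.hσ
      hφ := rfl
      hj := rfl
      sol := fun i hi => absurd hi (Nat.not_lt_zero _) }
  refine Runs.seq (hrun' O hO I K hK _ S' σ l hσ hl hE) fun s₂ h4 => ?_
  exact Runs.mono (hrun'' O I K hK s₂ S' σ l hl h4) le_rfl fun s' h => ⟨S', l, hl, h⟩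

/-- Preparing the feasibility tests. -/
def prepareProg : Program :=
  .seq (forLoop 2 colsX (.setCell 3 (.add (.const 0) (.var 2)) (.const 1)))
    (.seq (.setIdx 5 (.const 0)) (.seq (.setIdx 6 (.const 0)) (.setIdx 7 (.const 0))))

theorem run_prepareProg : ∃ T : ℕ → ℕ, IsPoly T ∧ ∀ (O : Oracle) (I : LPInst) (K : ℕ),
    idxBound I.dim ≤ K → ∀ (s : State), Setup I s →
    Runs O K I.bigS prepareProg s (T I.dim) (Ready I 0 Finset.univ) := by
  refine ⟨fun d => 2 + (idxBound d + 1) * (colsX.cost + 6 +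
    ((IExpr.add (.const 0) (.var 2)).cost + (QExpr.const 1).cost + 1)) + (2 + (2 + 2)), ?_,
    fun O I K hK s hs => ?_⟩
  · exact ((IsPoly.const 2).add ((isPoly_idxBound.add (.const 1)).mul (.const _))).add (.const _)
  refine Runs.seq (Runs.fillArray (n := I.N) (off := 0) (F := fun _ => 1)
    ((Nat.le_succ _).trans I.N_succ_le_idxBound) hK ?_ (fun _ _ _ => rfl) ?_) ?_
  · intro s' h
    have h' := hs.agree h (by simp) (by simp)
    exact ⟨colsX_eval h'.hm h'.hn, rfl⟩
  · intro i _
    exact_mod_cast I.ratSize_const_le (z := 1) (by norm_num)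
  rintro s₁ ⟨h1, h2, -⟩
  refine Runs.seq (P := fun x => x = s₁.setIdx 5 0) (Runs.setIdx (Nat.zero_le _) rfl) ?_
  rintro _ rfl
  refine Runs.seq (P := fun x => x = (s₁.setIdx 5 0).setIdx 6 0)
    (Runs.setIdx (Nat.zero_le _) rfl) ?_
  rintro _ rfl
  refine Runs.setIdx (Nat.zero_le _) ?_
  exact
    { toSetup := hs.agree ((((h1.weaken (V' := [2, 5, 6, 7]) (A' := [3]) (by simp)
        (by simp)).setIdx (v := 5) (by simp) 0).setIdx (v := 6) (by simp) 0).setIdx (v := 7)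
        (by simp) 0) (by simp) (by simp)
      act := fun i => by
        have := h2 i i.2
        rw [zero_add] at this
        simpa [setIdx_mem] using this
      hσ := rfl
      hy := rfl
      hφ := rfl }

/-- The program reducing `LP` to `DVS`. -/
def mainProg : Program :=
  .seq setupProg (.seq prepareProg (.seq queryProg (.branch testX
    (.seq (.setIdx 5 (.const 1)) (.seq queryProg (.branch testX solveProg
      (.setCell 0 (.const 0) (.const 2)))))
    (.setCell 0 (.const 0) (.const 1)))))

theorem outputs_setCell (s : State) (x : ℚ) : (s.setCell 0 0 x).Outputs [x] := by
  intro j hj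
  obtain rfl : j = 0 := by simpa using hj
  exact setCell_mem_self _ _ _ _

theorem IsSolution.isCorrect {I : LPInst} {S : Finset (Fin I.N)} {l : Fin I.N → ℚ}
    (h : IsSolution I 1 S l) : I.IsCorrect (.optimal fun j => l (ixPos j) - l (ixNeg j)) := by
  have h1 := I.cols_eq 1
  have h2 := I.rhsV_eq 1
  rw [Nat.cast_one] at h1 h2
  refine optimal_of_resid I.isScaled (by exact_mod_cast I.bigW_pos) h.nonneg ?_
  rw [h1, h2]
  exact sub_eq_zero.mpr h.sum_eq.symm

/-- The test with σ = 0 decides feasibility. For a feasible program the test with σ = 1 decides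
whether primal and dual solutions with equal objectives exist, and its failure means an infinite
value. -/
theorem run_mainProg : ∃ T : ℕ → ℕ, IsPoly T ∧ ∀ (O : Oracle), O.Solves DVS →
    ∀ (I : LPInst) (K : ℕ), idxBound I.dim ≤ K →
    Runs O K I.bigS mainProg (State.init (LP.encInst I)) (T I.dim) fun s' =>
      ∃ y : LP.Out I, s'.Outputs (LP.encOut I y) ∧ LP.IsCorrect I y := by
  obtain ⟨T₁, hT₁, hrun₁⟩ := run_setupProg
  obtain ⟨T₂, hT₂, hrun₂⟩ := run_prepareProg
  obtain ⟨T₃, hT₃, hrun₃⟩ := run_test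
  obtain ⟨T₄, hT₄, hrun₄⟩ := run_solveProg
  refine ⟨fun d => T₁ d + (T₂ d + (T₃ d + (testX.cost + (2 + (T₃ d + (testX.cost +
    (3 + T₄ d))))))), hT₁.add (hT₂.add (hT₃.add ((IsPoly.const _).add ((IsPoly.const 2).add
    (hT₃.add ((IsPoly.const _).add ((IsPoly.const 3).add hT₄))))))), fun O hO I K hK => ?_⟩
  have hW : (0 : ℚ) < I.bigW := by exact_mod_cast I.bigW_pos
  have c0 := I.cols_eq 0
  have r0 := I.rhsV_eq 0
  have c1 := I.cols_eq 1
  have r1 := I.rhsV_eq 1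
  rw [Nat.cast_zero] at c0 r0
  rw [Nat.cast_one] at c1 r1
  refine Runs.seq (hrun₁ O I K hK _ (hasInput_init I)) fun s₁ h1 => ?_
  refine Runs.seq (hrun₂ O I K hK s₁ h1) fun s₂ h2 => ?_
  refine Runs.seq (hrun₃ O hO I K hK s₂ _ 0 zero_le_one h2) ?_
  rintro s₃ ⟨-, h3, ht3⟩
  refine Runs.branch (fun h => ?_) fun h => ?_
  · have hfeas := ht3.mp h
    refine Runs.seq (P := fun x => x = s₃.setIdx 5 1) (Runs.setIdx ?_ rfl) ?_
    · simp only [IExpr.eval]; unfold idxBound at hK; omega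
    rintro _ rfl
    have h4 : Ready I 1 Finset.univ (s₃.setIdx 5 1) :=
      { toSetup := h3.toSetup.agree ((Agree.refl [5] [] s₃).setIdx (by simp) 1) (by simp) (by simp)
        act := h3.act
        hσ := rfl
        hy := h3.hy
        hφ := h3.hφ }
    refine Runs.seq (hrun₃ O hO I K hK _ _ 1 le_rfl h4) ?_
    rintro s₄ ⟨-, h5, ht5⟩
    refine Runs.branch (fun h => ?_) fun h => ?_
    · refine Runs.mono (hrun₄ O hO I K hK s₄ _ 1 le_rfl h5 (ht5.mp h)) (by omega) ?_
      rintro s' ⟨S, l, hl, hout⟩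
      exact ⟨.optimal _, hout, hl.isCorrect⟩
    · refine Runs.mono (Runs.setCell (P := fun x => x = s₄.setCell 0 0 2) ?_ rfl) ?_ ?_
      · exact_mod_cast I.ratSize_const_le (z := 2) le_rfl
      · simp only [IExpr.cost, QExpr.cost]; omega
      · rintro _ rfl
        refine ⟨.infinite, outputs_setCell _ _, infinite_of_not_coneMem I.isScaled hW ?_ ?_⟩
        · rw [c0, r0]; exact hfeas
        · rw [c1, r1]; exact fun hc => h (ht5.mpr hc)
  · refine Runs.mono (Runs.setCell (P := fun x => x = s₃.setCell 0 0 1) ?_ rfl) ?_ ?_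
    · exact_mod_cast I.ratSize_const_le (z := 1) (by norm_num)
    · simp only [IExpr.cost, QExpr.cost]; omega
    · rintro _ rfl
      refine ⟨.infeasible, outputs_setCell _ _, infeasible_of_not_coneMem I.isScaled hW ?_⟩
      rw [c0, r0]; exact fun hc => h (ht3.mpr hc)

end StrongPoly


theorem mainTheorem2 : StrongPoly.Reduces StrongPoly.LP StrongPoly.DVS := by
  obtain ⟨T, hT, hrun⟩ := StrongPoly.run_mainProg
  -- One polynomial has to bound both the steps and the indices, so the two bounds are added.
  obtain ⟨p, hp⟩ := hT.add StrongPoly.isPoly_idxBound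
  refine ⟨StrongPoly.mainProg, p, 300 * (.X + 1) ^ 3, fun O hO I => ?_⟩
  have hS : (300 * (.X + 1) ^ 3 : Polynomial ℕ).eval (StrongPoly.LP.encInst I).bitSize =
      I.bigS := by
    simp [StrongPoly.LPInst.bigS, StrongPoly.LPInst.u]
  rw [hS, I.dim_eq, ← hp]
  obtain ⟨s, t, h1, h2, y, h3, h4⟩ := hrun O hO I _ (Nat.le_add_left _ (T I.dim))
  exact ⟨y, s, t, h1, h2.trans (Nat.le_add_right _ _), h3, h4⟩
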